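/- Let $\Sigma$ be a (connected) Riemann surface with complex structure $j$, and let $\times$ be the cross product of $\mathbb{R}^7$ given on the canonical basis by $e_1\times e_2=e_3$, $e_1\times e_4=e_5$, $e_1\times e_7=e_6$, $e_2\times e_4=e_6$, $e_2\times e_5=e_7$, $e_3\times e_4=e_7$, $e_3\times e_6=e_5$, extended bilinearly so that it is skew-symmetric and each of these relations holds cyclically ($a\times b=c$ implies $b\times c=a$ and $c\times a=b$). Let $\varphi:\Sigma\to S^6\subset\mathbb{R}^7$ be a conformal harmonic immersion, and let $F:\Sigma\to\mathbb{R}^7$ be a smooth map with $dF=\varphi\times *d\varphi$, that is, $dF(u)=\varphi\times d\varphi(ju)$ for all tangent vectors $u$ (in a conformal coordinate $x+iy$: $F_x=\varphi\times\varphi_y$ and $F_y=-\varphi\times\varphi_x$); $F$ is then an immersion. Let $\varphi_0,\varphi_1,\varphi_2,\dots\subseteq\Sigma\times\mathbb{C}^7$ be the harmonic sequence of $\varphi$, regarded as a map into $\mathbb{R}P^6\subset\mathbb{C}P^6$: $\varphi_0$ is the complex line bundle spanned by $\varphi$, and $\varphi_{k+1}$ is the image of the map $s\mapsto P^{\perp}_{\varphi_k}(\partial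 s/\partial z)$ on sections $s$ of $\varphi_k$, with singularities removed, where $P^\perp_{\varphi_k}$ is the Hermitian projection onto the orthogonal bundle of $\varphi_k$. A subbundle is called isotropic if the complex bilinear extension of the inner product of $\mathbb{R}^7$ vanishes on its fibres. The immersion $F$ is called isotropic if at each point $p$ the normal vectors $\mathrm{II}_F(u,u)$, with $u$ a unit tangent vector at $p$ for the induced metric, all have the same length; it is called pseudo-umbilical if $\mathrm{II}_F\cdot\mathbf{h}_F=\lambda\,\mathrm{I}_F$ for some smooth function $\lambda$ on $\Sigma$, where $\mathrm{I}_F$, $\mathrm{II}_F$ are the first and second fundamental forms of $F$ and $\mathbf{h}_F=\frac12\operatorname{tr}(\mathrm{I}_F^{-1}\mathrm{II}_F)$ is its mean curvature vector. Then $F$ is isotropic if and only if $F$ is pseudo-umbilical and $\varphi_2$ is isotropic (that is, either $\varphi_2=\{0\}$ or $\varphi_2$ is an isotropic line bundle). In particular, if $F$ is isotropic then, up to change of orientation of $\Sigma$ (that is, up to replacing $j$ by $-j$), at least one of the following statements holds: 1. $\varphi$ is an almost complex curve, that is, a non-constant smooth map into $S^6$ with $d\varphi(ju)=\varphi\times d\varphi(u)$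 for all tangent vectors $u$; 2. there are a unit vector $\mathbf{v}\in\mathbb{R}^7$, an angle $\beta$, and an almost complex curve $\tilde\varphi:\Sigma\to S^6\cap\mathbf{v}^\perp$ of type (III) (that is, linearly full in a totally geodesic $S^5\subset S^6$: its image spans a $6$-dimensional subspace of $\mathbb{R}^7$), such that $\varphi=R_{\mathbf{v}}(\beta)\tilde\varphi$, where $R_{\mathbf{v}}(\beta)\in SO(7)$ is the rotation that fixes $\mathbf{v}$ and sends $\mathbf{x}\perp\mathbf{v}$ to $\cos\beta\,\mathbf{x}+\sin\beta\,\mathbf{v}\times\mathbf{x}$; 3. $\varphi$ is totally geodesic; 4. $\varphi$ is superminimal (that is, $\varphi_k=\{0\}$ for some $k>0$) and takes values in $S^4=S^6\cap W$ for some $5$-dimensional vector subspace $W$ of $\mathbb{R}^7$. -/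

import Mathlib

open scoped Manifold ContDiff Topology InnerProductSpace

noncomputable section

namespace CrossSurface

/-- Euclidean `ℝ⁷`. -/
abbrev E7 : Type := EuclideanSpace ℝ (Fin 7)

/-- `ℂ⁷ = ℝ⁷ ⊗ ℂ` with its standard Hermitian inner product. -/
abbrev C7 : Type := EuclideanSpace ℂ (Fin 7)

/-- The cross product of `ℝ⁷` with (for `𝐞₁, …, 𝐞₇` the canonical basis, indexed here from `0`)
`𝐞₁ × 𝐞₂ = 𝐞₃`, `𝐞₁ × 𝐞₄ = 𝐞₅`, `𝐞₁ × 𝐞₇ = 𝐞₆`, `𝐞₂ × 𝐞₄ = 𝐞₆`, `𝐞₂ × 𝐞₅ = 𝐞₇`,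
`𝐞₃ × 𝐞₄ = 𝐞₇`, `𝐞₃ × 𝐞₆ = 𝐞₅`, extended cyclically and skew-symmetrically. -/
def cross (x y : E7) : E7 :=
  !₂[x 1 * y 2 - x 2 * y 1 + (x 3 * y 4 - x 4 * y 3) + (x 6 * y 5 - x 5 * y 6),
     x 2 * y 0 - x 0 * y 2 + (x 3 * y 5 - x 5 * y 3) + (x 4 * y 6 - x 6 * y 4),
     x 0 * y 1 - x 1 * y 0 + (x 3 * y 6 - x 6 * y 3) + (x 5 * y 4 - x 4 * y 5),
     x 4 * y 0 - x 0 * y 4 + (x 5 * y 1 - x 1 * y 5) + (x 6 * y 2 - x 2 * y 6),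
     x 0 * y 3 - x 3 * y 0 + (x 6 * y 1 - x 1 * y 6) + (x 2 * y 5 - x 5 * y 2),
     x 0 * y 6 - x 6 * y 0 + (x 1 * y 3 - x 3 * y 1) + (x 4 * y 2 - x 2 * y 4),
     x 5 * y 0 - x 0 * y 5 + (x 1 * y 4 - x 4 * y 1) + (x 2 * y 3 - x 3 * y 2)]

/-- For a unit vector `v`, the rotation `R_v(β)` of `ℝ⁷`: it fixes `v`, and sends `x ⟂ v` to
`cos β x + sin β v × x`. -/
def rotation (v : E7) (β : ℝ) (x : E7) : E7 :=
  ⟪v, x⟫_ℝ • v + (Real.cos β • (x - ⟪v, x⟫_ℝ • v) + Real.sin β • cross v x)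

section Calculus

variable {M : Type*} [TopologicalSpace M] [ChartedSpace ℂ M]

/-- The differential at `p` of a map from a Riemann surface to a real normed space. The tangent
space at `p` is `ℂ` (through the preferred holomorphic chart at `p`), and its complex structure is
multiplication by `Complex.I`. -/
def D {E : Type*} [NormedAddCommGroup E] [NormedSpace ℝ E] (f : M → E) (p : M) : ℂ →L[ℝ] E :=
  mfderiv 𝓘(ℝ, ℂ) 𝓘(ℝ, E) f p

/-- The map `f` written in the preferred holomorphic chart at `p`. -/
def loc {E : Type*} (f : M → E) (p : M) : ℂ → E := f ∘ (chartAt ℂ p).symm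

/-- The second derivative at `p` of `f` in the preferred holomorphic chart at `p`. -/
def D2 {E : Type*} [NormedAddCommGroup E] [NormedSpace ℝ E] (f : M → E) (p : M) (u v : ℂ) : E :=
  fderiv ℝ (fderiv ℝ (loc f p)) (chartAt ℂ p p) u v

/-- `∂s/∂z` at `p`, where `z` is the preferred holomorphic chart at `p`. -/
def dz (s : M → C7) (p : M) : C7 :=
  (1 / 2 : ℂ) • (D s p 1 - Complex.I • D s p Complex.I)

/-! ### Maps into the sphere `S⁶` -/

/-- Smooth maps into the unit sphere `S⁶` of `ℝ⁷`. -/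
structure IsSmoothIntoS6 (φ : M → E7) : Prop where
  smooth : ContMDiff 𝓘(ℝ, ℂ) 𝓘(ℝ, E7) ∞ φ
  mem_sphere : ∀ p, φ p ∈ Metric.sphere (0 : E7) 1

/-- `φ : Σ → S⁶` is harmonic: the Laplacian of `φ` (with respect to a local conformal coordinate)
is orthogonal to the tangent space of `S⁶` at `φ`. -/
def IsHarmonicMap (φ : M → E7) : Prop :=
  ∀ p, ∀ u : E7, ⟪φ p, u⟫_ℝ = 0 → ⟪D2 φ p 1 1 + D2 φ p Complex.I Complex.I, u⟫_ℝ = 0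

/-- Conformal immersions: the differential is, at every point, a nonzero multiple of a linear
isometry. -/
def IsConformalImmersion (φ : M → E7) : Prop := ∀ p, IsConformalMap (D φ p)

/-- Almost complex curves: non-constant smooth maps `φ : Σ → S⁶` with `dφ ∘ j = J ∘ dφ`, where
`J u = φ × u` and where `j` is the complex structure of `Σ` if `ε = 1`, and that of `Σ` with the
opposite orientation if `ε = -1`. -/
structure IsAlmostComplexCurve (ε : ℤˣ) (φ : M → E7) : Prop where
  smooth : IsSmoothIntoS6 φ
  nonconstant : ∃ p q, φ p ≠ φ q
  complexLinear : ∀ p (u : ℂ), D φ p (((ε : ℤ) : ℂ) * Complex.I * u) = cross (φ p) (D φ p u)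

/-- Almost complex curves of type (III): linearly full in some totally geodesic `S⁵ ⊂ S⁶`. -/
structure IsAlmostComplexCurveIII (ε : ℤˣ) (φ : M → E7) : Prop where
  almostComplex : IsAlmostComplexCurve ε φ
  full : Module.finrank ℝ (Submodule.span ℝ (Set.range φ)) = 6

/-- The immersion `φ : Σ → S⁶` is totally geodesic: its second fundamental form in `S⁶` vanishes,
that is, all second derivatives of `φ` are in `ℝ φ ⊕ Tφ`. -/
def IsTotallyGeodesic (φ : M → E7) : Prop :=
  ∀ p (u v : ℂ), D2 φ p u v ∈ Submodule.span ℝ {φ p} ⊔ LinearMap.range (D φ p).toLinearMap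

/-! ### The harmonic sequence -/

/-- The fibre at `q` of the image of the second fundamental form
`A'_L(s) = P_L^⊥ (∂s/∂z)`, `s` a smooth local section of the bundle `L ⊆ Σ × ℂ⁷`. -/
def secondFundImage (L : M → Submodule ℂ C7) (q : M) : Set C7 :=
  {w | ∃ s : M → C7, ContMDiffAt 𝓘(ℝ, ℂ) 𝓘(ℝ, C7) ∞ s q ∧ (∀ᶠ x in 𝓝 q, s x ∈ L x) ∧
    w = (L q)ᗮ.starProjection (dz s q)}

/-- The bundle following `L` in a harmonic sequence: the image of `A'_L`, with the singularities
(the isolated zeros of `A'_L`) removed by taking the closure in `Σ × ℂ⁷`. -/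
def nextBundle (L : M → Submodule ℂ C7) (p : M) : Submodule ℂ C7 :=
  Submodule.span ℂ {w | (p, w) ∈ closure {y : M × C7 | y.2 ∈ secondFundImage L y.1}}

/-- The elements `φ₀, φ₁, φ₂, …` of the harmonic sequence of `φ : Σ → S⁶`, seen as a map to
`ℝP⁶ ⊂ ℂP⁶`. -/
def harmonicSeq (φ : M → E7) : ℕ → M → Submodule ℂ C7
  | 0 => fun p => Submodule.span ℂ {WithLp.toLp 2 fun i => ((φ p i : ℝ) : ℂ)}
  | n + 1 => nextBundle (harmonicSeq φ n)

/-- `L` is the zero bundle. -/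
def IsZeroBundle (L : M → Submodule ℂ C7) : Prop := ∀ p, L p = ⊥

/-- `L` is a smooth complex line subbundle of `Σ × ℂ⁷`. -/
def IsLineBundle (L : M → Submodule ℂ C7) : Prop :=
  ∀ p, ∃ U : Set M, IsOpen U ∧ p ∈ U ∧ ∃ s : M → C7, ContMDiffOn 𝓘(ℝ, ℂ) 𝓘(ℝ, C7) ∞ s U ∧
    ∀ q ∈ U, s q ≠ 0 ∧ L q = Submodule.span ℂ {s q}

/-- `L` is an isotropic line bundle: a line bundle on whose fibres the complex bilinear extension
of the inner product of `ℝ⁷` vanishes. -/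
structure IsIsotropicLineBundle (L : M → Submodule ℂ C7) : Prop where
  lineBundle : IsLineBundle L
  isotropic : ∀ p, ∀ x ∈ L p, ∀ y ∈ L p, ∑ i, x i * y i = 0

/-- `φ` is superminimal: some element `φ_j`, `j > 0`, of its harmonic sequence is zero. -/
def IsSuperminimal (φ : M → E7) : Prop := ∃ j : ℕ, 0 < j ∧ IsZeroBundle (harmonicSeq φ j)

/-! ### The associated surface and its extrinsic geometry -/

/-- `F : Σ → ℝ⁷` satisfies `dF = φ × *dφ`, where `(*dφ)(u) = dφ(j u)`: in a conformal coordinate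
`x + i y`, `F_x = φ × φ_y` and `F_y = - φ × φ_x`. -/
structure IsAssociatedSurface (φ F : M → E7) : Prop where
  smooth : ContMDiff 𝓘(ℝ, ℂ) 𝓘(ℝ, E7) ∞ F
  deriv_eq : ∀ p (u : ℂ), D F p u = cross (φ p) (D φ p (Complex.I * u))

/-- The first fundamental form. -/
def firstFF (F : M → E7) (p : M) (u v : ℂ) : ℝ := ⟪D F p u, D F p v⟫_ℝ

/-- The second fundamental form: the normal component of the second derivative. -/
def secondFF (F : M → E7) (p : M) (u v : ℂ) : E7 :=
  (LinearMap.range (D F p).toLinearMap)ᗮ.starProjection (D2 F p u v)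

/-- The real basis `∂/∂x = 1`, `∂/∂y = i` of the tangent space. -/
def frame : Fin 2 → ℂ := ![1, Complex.I]

/-- The mean curvature vector `½ tr (I⁻¹ II)`. -/
def meanCurvature (F : M → E7) (p : M) : E7 :=
  (1 / 2 : ℝ) • ∑ i, ∑ j,
    ((Matrix.of fun k l => firstFF F p (frame k) (frame l))⁻¹ i j) •
      secondFF F p (frame i) (frame j)

/-- `F` is pseudo-umbilical: `II · h = λ I` for some smooth function `λ`, with `h` the mean
curvature vector. -/
def IsPseudoUmbilical (F : M → E7) : Prop :=
  ∃ l : M → ℝ, ContMDiff 𝓘(ℝ, ℂ) 𝓘(ℝ, ℝ) ∞ l ∧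
    ∀ p (u v : ℂ), ⟪secondFF F p u v, meanCurvature F p⟫_ℝ = l p * firstFF F p u v

/-- `F` is isotropic: at each point, all the normal curvature vectors `II(u, u)`, `u` a unit
tangent vector, have the same length. -/
def IsIsotropicImmersion (F : M → E7) : Prop :=
  ∀ p (u v : ℂ), firstFF F p u u = 1 → firstFF F p v v = 1 →
    ‖secondFF F p u u‖ = ‖secondFF F p v v‖

end Calculus

end CrossSurface

end

open CrossSurface

open scoped Manifold ContDiff Topology InnerProductSpace

noncomputable section

namespace CrossSurface

/-! ### The cross product over `ℝ` and `ℂ` -/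

section Algebra

variable {𝕜 : Type*} [RCLike 𝕜]

/-! Write `f` for `φ` in a conformal coordinate, complexified, and let `f₂` be the part of `f_zz`
orthogonal to `f_z`. The tangential and normal parts of the second derivatives of `F` can be
computed from the 2-jet of `f`: the mean curvature vector is `f_x × f_y / |f_x|²`, a unit vector,
and the traceless part of the second fundamental form is spanned by the normal parts of `f × f_xy`
and `f × f_yy`. Hence pseudo-umbilicity is condition B, `(f × f_zz, f_z × f_z̄) = 0`
(`isPseudoUmbilical_iff`), while constant length of `II(u,u)` on unit vectors is B together with
condition A, `(f_zz, f_zz) = 0` (`isIsotropicImmersion_iff`). Since `(f₂, f₂) = (f_zz, f_zz)`,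
condition A is isotropy of `φ₂`, provided the zeros of `f₂` can be removed
(`harmonicSeq_two_isotropic_iff`). They can, because `f₂` solves a linear equation `∂f₂/∂z̄ = A f₂`
with smooth `A`, whose solutions vanish locally or have the form `(z - c)^k g` with `g(c) ≠ 0`
(`eventually_eq_zero_or_exists_eq_pow_smul`).

For the classification, B and its `z̄`-derivative place `f × (f_z × f₂)` and `f × (f_z × f̄₂)` in
the two-dimensional complement of `f, f_z, f_z̄, f₂, f̄₂`. Isotropy forces them to be parallel, and
then one of the two products vanishes (`bicross_eq_zero_or`); differentiating once more gives `f_z ×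
f̄₂ = 0` everywhere (`bicross_cj_second_eq_zero`). This says that `n = f_x × f_y / |f_x|²` satisfies
`n_z = -i f × f_z`, so that both `(f, n)` and `f × n` are constant on the connected surface.

On tangent vectors `n × ·` is the complex structure of `Σ`. If `f × n = 0`, then `n = ±f` and `φ` is
almost complex for one of the orientations. Otherwise the constant vector `f × n` gives the axis
`v`; with `(f, n) = cos 3β`, the map `R_v(-β) φ` is almost complex, and it is full in `v^⊥` as soon
as `f₂` is not identically zero. If `f₂` vanishes identically, `φ` is totally geodesic. The argument
always ends in one of the first three alternatives. -/

/-- The bilinear dot product of `𝕜⁷`. -/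
def dot (x y : EuclideanSpace 𝕜 (Fin 7)) : 𝕜 := ∑ i, x i * y i

/-- The bilinear cross product of `𝕜⁷`. -/
def bicross (x y : EuclideanSpace 𝕜 (Fin 7)) : EuclideanSpace 𝕜 (Fin 7) :=
  !₂[x 1 * y 2 - x 2 * y 1 + (x 3 * y 4 - x 4 * y 3) + (x 6 * y 5 - x 5 * y 6),
     x 2 * y 0 - x 0 * y 2 + (x 3 * y 5 - x 5 * y 3) + (x 4 * y 6 - x 6 * y 4),
     x 0 * y 1 - x 1 * y 0 + (x 3 * y 6 - x 6 * y 3) + (x 5 * y 4 - x 4 * y 5),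
     x 4 * y 0 - x 0 * y 4 + (x 5 * y 1 - x 1 * y 5) + (x 6 * y 2 - x 2 * y 6),
     x 0 * y 3 - x 3 * y 0 + (x 6 * y 1 - x 1 * y 6) + (x 2 * y 5 - x 5 * y 2),
     x 0 * y 6 - x 6 * y 0 + (x 1 * y 3 - x 3 * y 1) + (x 4 * y 2 - x 2 * y 4),
     x 5 * y 0 - x 0 * y 5 + (x 1 * y 4 - x 4 * y 1) + (x 2 * y 3 - x 3 * y 2)]

variable (a b c d : EuclideanSpace 𝕜 (Fin 7)) (r : 𝕜)

theorem dot_comm : dot a b = dot b a := by simp [dot, mul_comm]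

theorem dot_add_left : dot (a + b) c = dot a c + dot b c := by
  simp [dot, add_mul, Finset.sum_add_distrib]

theorem dot_smul_left : dot (r • a) b = r * dot a b := by
  simp [dot, Finset.mul_sum, mul_assoc]

theorem bicross_add_left : bicross (a + b) c = bicross a c + bicross b c := by
  ext i; fin_cases i <;> simp [bicross] <;> ring

theorem bicross_smul_left : bicross (r • a) b = r • bicross a b := by
  ext i; fin_cases i <;> simp [bicross] <;> ring

theorem bicross_anticomm : bicross a b = -bicross b a := by
  ext i; fin_cases i <;> simp [bicross] <;> ring

theorem bicross_self : bicross a a = 0 := by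
  ext i; fin_cases i <;> simp [bicross] <;> ring

theorem dot_add_right : dot a (b + c) = dot a b + dot a c := by
  simp only [dot_comm a, dot_add_left]

theorem dot_smul_right : dot a (r • b) = r * dot a b := by
  simp only [dot_comm a, dot_smul_left]

theorem bicross_add_right : bicross a (b + c) = bicross a b + bicross a c := by
  ext i; fin_cases i <;> simp [bicross] <;> ring

theorem bicross_smul_right : bicross a (r • b) = r • bicross a b := by
  ext i; fin_cases i <;> simp [bicross] <;> ring

/-- The dot product as a bilinear map. -/
def dotₗ : EuclideanSpace 𝕜 (Fin 7) →ₗ[𝕜] EuclideanSpace 𝕜 (Fin 7) →ₗ[𝕜] 𝕜 :=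
  LinearMap.mk₂ 𝕜 dot dot_add_left (fun r a b => dot_smul_left a b r) dot_add_right
    (fun r a b => dot_smul_right a b r)

/-- The cross product as a bilinear map. -/
def bicrossₗ : EuclideanSpace 𝕜 (Fin 7) →ₗ[𝕜] EuclideanSpace 𝕜 (Fin 7) →ₗ[𝕜]
    EuclideanSpace 𝕜 (Fin 7) :=
  LinearMap.mk₂ 𝕜 bicross bicross_add_left (fun r a b => bicross_smul_left a b r)
    bicross_add_right (fun r a b => bicross_smul_right a b r)

/-- The dot product as a continuous bilinear map. -/
def dotL : EuclideanSpace 𝕜 (Fin 7) →L[𝕜] EuclideanSpace 𝕜 (Fin 7) →L[𝕜] 𝕜 :=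
  dotₗ.toContinuousBilinearMap

/-- The cross product as a continuous bilinear map. -/
def bicrossL : EuclideanSpace 𝕜 (Fin 7) →L[𝕜] EuclideanSpace 𝕜 (Fin 7) →L[𝕜]
    EuclideanSpace 𝕜 (Fin 7) :=
  bicrossₗ.toContinuousBilinearMap

@[simp] theorem dotL_apply : dotL a b = dot a b := rfl

@[simp] theorem bicrossL_apply : bicrossL a b = bicross a b := rfl

@[simp] theorem dot_zero_left : dot 0 a = 0 := by simp [dot]
@[simp] theorem dot_zero_right : dot a 0 = 0 := by simp [dot]
@[simp] theorem bicross_zero_right : bicross a 0 = 0 := by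
  simpa using map_zero (bicrossL a)
theorem dot_neg_left : dot (-a) b = -dot a b := by simp [dot]
theorem dot_neg_right : dot a (-b) = -dot a b := by simp [dot]
theorem dot_sub_left : dot (a - b) c = dot a c - dot b c := by
  rw [sub_eq_add_neg, dot_add_left, dot_neg_left, sub_eq_add_neg]
theorem dot_sub_right : dot a (b - c) = dot a b - dot a c := by
  rw [sub_eq_add_neg, dot_add_right, dot_neg_right, sub_eq_add_neg]
theorem bicross_neg_left : bicross (-a) b = -bicross a b := by
  simpa using bicross_smul_left a b (-1)
theorem bicross_neg_right : bicross a (-b) = -bicross a b := by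
  simpa using bicross_smul_right a b (-1)
theorem bicross_sub_left : bicross (a - b) c = bicross a c - bicross b c := by
  rw [sub_eq_add_neg, bicross_add_left, bicross_neg_left, sub_eq_add_neg]
theorem bicross_sub_right : bicross a (b - c) = bicross a b - bicross a c := by
  rw [sub_eq_add_neg, bicross_add_right, bicross_neg_right, sub_eq_add_neg]

/-- The scalar triple product is cyclic. -/
theorem dot_bicross_cyclic : dot a (bicross b c) = dot b (bicross c a) := by
  simp [dot, bicross, Fin.sum_univ_succ]; ring

theorem dot_bicross_left : dot a (bicross a b) = 0 := by
  simp [dot, bicross, Fin.sum_univ_succ]; ring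

theorem dot_bicross_right : dot b (bicross a b) = 0 := by
  simp [dot, bicross, Fin.sum_univ_succ]; ring

/-- With a repeated factor the product obeys the rule familiar from dimension three; for distinct
factors only the polarization `bicross_bicross_swap` survives. For a unit vector `a` this makes `a ×
·` a complex structure on the complement of `a`. -/
theorem bicross_bicross_self : bicross a (bicross a b) = dot a b • a - dot a a • b := by
  ext i; fin_cases i <;> simp [dot, bicross, Fin.sum_univ_succ] <;> ring

/-- The polarized form of `bicross_bicross_self`. -/
theorem bicross_bicross_swap :
    bicross a (bicross b c) =
      dot a c • b + dot b c • a - (2 * dot a b) • c - bicross b (bicross a c) := by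
  ext i; fin_cases i <;> simp [dot, bicross, Fin.sum_univ_succ] <;> ring

theorem dot_bicross_bicross :
    dot (bicross a b) (bicross a c) = dot a a * dot b c - dot a b * dot a c := by
  simp [dot, bicross, Fin.sum_univ_succ]; ring

/-- The polarized form of `dot_bicross_bicross`. -/
theorem dot_bicross_bicross_swap :
    dot (bicross a b) (bicross c d) = 2 * dot a c * dot b d - dot a b * dot c d
      - dot a d * dot b c - dot (bicross c b) (bicross a d) := by
  simp [dot, bicross, Fin.sum_univ_succ]; ring

end Algebra

/-! ### Complexification and conjugation -/

/-- The complexification `ℝ⁷ → ℂ⁷`. -/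
def toC : E7 →L[ℝ] C7 :=
  LinearMap.toContinuousLinearMap
    { toFun := fun x => WithLp.toLp 2 fun i => ((x i : ℝ) : ℂ)
      map_add' := fun x y => by ext i; simp
      map_smul' := fun r x => by ext i; simp }

/-- Complex conjugation on `ℂ⁷`. -/
def cj : C7 →L[ℝ] C7 :=
  LinearMap.toContinuousLinearMap
    { toFun := fun x => WithLp.toLp 2 fun i => (starRingEnd ℂ) (x i)
      map_add' := fun x y => by ext i; simp
      map_smul' := fun r x => by ext i; simp }

@[simp] theorem toC_apply (x : E7) (i : Fin 7) : toC x i = ((x i : ℝ) : ℂ) := rfl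

@[simp] theorem cj_apply (x : C7) (i : Fin 7) : cj x i = (starRingEnd ℂ) (x i) := rfl

@[simp] theorem cj_cj (x : C7) : cj (cj x) = x := by ext i; simp

@[simp] theorem cj_toC (x : E7) : cj (toC x) = toC x := by ext i; simp

theorem cj_smul (c : ℂ) (x : C7) : cj (c • x) = (starRingEnd ℂ) c • cj x := by ext i; simp

theorem toC_injective : Function.Injective toC := fun x y h => by
  ext i
  have := congrArg (fun v : C7 => v i) h
  simpa using this

theorem cj_bicross (x y : C7) : cj (bicross x y) = bicross (cj x) (cj y) := by
  ext i; fin_cases i <;> simp [bicross]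

theorem conj_dot (x y : C7) : (starRingEnd ℂ) (dot x y) = dot (cj x) (cj y) := by
  simp [dot]

theorem toC_cross (x y : E7) : toC (cross x y) = bicross (toC x) (toC y) := by
  ext i; fin_cases i <;> simp [cross, bicross]

theorem dot_toC (x y : E7) : dot (toC x) (toC y) = ((⟪x, y⟫_ℝ : ℝ) : ℂ) := by
  simp [dot, PiLp.inner_apply, mul_comm]

theorem inner_eq_dot (x y : C7) : ⟪x, y⟫_ℂ = dot (cj x) y := by
  simp [dot, PiLp.inner_apply, mul_comm]

theorem inner_eq_dot_real (x y : E7) : ⟪x, y⟫_ℝ = dot x y := by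
  simp [dot, PiLp.inner_apply, mul_comm]

theorem cross_eq_bicross (x y : E7) : cross x y = bicross x y := rfl

theorem dot_cj_self (x : C7) : dot (cj x) x = ((‖x‖ ^ 2 : ℝ) : ℂ) := by
  rw [← inner_eq_dot, inner_self_eq_norm_sq_to_K]; simp

theorem dot_cj_self_eq_zero {x : C7} : dot (cj x) x = 0 ↔ x = 0 := by
  rw [dot_cj_self]; simp

/-! ### Pointwise algebra -/

/-- A vector orthogonal to seven pairwise orthogonal nonzero vectors of `ℂ⁷` is zero. -/
theorem eq_zero_of_orthogonal_family {e : Fin 7 → C7} (he : ∀ i, e i ≠ 0)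
    (ho : Pairwise fun i j => ⟪e i, e j⟫_ℂ = 0) {w : C7} (hw : ∀ i, ⟪e i, w⟫_ℂ = 0) : w = 0 := by
  have hli := linearIndependent_of_ne_zero_of_inner_eq_zero he ho
  have hspan := hli.span_eq_top_of_card_eq_finrank (by simp)
  have hmem : w ∈ (Submodule.span ℂ (Set.range e))ᗮ := by
    rw [Submodule.mem_orthogonal]
    intro u hu
    induction hu using Submodule.span_induction with
    | mem x hx => obtain ⟨i, rfl⟩ := hx; exact hw i
    | zero => simp
    | add x y _ _ hx hy => rw [inner_add_left, hx, hy, add_zero]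
    | smul a x _ hx => rw [inner_smul_left, hx, mul_zero]
  rw [hspan] at hmem
  simpa using hmem

/-- A real unit vector `f` and two isotropic vectors `f₁, f₂` such that `f, f₁, f₂` and the
conjugates of `f₁, f₂` are pairwise orthogonal. -/
structure IsIsotropicFrame (f f₁ f₂ : C7) : Prop where
  real : cj f = f
  unit : dot f f = 1
  ne_zero : f₁ ≠ 0
  dot_zero_one : dot f f₁ = 0
  dot_zero_two : dot f f₂ = 0
  dot_one_one : dot f₁ f₁ = 0
  dot_one_two : dot f₁ f₂ = 0
  dot_two_two : dot f₂ f₂ = 0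
  dot_cj_one_two : dot (cj f₁) f₂ = 0

namespace IsIsotropicFrame

variable {f f₁ f₂ : C7}

/-- The complex orthogonal complement of an isotropic frame. -/
def normal (f f₁ f₂ : C7) : Submodule ℂ C7 where
  carrier := {w | dot f w = 0 ∧ dot f₁ w = 0 ∧ dot (cj f₁) w = 0 ∧ dot f₂ w = 0 ∧
    dot (cj f₂) w = 0}
  add_mem' := by
    rintro a b ⟨h1, h2, h3, h4, h5⟩ ⟨k1, k2, k3, k4, k5⟩
    simp only [Set.mem_ofPred_eq, dot_add_right, *, add_zero, and_self]
  zero_mem' := by simp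
  smul_mem' := by
    rintro c b ⟨h1, h2, h3, h4, h5⟩
    simp only [Set.mem_ofPred_eq, dot_smul_right, *, mul_zero, and_self]

theorem cj_mem_normal (h : IsIsotropicFrame f f₁ f₂) {w : C7} (hw : w ∈ normal f f₁ f₂) :
    cj w ∈ normal f f₁ f₂ := by
  have c : ∀ {x : C7}, dot (cj x) w = 0 → dot x (cj w) = 0 := fun {x} hx => by
    have := congrArg (starRingEnd ℂ) hx
    simpa [conj_dot] using this
  obtain ⟨h1, h2, h3, h4, h5⟩ := hw
  refine ⟨c ?_, c h3, c ?_, c h5, c ?_⟩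
  · rwa [h.real]
  · rwa [cj_cj]
  · rwa [cj_cj]

/-- The complement of an isotropic frame is two-dimensional. -/
theorem eq_zero (h : IsIsotropicFrame f f₁ f₂) (h2 : f₂ ≠ 0) {a b w : C7} (ha : a ≠ 0) (hb : b ≠ 0)
    (hab : dot (cj a) b = 0) (hna : a ∈ normal f f₁ f₂) (hnb : b ∈ normal f f₁ f₂)
    (hnw : w ∈ normal f f₁ f₂) (haw : dot (cj a) w = 0) (hbw : dot (cj b) w = 0) : w = 0 := by
  have hn : ∀ {x : C7}, x ≠ 0 → cj x ≠ 0 := fun {x} hx h0 => hx (by rw [← cj_cj x, h0, map_zero])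
  have hf0 : f ≠ 0 := fun h0 => by simpa [h0] using h.unit
  have c : ∀ {x y : C7}, dot (cj x) y = 0 → dot (cj y) x = 0 := fun {x y} hxy => by
    rw [dot_comm, ← cj_cj x, ← conj_dot, hxy, map_zero]
  have c' : ∀ {x y : C7}, dot x y = 0 → dot (cj x) (cj y) = 0 := fun {x y} hxy => by
    rw [← conj_dot, hxy, map_zero]
  have hr := h.real
  obtain ⟨ha1, ha2, ha3, ha4, ha5⟩ := hna
  obtain ⟨hb1, hb2, hb3, hb4, hb5⟩ := hnb
  obtain ⟨hw1, hw2, hw3, hw4, hw5⟩ := hnw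
  -- The frame, its conjugates, `a` and `b` are seven Hermitian-orthogonal nonzero vectors, hence a
  -- basis of `ℂ⁷`.
  refine eq_zero_of_orthogonal_family (e := ![f, f₁, cj f₁, f₂, cj f₂, a, b]) ?_ ?_ ?_
  · intro i
    have hn1 := hn h.ne_zero
    have hn2 := hn h2
    have hn3 := h.ne_zero
    fin_cases i <;> assumption
  · have h01 := h.dot_zero_one
    have h02 := h.dot_zero_two
    have h11 := h.dot_one_one
    have h12 := h.dot_one_two
    have h22 := h.dot_two_two
    have h12' := h.dot_cj_one_two
    have h01' := c' h01
    have h02' := c' h02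
    have e1 := c' h11
    have e2 := c' h12
    have e3 := c' h22
    have e4 := c h12'
    rw [hr] at h01' h02'
    intro i j hij
    rw [inner_eq_dot]
    -- Each off-diagonal pair is one of the relations above, up to symmetry of `dot` and
    -- conjugation.
    fin_cases i <;> fin_cases j <;> first
      | exact absurd rfl hij
      | (simp only [Fin.zero_eta, Fin.mk_one, Fin.reduceFinMk, Matrix.cons_val, cj_cj, hr]
         first
          | assumption
          | (rw [dot_comm]; assumption)
          | (apply c; assumption)
          | (apply c; rw [hr]; assumption)
          | (apply c; rw [cj_cj]; assumption))
  · intro i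
    rw [inner_eq_dot]
    fin_cases i <;>
      simp only [Fin.zero_eta, Fin.mk_one, Fin.reduceFinMk, Matrix.cons_val, cj_cj, hr] <;>
      assumption

/-- Two vectors normal to an isotropic frame with degenerate bilinear Gram matrix are parallel. -/
theorem exists_eq_smul (h : IsIsotropicFrame f f₁ f₂) (h2 : f₂ ≠ 0) {a b : C7} (hb : b ≠ 0)
    (hna : a ∈ normal f f₁ f₂) (hnb : b ∈ normal f f₁ f₂)
    (hgram : dot a b ^ 2 = dot a a * dot b b) : ∃ t : ℂ, a = t • b := by
  have hbb : dot (cj b) b ≠ 0 := fun h0 => hb (dot_cj_self_eq_zero.1 h0)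
  set t : ℂ := dot (cj b) a / dot (cj b) b with ht
  -- `d` is the component of `a` Hermitian-orthogonal to `b`; passing from `a` to `d` does not
  -- change the bilinear Gram determinant with `b`.
  set d : C7 := a - t • b with hd
  by_cases hd0 : d = 0
  · exact ⟨t, sub_eq_zero.1 hd0⟩
  exfalso
  have hbd : dot (cj b) d = 0 := by
    rw [hd, dot_sub_right, dot_smul_right, ht]; field_simp; ring
  have hnd : d ∈ normal f f₁ f₂ := sub_mem hna (Submodule.smul_mem _ _ hnb)
  have hgram' : dot d b ^ 2 = dot d d * dot b b := by
    simp only [hd, dot_sub_left, dot_sub_right, dot_smul_left, dot_smul_right, dot_comm b a]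
    linear_combination hgram
  -- If `d ≠ 0`, then `b` and `d` span the complement of the frame. It is stable under conjugation,
  -- so the bilinear form has no radical on it.
  have key : ∀ w ∈ normal f f₁ f₂, dot b w = 0 → dot d w = 0 → w = 0 := by
    intro w hw h3 h4
    have h0 := h.eq_zero h2 hb hd0 hbd hnb hnd (h.cj_mem_normal hw)
      (by rw [← conj_dot, h3, map_zero]) (by rw [← conj_dot, h4, map_zero])
    rw [← cj_cj w, h0, map_zero]
  -- This combination is orthogonal to `b` because the Gram determinant vanishes, and to `d` by
  -- construction. Its vanishing puts `d` in the radical.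
  have hw := key (dot d d • b - dot d b • d)
    (sub_mem (Submodule.smul_mem _ _ hnb) (Submodule.smul_mem _ _ hnd))
    (by rw [dot_sub_right, dot_smul_right, dot_smul_right, dot_comm b d]
        linear_combination -hgram')
    (by rw [dot_sub_right, dot_smul_right, dot_smul_right]; ring)
  have hdd : dot d d = 0 := by
    have := congrArg (dot (cj b)) hw
    rw [dot_sub_right, dot_smul_right, dot_smul_right, hbd, dot_zero_right] at this
    simpa [hbb] using this
  have hdb : dot d b = 0 := by
    rw [hdd, zero_mul] at hgram'
    exact pow_eq_zero_iff two_ne_zero |>.1 hgram'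
  exact hd0 (key d hnd (by rw [dot_comm, hdb]) hdd)

/-- The kernel of `f × ·` is the line of `f`, which contains no nonzero isotropic vector because
`(f, f) = 1`. -/
theorem eq_zero_of_bicross_eq_zero (h : IsIsotropicFrame f f₁ f₂) {w : C7} (hw : dot w w = 0)
    (hfw : bicross f w = 0) : w = 0 := by
  have h1 := bicross_bicross_self f w
  rw [hfw, bicross_zero_right, h.unit, one_smul] at h1
  have h2 : w = dot f w • f := (sub_eq_zero.1 h1.symm).symm
  have h3 : dot f w = 0 := by
    rw [h2, dot_smul_left, dot_smul_right, h.unit, mul_one] at hw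
    simpa using hw
  rw [h2, h3, zero_smul]

/-- Algebraic core of the classification: if the mean curvature direction is umbilical, one of two
cross products vanishes. -/
theorem bicross_eq_zero_or (h : IsIsotropicFrame f f₁ f₂)
    (hP : dot (bicross f f₂) (bicross f₁ (cj f₁)) = 0)
    (hQ : dot (bicross f f₂) (bicross f₁ (cj f₂)) = 0) :
    bicross f₁ f₂ = 0 ∨ bicross f₁ (cj f₂) = 0 := by
  by_cases h2 : f₂ = 0
  · simp [h2]
  have h01 := h.dot_zero_one
  have h02 := h.dot_zero_two
  have h11 := h.dot_one_one
  have h12 := h.dot_one_two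
  have h22 := h.dot_two_two
  have c : ∀ {x y : C7}, dot (cj x) y = 0 → dot (cj y) x = 0 := fun {x y} hxy => by
    rw [dot_comm, ← cj_cj x, ← conj_dot, hxy, map_zero]
  have h12' : dot f₁ (cj f₂) = 0 := by rw [dot_comm]; exact c h.dot_cj_one_two
  have h02' : dot f (cj f₂) = 0 := by rw [dot_comm]; exact c (by rw [h.real]; exact h02)
  have h01' : dot f (cj f₁) = 0 := by rw [dot_comm]; exact c (by rw [h.real]; exact h01)
  have h22' : dot (cj f₂) (cj f₂) = 0 := by rw [← conj_dot, h22, map_zero]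
  have h1'2' : dot (cj f₁) (cj f₂) = 0 := by rw [← conj_dot, h12, map_zero]
  have hP' : dot (bicross f (cj f₂)) (bicross f₁ (cj f₁)) = 0 := by
    have := congrArg (starRingEnd ℂ) hP
    rw [conj_dot, cj_bicross, cj_bicross, h.real, cj_cj, map_zero,
      bicross_anticomm (cj f₁), dot_neg_right, neg_eq_zero] at this
    exact this
  -- By cyclicity of the triple product, membership amounts to pairing `f₁ × u` with `f × y` for `y`
  -- in the frame; it is used for `u = f₂` and `u = f̄₂`.
  have hmem : ∀ u : C7, dot f u = 0 → dot f₁ u = 0 →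
      (∀ y ∈ [f, f₁, cj f₁, f₂, cj f₂], dot (bicross f₁ u) (bicross f y) = 0) →
      bicross f (bicross f₁ u) ∈ normal f f₁ f₂ := by
    intro u h0 h1 hy
    have key : ∀ y ∈ [f, f₁, cj f₁, f₂, cj f₂], dot y (bicross f (bicross f₁ u)) = 0 := by
      intro y hy'
      rw [dot_bicross_cyclic, dot_bicross_cyclic, bicross_anticomm y f, dot_neg_right, hy y hy',
        neg_zero]
    exact ⟨key _ (by simp), key _ (by simp), key _ (by simp), key _ (by simp), key _ (by simp)⟩
  -- Exchanging `f` and `f₁` only changes the sign of the pairing; this converts `hP` and `hQ` into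
  -- the pairings that `hmem` asks for.
  have swap : ∀ u y : C7, dot f u = 0 → dot f y = 0 →
      dot (bicross f u) (bicross f₁ y) = -dot (bicross f₁ u) (bicross f y) := by
    intro u y hu hy
    rw [dot_bicross_bicross_swap, h01, hu, hy]; ring
  have hsame1 : ∀ u : C7, dot f₁ u = 0 → dot (bicross f₁ u) (bicross f f₁) = 0 := by
    intro u hu
    rw [bicross_anticomm f, dot_neg_right, dot_bicross_bicross, h11, hu]; ring
  have hsame2 : ∀ u : C7, dot f u = 0 → dot u u = 0 →
      dot (bicross f₁ u) (bicross f u) = 0 := by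
    intro u hu huu
    rw [bicross_anticomm f, dot_neg_right, bicross_anticomm f₁, dot_neg_left,
      dot_bicross_bicross, huu, dot_comm u f, hu]; ring
  have hA : bicross f (bicross f₁ f₂) ∈ normal f f₁ f₂ := by
    refine hmem _ h02 h12 ?_
    intro y hy
    fin_cases hy
    · simp [bicross_self]
    · exact hsame1 _ h12
    · have := swap _ _ h02 h01'; rw [hP] at this; exact neg_eq_zero.1 this.symm
    · exact hsame2 _ h02 h22
    · have := swap _ _ h02 h02'; rw [hQ] at this; exact neg_eq_zero.1 this.symm
  have hA' : bicross f (bicross f₁ (cj f₂)) ∈ normal f f₁ f₂ := by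
    refine hmem _ h02' h12' ?_
    intro y hy
    fin_cases hy
    · simp [bicross_self]
    · exact hsame1 _ h12'
    · have := swap _ _ h02' h01'; rw [hP'] at this; exact neg_eq_zero.1 this.symm
    · rw [dot_comm]; exact hQ
    · exact hsame2 _ h02' h22'
  set X := bicross f₁ f₂ with hX
  set Y := bicross f₁ (cj f₂) with hY
  have hXX : dot X X = 0 := by rw [hX, dot_bicross_bicross, h11, h12]; ring
  have hYY : dot Y Y = 0 := by rw [hY, dot_bicross_bicross, h11, h12']; ring
  have hXY : dot X Y = 0 := by rw [hX, hY, dot_bicross_bicross, h11, h12]; ring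
  by_cases hY0 : bicross f Y = 0
  · exact Or.inr (h.eq_zero_of_bicross_eq_zero hYY hY0)
  left
  -- As `X` and `Y` are isotropic and mutually orthogonal, the Gram matrix of `f × X` and `f × Y`
  -- involves only products of `(f, X)` and `(f, Y)`, so its rank is at most one.
  obtain ⟨t, ht⟩ := h.exists_eq_smul h2 hY0 hA hA' (by
    simp only [dot_bicross_bicross, hXX, hYY, hXY]; ring)
  have hXtY : X = t • Y := by
    refine sub_eq_zero.1 (h.eq_zero_of_bicross_eq_zero ?_ ?_)
    · simp only [dot_sub_left, dot_sub_right, dot_smul_left, dot_smul_right, hXX, hYY, hXY,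
        dot_comm Y X]
      ring
    · rw [bicross_sub_right, bicross_smul_right, ht, sub_self]
  have e1 : bicross f₂ X = 0 := by
    rw [hX, bicross_anticomm f₁, bicross_neg_right, bicross_bicross_self, dot_comm f₂ f₁, h12, h22]
    simp
  have e2 : bicross (cj f₂) X = 0 := by
    rw [hXtY, bicross_smul_right, hY, bicross_anticomm f₁, bicross_neg_right,
      bicross_bicross_self, dot_comm _ f₁, h12', h22']
    simp
  have e3 : dot f₂ X = 0 := dot_bicross_right _ _
  have e4 : dot (cj f₂) X = 0 := by
    rw [hXtY, dot_smul_right, hY, dot_bicross_right, mul_zero]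
  -- Both `f₂` and `f̄₂` annihilate `X`, so the polarized identity reduces to `2 (f₂, f̄₂) X = 0`.
  have e5 := bicross_bicross_swap f₂ (cj f₂) X
  rw [e1, e2, e3, e4] at e5
  have e6 : dot f₂ (cj f₂) ≠ 0 := by
    rw [dot_comm]; exact fun h0 => h2 (dot_cj_self_eq_zero.1 h0)
  simpa [e6] using e5

end IsIsotropicFrame

/-! ### Wirtinger derivatives -/

section Wirtinger

set_option linter.unusedSectionVars false

variable {V W U : Type*}
  [NormedAddCommGroup V] [NormedSpace ℝ V] [NormedSpace ℂ V] [IsScalarTower ℝ ℂ V]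
  [NormedAddCommGroup W] [NormedSpace ℝ W] [NormedSpace ℂ W] [IsScalarTower ℝ ℂ W]
  [NormedAddCommGroup U] [NormedSpace ℝ U] [NormedSpace ℂ U] [IsScalarTower ℝ ℂ U]

/-- The Wirtinger derivative `∂/∂z`. -/
def del (h : ℂ → V) (x : ℂ) : V :=
  (1 / 2 : ℂ) • (fderiv ℝ h x 1 - Complex.I • fderiv ℝ h x Complex.I)

/-- The Wirtinger derivative `∂/∂z̄`. -/
def delBar (h : ℂ → V) (x : ℂ) : V :=
  (1 / 2 : ℂ) • (fderiv ℝ h x 1 + Complex.I • fderiv ℝ h x Complex.I)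

theorem clm_apply_eq (L : ℂ →L[ℝ] V) (u : ℂ) :
    L u = (u.re : ℂ) • L 1 + (u.im : ℂ) • L Complex.I := by
  have hu : u = u.re • (1 : ℂ) + u.im • Complex.I := by
    simp [Complex.re_add_im]
  conv_lhs => rw [hu]
  rw [map_add, map_smul, map_smul]
  exact (congrArg₂ (· + ·) (algebraMap_smul ℂ _ _) (algebraMap_smul ℂ _ _)).symm

theorem fderiv_eq_del (h : ℂ → V) (x u : ℂ) :
    fderiv ℝ h x u = u • del h x + (starRingEnd ℂ) u • delBar h x := by
  rw [clm_apply_eq, del, delBar]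
  have hI := Complex.I_mul_I
  have h1 := Complex.re_add_im u
  have h2 : (starRingEnd ℂ) u = u.re - u.im * Complex.I := by
    apply Complex.ext <;> simp
  rw [h2]
  nth_rw 3 [← h1]
  match_scalars <;> first
    | ring1
    | linear_combination (u.im : ℂ) * hI

theorem del_congr {h k : ℂ → V} {x : ℂ} (e : h =ᶠ[𝓝 x] k) : del h x = del k x := by
  rw [del, del, e.fderiv_eq]

theorem delBar_congr {h k : ℂ → V} {x : ℂ} (e : h =ᶠ[𝓝 x] k) : delBar h x = delBar k x := by
  rw [delBar, delBar, e.fderiv_eq]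

theorem eventuallyEq_del {h k : ℂ → V} {x : ℂ} (e : h =ᶠ[𝓝 x] k) : del h =ᶠ[𝓝 x] del k :=
  e.eventuallyEq_nhds.mono fun _ hy => del_congr hy

@[simp] theorem del_const (v : V) (x : ℂ) : del (fun _ => v) x = 0 := by simp [del]

@[simp] theorem delBar_const (v : V) (x : ℂ) : delBar (fun _ => v) x = 0 := by simp [delBar]

/-- A single Leibniz rule for complex bilinear maps serves scalar multiplication, `dot`, `bicross`
and the evaluation of operators. -/
theorem del_bilin (B : V →L[ℂ] W →L[ℂ] U) {h : ℂ → V} {k : ℂ → W} {x : ℂ}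
    (hh : DifferentiableAt ℝ h x) (hk : DifferentiableAt ℝ k x) :
    del (fun y => B (h y) (k y)) x = B (del h x) (k x) + B (h x) (del k x) := by
  have := ((B.bilinearRestrictScalars ℝ).hasFDerivAt_of_bilinear hh.hasFDerivAt
    hk.hasFDerivAt).fderiv
  simp only [ContinuousLinearMap.bilinearRestrictScalars_apply_apply] at this
  simp only [del, this]
  simp
  module

theorem delBar_bilin (B : V →L[ℂ] W →L[ℂ] U) {h : ℂ → V} {k : ℂ → W} {x : ℂ}
    (hh : DifferentiableAt ℝ h x) (hk : DifferentiableAt ℝ k x) :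
    delBar (fun y => B (h y) (k y)) x = B (delBar h x) (k x) + B (h x) (delBar k x) := by
  have := ((B.bilinearRestrictScalars ℝ).hasFDerivAt_of_bilinear hh.hasFDerivAt
    hk.hasFDerivAt).fderiv
  simp only [ContinuousLinearMap.bilinearRestrictScalars_apply_apply] at this
  simp only [delBar, this]
  simp
  module

theorem del_smul {c : ℂ → ℂ} {h : ℂ → V} {x : ℂ}
    (hc : DifferentiableAt ℝ c x) (hh : DifferentiableAt ℝ h x) :
    del (fun y => c y • h y) x = del c x • h x + c x • del h x :=
  del_bilin (ContinuousLinearMap.lsmul ℂ ℂ) hc hh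

theorem delBar_smul {c : ℂ → ℂ} {h : ℂ → V} {x : ℂ}
    (hc : DifferentiableAt ℝ c x) (hh : DifferentiableAt ℝ h x) :
    delBar (fun y => c y • h y) x = delBar c x • h x + c x • delBar h x :=
  delBar_bilin (ContinuousLinearMap.lsmul ℂ ℂ) hc hh

theorem del_add {h k : ℂ → V} {x : ℂ}
    (hh : DifferentiableAt ℝ h x) (hk : DifferentiableAt ℝ k x) :
    del (fun y => h y + k y) x = del h x + del k x := by
  simp only [del, fderiv_fun_add hh hk, add_apply]; module

theorem del_sub {h k : ℂ → V} {x : ℂ}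
    (hh : DifferentiableAt ℝ h x) (hk : DifferentiableAt ℝ k x) :
    del (fun y => h y - k y) x = del h x - del k x := by
  simp only [del, fderiv_fun_sub hh hk, sub_apply]; module

theorem delBar_sub {h k : ℂ → V} {x : ℂ}
    (hh : DifferentiableAt ℝ h x) (hk : DifferentiableAt ℝ k x) :
    delBar (fun y => h y - k y) x = delBar h x - delBar k x := by
  simp only [delBar, fderiv_fun_sub hh hk, sub_apply]; module

theorem delBar_cj {h : ℂ → C7} {x : ℂ} (hh : DifferentiableAt ℝ h x) :
    delBar (fun y => cj (h y)) x = cj (del h x) := by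
  have := (cj.hasFDerivAt.comp x hh.hasFDerivAt).fderiv
  simp only [Function.comp_def] at this
  rw [delBar, this, del, cj_smul, map_sub, cj_smul]
  simp [Complex.conj_ofNat]

theorem del_cj {h : ℂ → C7} {x : ℂ} (hh : DifferentiableAt ℝ h x) :
    del (fun y => cj (h y)) x = cj (delBar h x) := by
  have := (cj.hasFDerivAt.comp x hh.hasFDerivAt).fderiv
  simp only [Function.comp_def] at this
  rw [del, this, delBar, cj_smul, map_add, cj_smul]
  simp [sub_eq_add_neg, Complex.conj_ofNat]

theorem fderiv_complex_apply {τ : ℂ → ℂ} {τ' y : ℂ} (h : HasDerivAt τ τ' y) (u : ℂ) :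
    fderiv ℝ τ y u = τ' * u := by
  rw [(h.hasFDerivAt.restrictScalars ℝ).fderiv]; simp [mul_comm]

theorem delBar_of_hasDerivAt {τ : ℂ → ℂ} {τ' y : ℂ} (h : HasDerivAt τ τ' y) :
    delBar τ y = 0 := by
  rw [delBar, fderiv_complex_apply h, fderiv_complex_apply h]
  simp only [smul_eq_mul]
  linear_combination τ' / 2 * Complex.I_mul_I

theorem del_of_hasDerivAt {τ : ℂ → ℂ} {τ' y : ℂ} (h : HasDerivAt τ τ' y) :
    del τ y = τ' := by
  rw [del, fderiv_complex_apply h, fderiv_complex_apply h]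
  simp only [smul_eq_mul]
  linear_combination -τ' / 2 * Complex.I_mul_I

theorem fderiv_comp_holomorphic {h : ℂ → V} {τ : ℂ → ℂ} {τ' y : ℂ} (hτ : HasDerivAt τ τ' y)
    (hh : DifferentiableAt ℝ h (τ y)) (u : ℂ) :
    fderiv ℝ (h ∘ τ) y u = fderiv ℝ h (τ y) (τ' * u) := by
  have hτ' := hτ.hasFDerivAt.restrictScalars ℝ
  rw [fderiv_comp y hh hτ'.differentiableAt]
  simp [fderiv_complex_apply hτ]

theorem del_comp_holomorphic {h : ℂ → V} {τ : ℂ → ℂ} {τ' y : ℂ} (hτ : HasDerivAt τ τ' y)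
    (hh : DifferentiableAt ℝ h (τ y)) : del (h ∘ τ) y = τ' • del h (τ y) := by
  rw [del, fderiv_comp_holomorphic hτ hh, fderiv_comp_holomorphic hτ hh, fderiv_eq_del,
    fderiv_eq_del]
  simp only [map_mul, map_one, Complex.conj_I]
  match_scalars
  · linear_combination -(τ' / 2) * Complex.I_mul_I
  · linear_combination (starRingEnd ℂ τ' / 2) * Complex.I_mul_I

theorem delBar_comp_holomorphic {h : ℂ → V} {τ : ℂ → ℂ} {τ' y : ℂ} (hτ : HasDerivAt τ τ' y)
    (hh : DifferentiableAt ℝ h (τ y)) :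
    delBar (h ∘ τ) y = (starRingEnd ℂ) τ' • delBar h (τ y) := by
  rw [delBar, fderiv_comp_holomorphic hτ hh, fderiv_comp_holomorphic hτ hh, fderiv_eq_del,
    fderiv_eq_del]
  simp only [map_mul, map_one, Complex.conj_I]
  match_scalars
  · linear_combination (τ' / 2) * Complex.I_mul_I
  · linear_combination -(starRingEnd ℂ τ' / 2) * Complex.I_mul_I

theorem contDiffOn_fderiv_apply {h : ℂ → V} {T : Set ℂ} (hT : IsOpen T)
    (hh : ContDiffOn ℝ ∞ h T) (u : ℂ) : ContDiffOn ℝ ∞ (fun x => fderiv ℝ h x u) T :=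
  (hh.fderiv_of_isOpen hT (m := ∞) (by simp)).clm_apply contDiffOn_const

theorem contDiffOn_del {h : ℂ → V} {T : Set ℂ} (hT : IsOpen T)
    (hh : ContDiffOn ℝ ∞ h T) : ContDiffOn ℝ ∞ (del h) T :=
  ((contDiffOn_fderiv_apply hT hh 1).sub
    ((contDiffOn_fderiv_apply hT hh Complex.I).const_smul Complex.I)).const_smul (1 / 2 : ℂ)

theorem contDiffOn_delBar {h : ℂ → V} {T : Set ℂ} (hT : IsOpen T)
    (hh : ContDiffOn ℝ ∞ h T) : ContDiffOn ℝ ∞ (delBar h) T :=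
  ((contDiffOn_fderiv_apply hT hh 1).add
    ((contDiffOn_fderiv_apply hT hh Complex.I).const_smul Complex.I)).const_smul (1 / 2 : ℂ)

theorem differentiableAt_of_contDiffOn {h : ℂ → V} {T : Set ℂ} (hT : IsOpen T)
    (hh : ContDiffOn ℝ ∞ h T) {x : ℂ} (hx : x ∈ T) : DifferentiableAt ℝ h x :=
  (hh.contDiffAt (hT.mem_nhds hx)).differentiableAt (by simp)

theorem fderiv_del_apply {h : ℂ → V} {x : ℂ} (hh : ContDiffAt ℝ 2 h x) (u : ℂ) :
    fderiv ℝ (del h) x u = (1 / 2 : ℂ) • (fderiv ℝ (fderiv ℝ h) x u 1 -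
      Complex.I • fderiv ℝ (fderiv ℝ h) x u Complex.I) := by
  have hd : DifferentiableAt ℝ (fderiv ℝ h) x :=
    (hh.fderiv_right (m := 1) (by norm_num)).differentiableAt (by simp)
  have h1 := hd.hasFDerivAt.clm_apply (hasFDerivAt_const (1 : ℂ) x)
  have h2 := hd.hasFDerivAt.clm_apply (hasFDerivAt_const Complex.I x)
  have h3 := ((h1.sub (h2.const_smul Complex.I)).const_smul (1 / 2 : ℂ)).fderiv
  have h4 : del h = (1 / 2 : ℂ) • ((fun y => fderiv ℝ h y 1) -
    Complex.I • fun y => fderiv ℝ h y Complex.I) := rfl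
  rw [h4, h3]
  simp

theorem fderiv_delBar_apply {h : ℂ → V} {x : ℂ} (hh : ContDiffAt ℝ 2 h x) (u : ℂ) :
    fderiv ℝ (delBar h) x u = (1 / 2 : ℂ) • (fderiv ℝ (fderiv ℝ h) x u 1 +
      Complex.I • fderiv ℝ (fderiv ℝ h) x u Complex.I) := by
  have hd : DifferentiableAt ℝ (fderiv ℝ h) x :=
    (hh.fderiv_right (m := 1) (by norm_num)).differentiableAt (by simp)
  have h1 := hd.hasFDerivAt.clm_apply (hasFDerivAt_const (1 : ℂ) x)
  have h2 := hd.hasFDerivAt.clm_apply (hasFDerivAt_const Complex.I x)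
  have h3 := ((h1.add (h2.const_smul Complex.I)).const_smul (1 / 2 : ℂ)).fderiv
  have h4 : delBar h = (1 / 2 : ℂ) • ((fun y => fderiv ℝ h y 1) +
    Complex.I • fun y => fderiv ℝ h y Complex.I) := rfl
  rw [h4, h3]
  simp

theorem snd_fderiv_symm {h : ℂ → V} {x : ℂ} (hh : ContDiffAt ℝ 2 h x) (u v : ℂ) :
    fderiv ℝ (fderiv ℝ h) x u v = fderiv ℝ (fderiv ℝ h) x v u :=
  hh.isSymmSndFDerivAt (by simp) u v

theorem delBar_del {h : ℂ → V} {x : ℂ} (hh : ContDiffAt ℝ 2 h x) :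
    delBar (del h) x = (1 / 4 : ℂ) • (fderiv ℝ (fderiv ℝ h) x 1 1 +
      fderiv ℝ (fderiv ℝ h) x Complex.I Complex.I) := by
  rw [delBar, fderiv_del_apply hh, fderiv_del_apply hh, snd_fderiv_symm hh Complex.I 1]
  match_scalars <;> first
    | ring1
    | linear_combination -(1 / 4 : ℂ) * Complex.I_mul_I

theorem del_delBar {h : ℂ → V} {x : ℂ} (hh : ContDiffAt ℝ 2 h x) :
    del (delBar h) x = delBar (del h) x := by
  rw [delBar_del hh, del, fderiv_delBar_apply hh, fderiv_delBar_apply hh,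
    snd_fderiv_symm hh Complex.I 1]
  match_scalars <;> first
    | ring1
    | linear_combination -(1 / 4 : ℂ) * Complex.I_mul_I

theorem del_del {h : ℂ → V} {x : ℂ} (hh : ContDiffAt ℝ 2 h x) :
    del (del h) x = (1 / 4 : ℂ) • (fderiv ℝ (fderiv ℝ h) x 1 1 -
      fderiv ℝ (fderiv ℝ h) x Complex.I Complex.I -
      (2 * Complex.I) • fderiv ℝ (fderiv ℝ h) x 1 Complex.I) := by
  rw [del, fderiv_del_apply hh, fderiv_del_apply hh, snd_fderiv_symm hh Complex.I 1]
  match_scalars <;> first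
    | ring1
    | linear_combination (-1 / 4 : ℂ) * Complex.I_mul_I
    | linear_combination (1 / 4 : ℂ) * Complex.I_mul_I

end Wirtinger

/-! ### Division by a holomorphic coordinate -/

section Division

set_option linter.unusedSectionVars false

variable {V : Type*} [NormedAddCommGroup V] [NormedSpace ℝ V]

/-- Each differentiation of `h(tz)` in `z` brings out one more factor `t`; with the weight `t^j`
included, this class of integrals is closed under differentiation. -/
theorem hasFDerivAt_integral_dilation (j : ℕ) {h : ℂ → V} (hh : ContDiff ℝ 1 h) (z : ℂ) :
    HasFDerivAt (fun z : ℂ => ∫ t in (0 : ℝ)..1, t ^ j • h (t • z))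
      (∫ t in (0 : ℝ)..1, t ^ (j + 1) • fderiv ℝ h (t • z)) z := by
  have hfd : Continuous (fderiv ℝ h) := hh.continuous_fderiv (by simp)
  have hF' : Continuous fun q : ℝ × ℂ => q.1 ^ (j + 1) • fderiv ℝ h (q.1 • q.2) := by fun_prop
  obtain ⟨C, hC⟩ := ((isCompact_Icc (a := (0 : ℝ)) (b := 1)).prod
    (isCompact_closedBall z 1)).exists_bound_of_continuousOn hF'.continuousOn
  have hcont : ∀ x : ℂ, Continuous fun t : ℝ => t ^ j • h (t • x) := fun x => by
    have := hh.continuous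
    fun_prop
  refine intervalIntegral.hasFDerivAt_integral_of_dominated_of_fderiv_le (μ := MeasureTheory.volume)
    (F := fun z t => t ^ j • h (t • z)) (F' := fun z t => t ^ (j + 1) • fderiv ℝ h (t • z))
    (bound := fun _ => C) (Metric.ball_mem_nhds z one_pos) ?_ ?_ ?_ ?_ ?_ ?_
  · exact Filter.Eventually.of_forall fun x => (hcont x).aestronglyMeasurable
  · exact (hcont z).intervalIntegrable _ _
  · exact (hF'.comp (by fun_prop : Continuous fun t : ℝ => (t, z))).aestronglyMeasurable
  · refine Filter.Eventually.of_forall fun t ht x hx => hC (t, x) ⟨?_, ?_⟩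
    · rw [Set.uIoc_of_le zero_le_one] at ht; exact ⟨ht.1.le, ht.2⟩
    · exact Metric.ball_subset_closedBall hx
  · exact intervalIntegrable_const
  · refine Filter.Eventually.of_forall fun t _ x _ => ?_
    have h1 : HasFDerivAt (fun x : ℂ => t • x) (t • ContinuousLinearMap.id ℝ ℂ) x :=
      (hasFDerivAt_id x).const_smul t
    have h2 := ((hh.differentiable (by simp) (t • x)).hasFDerivAt.comp x h1).const_smul (t ^ j)
    refine h2.congr_fderiv ?_
    ext u
    simp [pow_succ, smul_smul]

/-- The target space is quantified inside the induction because the derivative takes values in a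
space of operators. -/
theorem contDiff_integral_dilation_nat (n : ℕ) : ∀ {V : Type _} [NormedAddCommGroup V]
    [NormedSpace ℝ V] (j : ℕ) {h : ℂ → V}, ContDiff ℝ n h →
    ContDiff ℝ n fun z : ℂ => ∫ t in (0 : ℝ)..1, t ^ j • h (t • z) := by
  induction n with
  | zero =>
    intro V _ _ j h hh
    have hc : Continuous h := hh.continuous
    exact contDiff_zero.2 (intervalIntegral.continuous_parametric_intervalIntegral_of_continuous'
      (f := fun (z : ℂ) (t : ℝ) => t ^ j • h (t • z))
      (by simp only [Function.uncurry_def]; fun_prop) 0 1)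
  | succ n ih =>
    intro V _ _ j h hh
    push_cast at hh ⊢
    refine contDiff_succ_iff_hasFDerivAt.2 ⟨_, ih (j + 1) (hh.fderiv_right le_rfl), fun z =>
      hasFDerivAt_integral_dilation j (hh.of_le (by simp)) z⟩

theorem contDiff_integral_dilation (j : ℕ) {h : ℂ → V} (hh : ContDiff ℝ ∞ h) :
    ContDiff ℝ ∞ fun z : ℂ => ∫ t in (0 : ℝ)..1, t ^ j • h (t • z) :=
  contDiff_infty.2 fun n => contDiff_integral_dilation_nat n j (contDiff_infty.1 hh n)

theorem norm_conj_pow_mul_inv_pow_le {n b : ℕ} (hb : b < n) (z : ℂ) :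
    ‖(starRingEnd ℂ) z ^ n * (z⁻¹) ^ b‖ ≤ ‖z‖ ^ (n - b) := by
  rcases eq_or_ne z 0 with rfl | hz
  · rw [map_zero, zero_pow (by omega), zero_mul, norm_zero]; positivity
  · have hz' : ‖z‖ ≠ 0 := norm_ne_zero_iff.2 hz
    rw [norm_mul, norm_pow, norm_pow, norm_inv, RCLike.norm_conj, inv_pow, ← div_eq_mul_inv,
      div_le_iff₀ (by positivity), ← pow_add, Nat.sub_add_cancel hb.le]

/-- The function has size `|z|^(n-b)`, and a derivative either lowers `n` or raises `b` by one, so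
the induction spends one unit of `n - b` per derivative. Since `n > 0`, the value at the origin is
zero regardless of the convention for `0⁻¹`. -/
theorem contDiff_conj_pow_mul_inv_pow (m : ℕ) : ∀ n b : ℕ, b + m + 1 ≤ n →
    ContDiff ℝ m fun z : ℂ => (starRingEnd ℂ) z ^ n * (z⁻¹) ^ b := by
  induction m with
  | zero =>
    intro n b hn
    refine contDiff_zero.2 (continuous_iff_continuousAt.2 fun z => ?_)
    rcases eq_or_ne z 0 with rfl | hz
    · have h0 : (starRingEnd ℂ) (0 : ℂ) ^ n * (0⁻¹) ^ b = 0 := by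
        rw [map_zero, zero_pow (by omega), zero_mul]
      rw [ContinuousAt, h0]
      refine squeeze_zero_norm (norm_conj_pow_mul_inv_pow_le (by omega)) ?_
      have : Continuous fun z : ℂ => ‖z‖ ^ (n - b) := by fun_prop
      simpa [show n - b ≠ 0 by omega] using this.tendsto 0
    · exact ((Complex.continuous_conj.continuousAt).pow n).mul
        ((continuousAt_inv₀ hz).pow b)
  | succ m ih =>
    intro n b hn
    push_cast
    let L : ℂ → ℂ →L[ℝ] ℂ := fun z =>
      ((n : ℂ) * ((starRingEnd ℂ) z ^ (n - 1) * (z⁻¹) ^ b)) • (Complex.conjCLE : ℂ →L[ℝ] ℂ) -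
      ((b : ℂ) * ((starRingEnd ℂ) z ^ n * (z⁻¹) ^ (b + 1))) • ContinuousLinearMap.id ℝ ℂ
    refine contDiff_succ_iff_hasFDerivAt.2 ⟨L, ?_, fun z => ?_⟩
    · exact ((contDiff_const.mul (ih (n - 1) b (by omega))).smul contDiff_const).sub
        ((contDiff_const.mul (ih n (b + 1) (by omega))).smul contDiff_const)
    rcases eq_or_ne z 0 with rfl | hz
    · have hL : L 0 = 0 := by
        simp only [L, map_zero]
        rw [zero_pow (by omega), zero_pow (by omega)]; ext; simp
      rw [hL, hasFDerivAt_iff_isLittleO_nhds_zero]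
      simp only [zero_add, map_zero, zero_apply, sub_zero]
      rw [zero_pow (by omega : n ≠ 0)]
      simp only [zero_mul, sub_zero]
      have h1 : (fun z : ℂ => (starRingEnd ℂ) z ^ n * (z⁻¹) ^ b) =O[𝓝 0] fun z => ‖z‖ ^ (n - b) :=
        Asymptotics.IsBigO.of_norm_le (norm_conj_pow_mul_inv_pow_le (by omega))
      exact h1.trans_isLittleO (Asymptotics.isLittleO_norm_pow_id (by omega))
    · have h1 : HasFDerivAt (fun z : ℂ => (starRingEnd ℂ) z) (Complex.conjCLE : ℂ →L[ℝ] ℂ) z :=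
        Complex.conjCLE.hasFDerivAt
      have h2 := (((hasDerivAt_inv hz).pow b).hasFDerivAt).restrictScalars ℝ
      refine ((h1.pow n).mul h2).congr_fderiv ?_
      ext u
      simp only [L]
      rcases b with _ | b
      · simp
      · simp
        field_simp
        ring

variable [NormedSpace ℂ V] [IsScalarTower ℝ ℂ V]

/-- Hadamard's lemma: integrate the differential of `h` along the segment from `0` to `z`, split
into its `z` and `z̄` parts. -/
theorem hadamard_del [CompleteSpace V] {h : ℂ → V} (hh : ContDiff ℝ ∞ h) (z : ℂ) :
    h z = h 0 + z • (∫ t in (0 : ℝ)..1, del h (t • z)) +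
      (starRingEnd ℂ) z • ∫ t in (0 : ℝ)..1, delBar h (t • z) := by
  have hc1 : Continuous (del h) :=
    (contDiffOn_univ.1 (contDiffOn_del isOpen_univ hh.contDiffOn)).continuous
  have hc2 : Continuous (delBar h) :=
    (contDiffOn_univ.1 (contDiffOn_delBar isOpen_univ hh.contDiffOn)).continuous
  have hd : ∀ t ∈ Set.uIcc (0 : ℝ) 1, HasDerivAt (fun t : ℝ => h (t • z))
      (z • del h (t • z) + (starRingEnd ℂ) z • delBar h (t • z)) t := by
    intro t _
    have h1 : HasDerivAt (fun t : ℝ => t • z) z t := by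
      simpa using (hasDerivAt_id t).smul_const z
    have h2 := ((hh.differentiable (by simp) (t • z)).hasFDerivAt.comp_hasDerivAt t h1)
    rwa [fderiv_eq_del] at h2
  have hi1 : IntervalIntegrable (fun t : ℝ => z • del h (t • z)) MeasureTheory.volume 0 1 :=
    Continuous.intervalIntegrable (by fun_prop) _ _
  have hi2 : IntervalIntegrable (fun t : ℝ => (starRingEnd ℂ) z • delBar h (t • z))
      MeasureTheory.volume 0 1 := Continuous.intervalIntegrable (by fun_prop) _ _
  have := intervalIntegral.integral_eq_sub_of_hasDerivAt hd (hi1.add hi2)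
  rw [intervalIntegral.integral_add hi1 hi2, intervalIntegral.integral_smul,
    intervalIntegral.integral_smul] at this
  rw [add_assoc, this]
  simp

theorem delBar_integral_dilation [CompleteSpace V] (j : ℕ) {h : ℂ → V} (hh : ContDiff ℝ ∞ h) :
    delBar (fun z : ℂ => ∫ t in (0 : ℝ)..1, t ^ j • h (t • z)) =
      fun z => ∫ t in (0 : ℝ)..1, t ^ (j + 1) • delBar h (t • z) := by
  funext z
  have hfd : Continuous (fderiv ℝ h) := hh.continuous_fderiv (by simp)
  have hF' : Continuous fun t : ℝ => t ^ (j + 1) • fderiv ℝ h (t • z) := by fun_prop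
  have happ : ∀ u : ℂ, (∫ t in (0 : ℝ)..1, t ^ (j + 1) • fderiv ℝ h (t • z)) u =
      ∫ t in (0 : ℝ)..1, t ^ (j + 1) • fderiv ℝ h (t • z) u := fun u => by
    rw [ContinuousLinearMap.intervalIntegral_apply (hF'.intervalIntegrable _ _)]
    rfl
  have hi : ∀ u : ℂ, IntervalIntegrable (fun t : ℝ => t ^ (j + 1) • fderiv ℝ h (t • z) u)
      MeasureTheory.volume 0 1 := fun u => Continuous.intervalIntegrable (by fun_prop) _ _
  have hi2 : IntervalIntegrable (fun t : ℝ => Complex.I • t ^ (j + 1) • fderiv ℝ h (t • z)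
      Complex.I) MeasureTheory.volume 0 1 := (hi Complex.I).smul Complex.I
  rw [delBar, (hasFDerivAt_integral_dilation j (hh.of_le (by simp)) z).fderiv, happ, happ,
    ← intervalIntegral.integral_smul, ← intervalIntegral.integral_add (hi 1) hi2,
    ← intervalIntegral.integral_smul]
  congr 1
  funext t
  simp only [delBar, smul_add]
  rw [smul_comm (t ^ (j + 1)) (1 / 2 : ℂ), smul_comm (t ^ (j + 1)) (1 / 2 : ℂ),
    smul_comm (t ^ (j + 1)) Complex.I]

theorem iterate_delBar_integral_dilation [CompleteSpace V] (n : ℕ) : ∀ (j : ℕ) {h : ℂ → V},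
    ContDiff ℝ ∞ h → delBar^[n] (fun z : ℂ => ∫ t in (0 : ℝ)..1, t ^ j • h (t • z)) =
      fun z => ∫ t in (0 : ℝ)..1, t ^ (j + n) • (delBar^[n] h) (t • z) := by
  induction n with
  | zero => intro j h _; rfl
  | succ n ih =>
    intro j h hh
    rw [Function.iterate_succ_apply, Function.iterate_succ_apply, delBar_integral_dilation j hh,
      ih (j + 1) (contDiffOn_univ.1 (contDiffOn_delBar isOpen_univ hh.contDiffOn))]
    simp only [Nat.add_right_comm, Nat.add_assoc]

/-- A function all of whose antiholomorphic derivatives vanish at the origin is divisible by `z`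
up to arbitrarily high powers of `z̄`. -/
theorem exists_eq_smul_add_conj_pow_smul [CompleteSpace V] {h : ℂ → V} (hh : ContDiff ℝ ∞ h)
    (h0 : ∀ j, (delBar^[j] h) 0 = 0) (n : ℕ) : ∃ a b : ℂ → V, ContDiff ℝ ∞ a ∧ ContDiff ℝ ∞ b ∧
      (∀ j, (delBar^[j] b) 0 = 0) ∧ ∀ z, h z = z • a z + (starRingEnd ℂ) z ^ n • b z := by
  induction n with
  | zero => exact ⟨0, h, contDiff_const, hh, h0, by simp⟩
  | succ n ih =>
    obtain ⟨a, b, ha, hb, hb0, hab⟩ := ih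
    have hd := contDiffOn_univ.1 (contDiffOn_del isOpen_univ hb.contDiffOn)
    have hdb := contDiffOn_univ.1 (contDiffOn_delBar isOpen_univ hb.contDiffOn)
    have i1 := contDiff_integral_dilation 0 hd
    have i2 := contDiff_integral_dilation 0 hdb
    have hconj : ContDiff ℝ ∞ fun z : ℂ => (starRingEnd ℂ) z ^ n :=
      (Complex.conjCLE.contDiff).pow n
    refine ⟨fun z => a z + (starRingEnd ℂ) z ^ n • ∫ t in (0 : ℝ)..1, t ^ 0 • del b (t • z),
      fun z => ∫ t in (0 : ℝ)..1, t ^ 0 • delBar b (t • z), ha.add (hconj.smul i1), i2, ?_, ?_⟩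
    · intro j
      -- At the origin the `z̄`-derivatives of the remainder are multiples of those of `b`, one
      -- order higher, so the hypothesis on `b` is inherited.
      rw [iterate_delBar_integral_dilation j 0 hdb]
      simp only [smul_zero, ← Function.iterate_succ_apply, hb0, intervalIntegral.integral_zero]
    · intro z
      rw [hab z, hadamard_del hb z, show b 0 = 0 from hb0 0]
      simp only [pow_zero, one_smul]
      module

theorem contDiff_nat_of_eq_smul_add (m : ℕ) {a b : ℂ → V} (ha : ContDiff ℝ ∞ a)
    (hb : ContDiff ℝ ∞ b) :
    ContDiff ℝ m fun z => a z + ((starRingEnd ℂ) z ^ (m + 2) * z⁻¹ ^ 1) • b z :=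
  (ha.of_le (by exact_mod_cast le_top)).add
    ((contDiff_conj_pow_mul_inv_pow m (m + 2) 1 (by omega)).smul
      (hb.of_le (by exact_mod_cast le_top)))

/-- Away from `0` the quotient `h / z` equals `a + (z̄^n / z) b` for every `n`. For `n = m + 2` this
extends to a `C^m` function, and by continuity at the origin all these extensions coincide. -/
theorem exists_contDiff_eq_smul [CompleteSpace V] {h : ℂ → V} (hh : ContDiff ℝ ∞ h)
    (h0 : ∀ j, (delBar^[j] h) 0 = 0) : ∃ g : ℂ → V, ContDiff ℝ ∞ g ∧ ∀ z, h z = z • g z := by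
  choose a b ha hb _ hab using exists_eq_smul_add_conj_pow_smul hh h0
  set G : ℕ → ℂ → V := fun m z =>
    a (m + 2) z + ((starRingEnd ℂ) z ^ (m + 2) * z⁻¹ ^ 1) • b (m + 2) z with hG
  have hGc : ∀ m : ℕ, ContDiff ℝ m (G m) := fun m =>
    contDiff_nat_of_eq_smul_add m (ha (m + 2)) (hb (m + 2))
  have hGz : ∀ m z, z ≠ 0 → G m z = z⁻¹ • h z := by
    intro m z hz
    rw [hab (m + 2) z]
    simp only [hG, smul_add, smul_smul, inv_mul_cancel₀ hz, one_smul, pow_one]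
    rw [mul_comm]
  have hGG : ∀ m, G m = G 0 := by
    intro m
    refine (hGc m).continuous.ext_on (dense_compl_singleton (0 : ℂ)) (hGc 0).continuous ?_
    intro z hz
    rw [hGz m z hz, hGz 0 z hz]
  refine ⟨G 0, contDiff_infty.2 fun m => hGG m ▸ hGc m, fun z => ?_⟩
  rcases eq_or_ne z 0 with rfl | hz
  · rw [zero_smul]; exact h0 0
  · rw [hGz 0 z hz, smul_smul, mul_inv_cancel₀ hz, one_smul]

theorem iterate_delBar_congr {h k : ℂ → V} {x : ℂ} (e : h =ᶠ[𝓝 x] k) (j : ℕ) :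
    delBar^[j] h =ᶠ[𝓝 x] delBar^[j] k := by
  induction j with
  | zero => exact e
  | succ j ih =>
    simp only [Function.iterate_succ_apply']
    exact ih.eventuallyEq_nhds.mono fun _ hy => delBar_congr hy

theorem delBar_comp_const_add (h : ℂ → V) (c : ℂ) :
    delBar (fun z => h (c + z)) = fun z => delBar h (c + z) := by
  funext z
  simp [delBar, fderiv_comp_add_left]

theorem iterate_delBar_comp_const_add (h : ℂ → V) (c : ℂ) (j : ℕ) :
    delBar^[j] (fun z => h (c + z)) = fun z => (delBar^[j] h) (c + z) := by
  induction j with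
  | zero => rfl
  | succ j ih => simp only [Function.iterate_succ_apply', ih, delBar_comp_const_add]

/-- A smooth function all of whose antiholomorphic derivatives vanish at `c` is a smooth multiple
of `z - c`. -/
theorem exists_contDiffOn_eq_smul [CompleteSpace V] {h : ℂ → V} {T : Set ℂ} (hT : IsOpen T) {c : ℂ}
    (hc : c ∈ T) (hh : ContDiffOn ℝ ∞ h T) (h0 : ∀ j, (delBar^[j] h) c = 0) :
    ∃ g : ℂ → V, ContDiffOn ℝ ∞ g T ∧ ∀ z ∈ T, h z = (z - c) • g z := by
  obtain ⟨r, hr, hrT⟩ := Metric.nhds_basis_closedBall.mem_iff.1 (hT.mem_nhds hc)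
  -- A cutoff makes `h` globally smooth without changing it near `c`, hence without changing its
  -- derivatives there.
  let χ : ContDiffBump c := ⟨r / 2, r, half_pos hr, half_lt_self hr⟩
  have hχ : tsupport χ ⊆ T := by rw [χ.tsupport_eq]; exact hrT
  set k : ℂ → V := fun z => χ z • h z with hk
  have hkc : ContDiff ℝ ∞ k := by
    rw [contDiff_iff_contDiffAt]
    intro z
    by_cases hz : z ∈ T
    · exact χ.contDiff.contDiffAt.smul (hh.contDiffAt (hT.mem_nhds hz))
    · have hz' : z ∉ tsupport χ := fun h => hz (hχ h)
      have : k =ᶠ[𝓝 z] fun _ => 0 := by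
        filter_upwards [notMem_tsupport_iff_eventuallyEq.1 hz'] with y hy
        simp [hk, hy]
      exact contDiffAt_const.congr_of_eventuallyEq this
  have hkh : k =ᶠ[𝓝 c] h := by
    filter_upwards [χ.eventuallyEq_one] with y hy
    simp [hk, hy]
  obtain ⟨G, hGc, hG⟩ := exists_contDiff_eq_smul (h := fun z => k (c + z))
    (hkc.comp (contDiff_const.add contDiff_id)) (fun j => by
      rw [iterate_delBar_comp_const_add]
      simpa using (iterate_delBar_congr hkh j).eq_of_nhds.trans (h0 j))
  classical
  refine ⟨fun z => if z = c then G 0 else (z - c)⁻¹ • h z, ?_, ?_⟩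
  · intro z hz
    refine ContDiffAt.contDiffWithinAt ?_
    by_cases hzc : z = c
    · subst hzc
      have : (fun y => if y = z then G 0 else (y - z)⁻¹ • h y) =ᶠ[𝓝 z] fun y => G (y - z) := by
        filter_upwards [hkh] with y hy
        split_ifs with hyz
        · simp [hyz]
        · have := hG (y - z)
          simp only [add_sub_cancel] at this
          rw [← hy, this, smul_smul, inv_mul_cancel₀ (sub_ne_zero.2 hyz), one_smul]
      exact ContDiffAt.congr_of_eventuallyEq
        (hGc.comp (contDiff_id.sub contDiff_const)).contDiffAt this
    · have : (fun y => if y = c then G 0 else (y - c)⁻¹ • h y) =ᶠ[𝓝 z]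
          fun y => (y - c)⁻¹ • h y := by
        filter_upwards [isOpen_ne.mem_nhds hzc] with y hy
        simp [show y ≠ c from hy]
      refine ContDiffAt.congr_of_eventuallyEq ?_ this
      exact ((contDiffAt_id.sub contDiffAt_const).inv (sub_ne_zero.2 hzc)).smul
        (hh.contDiffAt (hT.mem_nhds hz))
  · intro z hz
    by_cases hzc : z = c
    · subst hzc; simpa using h0 0
    · simp [hzc, smul_smul, mul_inv_cancel₀ (sub_ne_zero.2 hzc)]

/-! ### The equation `∂h/∂z̄ = A h` -/

/-- Evaluation of endomorphisms, as a continuous bilinear map. -/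
def evalL : (V →L[ℂ] V) →L[ℂ] V →L[ℂ] V := ContinuousLinearMap.id ℂ (V →L[ℂ] V)

theorem delBar_clm_apply {A : ℂ → V →L[ℂ] V} {h : ℂ → V} {x : ℂ} (hA : DifferentiableAt ℝ A x)
    (hh : DifferentiableAt ℝ h x) :
    delBar (fun y => A y (h y)) x = delBar A x (h x) + A x (delBar h x) :=
  delBar_bilin evalL hA hh

theorem del_clm_apply {A : ℂ → V →L[ℂ] V} {h : ℂ → V} {x : ℂ} (hA : DifferentiableAt ℝ A x)
    (hh : DifferentiableAt ℝ h x) :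
    del (fun y => A y (h y)) x = del A x (h x) + A x (del h x) :=
  del_bilin evalL hA hh

theorem contDiffOn_clm_comp {A B : ℂ → V →L[ℂ] V} {T : Set ℂ} (hA : ContDiffOn ℝ ∞ A T)
    (hB : ContDiffOn ℝ ∞ B T) : ContDiffOn ℝ ∞ (fun x => (A x).comp (B x)) T :=
  (((ContinuousLinearMap.compL ℂ V V V).bilinearRestrictScalars ℝ).isBoundedBilinearMap.contDiff
    (n := ∞)).comp_contDiffOn (hA.prodMk hB)

/-- The equation expresses every iterated `z̄`-derivative linearly in `h` itself. A zero of `h`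
therefore kills all of them, which is what division by `z - c` requires. -/
theorem iterate_delBar_of_delBar_eq {A : ℂ → V →L[ℂ] V} {h : ℂ → V} {T : Set ℂ} (hT : IsOpen T)
    (hA : ContDiffOn ℝ ∞ A T) (hh : ContDiffOn ℝ ∞ h T) (heq : ∀ x ∈ T, delBar h x = A x (h x))
    (j : ℕ) : ∃ B : ℂ → V →L[ℂ] V, ContDiffOn ℝ ∞ B T ∧ ∀ x ∈ T, (delBar^[j] h) x = B x (h x) := by
  induction j with
  | zero => exact ⟨fun _ => ContinuousLinearMap.id ℂ V, contDiffOn_const, fun x _ => rfl⟩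
  | succ j ih =>
    obtain ⟨B, hB, hBh⟩ := ih
    refine ⟨fun x => delBar B x + (B x).comp (A x),
      (contDiffOn_delBar hT hB).add (contDiffOn_clm_comp hB hA), fun x hx => ?_⟩
    have e : delBar^[j] h =ᶠ[𝓝 x] fun y => B y (h y) := by
      filter_upwards [hT.mem_nhds hx] with y hy using hBh y hy
    rw [Function.iterate_succ_apply', delBar_congr e, delBar_clm_apply
      (differentiableAt_of_contDiffOn hT hB hx) (differentiableAt_of_contDiffOn hT hh hx),
      heq x hx]
    rfl

/-- The factor `z - c` is holomorphic and passes through `∂/∂z̄`, so the quotient solves the same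
equation off `c`, and at `c` by continuity. Division can thus be iterated with the same `A`. -/
theorem exists_eq_smul_of_delBar_eq [CompleteSpace V] {A : ℂ → V →L[ℂ] V} {h : ℂ → V} {T : Set ℂ}
    (hT : IsOpen T) (hA : ContDiffOn ℝ ∞ A T) (hh : ContDiffOn ℝ ∞ h T)
    (heq : ∀ x ∈ T, delBar h x = A x (h x)) {c : ℂ} (hc : c ∈ T) (h0 : h c = 0) :
    ∃ g : ℂ → V, ContDiffOn ℝ ∞ g T ∧ (∀ z ∈ T, h z = (z - c) • g z) ∧
      ∀ x ∈ T, delBar g x = A x (g x) := by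
  obtain ⟨g, hg, hgh⟩ := exists_contDiffOn_eq_smul hT hc hh (fun j => by
    obtain ⟨B, -, hB⟩ := iterate_delBar_of_delBar_eq hT hA hh heq j
    rw [hB c hc, h0, map_zero])
  refine ⟨g, hg, hgh, ?_⟩
  have hne : ∀ x ∈ T, x ≠ c → delBar g x = A x (g x) := by
    intro x hx hxc
    have e : h =ᶠ[𝓝 x] fun z => (z - c) • g z := by
      filter_upwards [hT.mem_nhds hx] with y hy using hgh y hy
    have hd : HasDerivAt (fun z : ℂ => z - c) 1 x := (hasDerivAt_id x).sub_const c
    have h1 := heq x hx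
    rw [delBar_congr e, delBar_smul (hd.hasFDerivAt.restrictScalars ℝ).differentiableAt
      (differentiableAt_of_contDiffOn hT hg hx), delBar_of_hasDerivAt hd, zero_smul, zero_add,
      hgh x hx, map_smul] at h1
    exact smul_right_injective V (sub_ne_zero.2 hxc) h1
  intro x hx
  by_cases hxc : x = c
  · subst hxc
    have c1 : ContinuousAt (delBar g) x :=
      (contDiffOn_delBar hT hg).continuousOn.continuousAt (hT.mem_nhds hx)
    have c2 : ContinuousAt (fun y => A y (g y)) x :=
      (hA.continuousOn.continuousAt (hT.mem_nhds hx)).clm_apply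
        (hg.continuousOn.continuousAt (hT.mem_nhds hx))
    have e : delBar g =ᶠ[𝓝[≠] x] fun y => A y (g y) := by
      filter_upwards [nhdsWithin_le_nhds (hT.mem_nhds hx), self_mem_nhdsWithin] with y hy hyx
      exact hne y hy hyx
    exact ((c1.eventuallyEq_nhds_iff_eventuallyEq_nhdsNE c2).1 e).eq_of_nhds
  · exact hne x hx hxc

end Division

/-! ### Unique continuation -/

/-- On the line in direction `d`, a positive second derivative would make the maximum a local
minimum as well; the restriction would be locally constant and its second derivative zero. -/
theorem snd_fderiv_nonpos_of_isLocalMax {v : ℂ → ℝ} {z : ℂ} (hv : ContDiffAt ℝ 2 v z)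
    (hmax : IsLocalMax v z) (d : ℂ) : fderiv ℝ (fderiv ℝ v) z d d ≤ 0 := by
  by_contra! hpos
  set w : ℝ → ℝ := fun t => v (z + t • d) with hw
  have hl : ∀ t : ℝ, HasDerivAt (fun t : ℝ => z + t • d) d t := fun t => by
    simpa using ((hasDerivAt_id t).smul_const d).const_add z
  have hlc : Filter.Tendsto (fun t : ℝ => z + t • d) (𝓝 0) (𝓝 z) := by
    simpa using (hl 0).continuousAt.tendsto
  have hd1 : ∀ᶠ t in 𝓝 (0 : ℝ), HasDerivAt w (fderiv ℝ v (z + t • d) d) t := by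
    have h1 : ∀ᶠ y in 𝓝 z, DifferentiableAt ℝ v y :=
      (hv.eventually (by simp)).mono fun y hy => hy.differentiableAt (by simp)
    filter_upwards [hlc.eventually h1] with t ht
    exact HasFDerivAt.comp_hasDerivAt (f := fun t : ℝ => z + t • d) t ht.hasFDerivAt (hl t)
  have hderiv : deriv w =ᶠ[𝓝 0] fun t => fderiv ℝ v (z + t • d) d := hd1.mono fun t ht => ht.deriv
  have hdf : DifferentiableAt ℝ (fderiv ℝ v) z :=
    (hv.fderiv_right (m := 1) (by norm_num)).differentiableAt (by simp)
  have hd2 : HasDerivAt (fun t : ℝ => fderiv ℝ v (z + t • d) d) (fderiv ℝ (fderiv ℝ v) z d d) 0 := by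
    have h1 : HasFDerivAt (fderiv ℝ v) (fderiv ℝ (fderiv ℝ v) z) (z + (0 : ℝ) • d) := by
      simpa using hdf.hasFDerivAt
    have h2 := (HasFDerivAt.comp_hasDerivAt (f := fun t : ℝ => z + t • d) 0 h1 (hl 0)).clm_apply
      (hasDerivAt_const (0 : ℝ) d)
    simpa [Function.comp_def] using h2
  have hdd : deriv (deriv w) 0 = fderiv ℝ (fderiv ℝ v) z d d := by
    rw [hderiv.deriv_eq, hd2.deriv]
  have hwmax : IsLocalMax w 0 := by
    have : ∀ᶠ t in 𝓝 (0 : ℝ), v (z + t • d) ≤ v z := hlc.eventually hmax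
    simpa [IsLocalMax, IsMaxFilter, hw] using this
  have hwmin : IsLocalMin w 0 := isLocalMin_of_deriv_deriv_pos (by rwa [hdd]) hwmax.deriv_eq_zero
    hd1.self_of_nhds.continuousAt
  have hconst : w =ᶠ[𝓝 0] fun _ => w 0 := by
    filter_upwards [hwmax, hwmin] with t h1 h2 using le_antisymm h1 h2
  have h0 : deriv (deriv w) 0 = 0 := by
    have : deriv w =ᶠ[𝓝 0] fun _ => 0 := by
      filter_upwards [hconst.eventuallyEq_nhds] with t ht
      rw [ht.deriv_eq, deriv_const]
    rw [this.deriv_eq, deriv_const]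
  rw [hdd] at h0
  exact hpos.ne' h0

theorem fderiv_normSq_sub (c : ℂ) : fderiv ℝ (fun z : ℂ => ‖z - c‖ ^ 2) =
    fun z => (2 : ℕ) • innerSL ℝ (z - c) := by
  funext z
  have h := ((hasStrictFDerivAt_norm_sq (z - c)).hasFDerivAt).comp z
    ((hasFDerivAt_id z).sub_const c)
  simpa [Function.comp_def] using h.fderiv

theorem hasFDerivAt_two_smul_innerSL_sub (c z : ℂ) :
    HasFDerivAt (fun z : ℂ => (2 : ℕ) • innerSL ℝ (z - c))
      ((2 : ℕ) • (innerSL ℝ (E := ℂ)).comp (ContinuousLinearMap.id ℝ ℂ)) z :=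
  ((innerSL ℝ (E := ℂ)).hasFDerivAt.comp z ((hasFDerivAt_id z).sub_const c)).const_smul (2 : ℕ)

theorem snd_fderiv_normSq_sub (c z d : ℂ) :
    fderiv ℝ (fderiv ℝ fun z : ℂ => ‖z - c‖ ^ 2) z d d = 2 * ‖d‖ ^ 2 := by
  rw [fderiv_normSq_sub, (hasFDerivAt_two_smul_innerSL_sub c z).fderiv]
  change (2 : ℕ) • ⟪d, d⟫_ℝ = _
  rw [real_inner_self_eq_norm_sq, nsmul_eq_mul, Nat.cast_ofNat]

/-- A maximum principle on small discs for nonnegative `u` with `Δu ≥ -K u`. -/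
theorem le_of_neg_mul_le_laplacian {u : ℂ → ℝ} {c : ℂ} {R K S : ℝ} (hR : 0 < R)
    (hK : K * (2 * R ^ 2) < 4) (hK0 : 0 ≤ K) (hcont : ContinuousOn u (Metric.closedBall c R))
    (hu : ∀ z ∈ Metric.ball c R, ContDiffAt ℝ 2 u z)
    (hlap : ∀ z ∈ Metric.ball c R, -(K * u z) ≤
      fderiv ℝ (fderiv ℝ u) z 1 1 + fderiv ℝ (fderiv ℝ u) z Complex.I Complex.I)
    (hnn : ∀ z ∈ Metric.closedBall c R, 0 ≤ u z) (hS : ∀ z ∈ Metric.sphere c R, u z ≤ S) :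
    ∀ z ∈ Metric.closedBall c R, u z ≤ 2 * S := by
  -- Comparison function: its Laplacian is `-4` and `R² ≤ ψ ≤ 2R²` on the disc. The assumption `K ·
  -- 2R² < 4` makes positive multiples of `ψ` strict supersolutions, and the ratio of the two bounds
  -- is the factor 2 in the conclusion.
  set ψ : ℂ → ℝ := fun z => 2 * R ^ 2 - ‖z - c‖ ^ 2 with hψ
  have hψR : ∀ z ∈ Metric.closedBall c R, R ^ 2 ≤ ψ z := by
    intro z hz
    rw [mem_closedBall_iff_norm] at hz
    have := pow_le_pow_left₀ (norm_nonneg _) hz 2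
    simp only [hψ]; linarith
  have hψ2 : ∀ z, ψ z ≤ 2 * R ^ 2 := fun z => by simp only [hψ]; nlinarith [norm_nonneg (z - c)]
  have hR2 : 0 < R ^ 2 := by positivity
  have hψc : Continuous ψ := by simp only [hψ]; fun_prop
  obtain ⟨z₀, hz₀, hmax⟩ := (isCompact_closedBall c R).exists_isMaxOn
    ⟨c, Metric.mem_closedBall_self hR.le⟩
    (hcont.div hψc.continuousOn fun z hz => (hR2.trans_le (hψR z hz)).ne')
  set M := u z₀ / ψ z₀ with hM
  have hψ0 : 0 < ψ z₀ := hR2.trans_le (hψR z₀ hz₀)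
  have hM0 : 0 ≤ M := div_nonneg (hnn z₀ hz₀) hψ0.le
  have hle : ∀ z ∈ Metric.closedBall c R, u z ≤ M * ψ z := fun z hz =>
    (div_le_iff₀ (hR2.trans_le (hψR z hz))).1 (hmax hz)
  have hsphere : (Metric.sphere c R).Nonempty := NormedSpace.sphere_nonempty.2 hR.le
  have hS0 : 0 ≤ S := by
    obtain ⟨y, hy⟩ := hsphere
    exact (hnn y (Metric.sphere_subset_closedBall hy)).trans (hS y hy)
  have hMS : M * R ^ 2 ≤ S := by
    by_cases hb : z₀ ∈ Metric.ball c R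
    · have hMz : M = 0 := by
        by_contra hne
        have hMpos : 0 < M := lt_of_le_of_ne hM0 (Ne.symm hne)
        have hψd : ContDiff ℝ 2 ψ :=
          contDiff_const.sub ((contDiff_norm_sq ℝ).comp (contDiff_id.sub contDiff_const))
        set v : ℂ → ℝ := fun z => u z - M * ψ z with hv
        have hvd : ContDiffAt ℝ 2 v z₀ := (hu z₀ hb).sub (contDiffAt_const.mul hψd.contDiffAt)
        have hvmax : IsLocalMax v z₀ := by
          filter_upwards [Metric.isOpen_ball.mem_nhds hb] with y hy
          have h1 := hle y (Metric.ball_subset_closedBall hy)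
          have h2 : M * ψ z₀ = u z₀ := by rw [hM]; field_simp
          simp only [hv]; linarith
        have hsec : ∀ d : ℂ, fderiv ℝ (fderiv ℝ v) z₀ d d =
            fderiv ℝ (fderiv ℝ u) z₀ d d + M * (2 * ‖d‖ ^ 2) := by
          intro d
          have hN : Differentiable ℝ fun z : ℂ => ‖z - c‖ ^ 2 :=
            ((contDiff_norm_sq ℝ).comp (contDiff_id.sub contDiff_const)).differentiable
              (n := 2) (by simp)
          have hN2 : DifferentiableAt ℝ (fderiv ℝ fun z : ℂ => ‖z - c‖ ^ 2) z₀ := by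
            rw [fderiv_normSq_sub]
            exact (hasFDerivAt_two_smul_innerSL_sub c z₀).differentiableAt
          have e : fderiv ℝ v =ᶠ[𝓝 z₀]
              fun z => fderiv ℝ u z + M • fderiv ℝ (fun z : ℂ => ‖z - c‖ ^ 2) z := by
            filter_upwards [Metric.isOpen_ball.mem_nhds hb] with y hy
            have h1 := ((hu y hy).differentiableAt (by simp)).hasFDerivAt
            have h2 := ((hN y).hasFDerivAt.const_sub (2 * R ^ 2)).const_mul M
            rw [(h1.fun_sub h2).fderiv, smul_neg, sub_neg_eq_add]
          have hdf : DifferentiableAt ℝ (fderiv ℝ u) z₀ :=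
            ((hu z₀ hb).fderiv_right (m := 1) (by norm_num)).differentiableAt (by simp)
          rw [e.fderiv_eq, (hdf.hasFDerivAt.fun_add (hN2.hasFDerivAt.fun_const_smul M)).fderiv]
          simp [snd_fderiv_normSq_sub]
        have h1 := snd_fderiv_nonpos_of_isLocalMax hvd hvmax 1
        have h2 := snd_fderiv_nonpos_of_isLocalMax hvd hvmax Complex.I
        rw [hsec] at h1 h2
        simp only [norm_one, Complex.norm_I] at h1 h2
        have h3 := hlap z₀ hb
        have h4 : u z₀ = M * ψ z₀ := by rw [hM]; field_simp
        rw [h4] at h3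
        have h5 : K * (M * ψ z₀) ≤ M * (K * (2 * R ^ 2)) := by
          have := mul_le_mul_of_nonneg_left (hψ2 z₀) (mul_nonneg hK0 hM0)
          linarith
        have h6 := mul_lt_mul_of_pos_left hK hMpos
        linarith
      rw [hMz, zero_mul]; exact hS0
    · have hs : z₀ ∈ Metric.sphere c R := by
        rw [Metric.mem_sphere]
        exact le_antisymm hz₀ (not_lt.1 hb)
      have hψs : ψ z₀ = R ^ 2 := by
        rw [mem_sphere_iff_norm] at hs
        simp only [hψ, hs]; ring
      have : M * ψ z₀ = u z₀ := by rw [hM]; field_simp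
      rw [← hψs, this]
      exact hS z₀ hs
  intro z hz
  calc u z ≤ M * ψ z := hle z hz
    _ ≤ M * (2 * R ^ 2) := mul_le_mul_of_nonneg_left (hψ2 z) hM0
    _ = 2 * (M * R ^ 2) := by ring
    _ ≤ 2 * S := by linarith

/-! ### Leibniz rules in `ℂ⁷` and the Laplacian of `|g|²` -/

theorem contDiffAt_two {W : Type*} [NormedAddCommGroup W] [NormedSpace ℝ W] {h : ℂ → W} {T : Set ℂ}
    (hT : IsOpen T) (hh : ContDiffOn ℝ ∞ h T) {x : ℂ} (hx : x ∈ T) : ContDiffAt ℝ 2 h x := by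
  have := contDiffAt_infty.1 (hh.contDiffAt (hT.mem_nhds hx)) 2
  exact_mod_cast this

theorem snd_fderiv_clm_comp {W U : Type*} [NormedAddCommGroup W] [NormedSpace ℝ W]
    [NormedAddCommGroup U] [NormedSpace ℝ U] (L : W →L[ℝ] U) {h : ℂ → W} {x : ℂ}
    (hh : ContDiffAt ℝ 2 h x) (u v : ℂ) :
    fderiv ℝ (fderiv ℝ fun y => L (h y)) x u v = L (fderiv ℝ (fderiv ℝ h) x u v) := by
  have e : (fderiv ℝ fun y => L (h y)) =ᶠ[𝓝 x]
      (ContinuousLinearMap.compL ℝ ℂ W U L) ∘ fderiv ℝ h := by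
    filter_upwards [hh.eventually (by simp)] with y hy
    exact (L.hasFDerivAt.comp y (hy.differentiableAt (by simp)).hasFDerivAt).fderiv
  have hdf : DifferentiableAt ℝ (fderiv ℝ h) x :=
    (hh.fderiv_right (m := 1) (by norm_num)).differentiableAt (by simp)
  rw [e.fderiv_eq, ((ContinuousLinearMap.hasFDerivAt _).comp x hdf.hasFDerivAt).fderiv]
  rfl

theorem del_dot {h k : ℂ → C7} {x : ℂ} (hh : DifferentiableAt ℝ h x)
    (hk : DifferentiableAt ℝ k x) :
    del (fun y => dot (h y) (k y)) x = dot (del h x) (k x) + dot (h x) (del k x) :=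
  del_bilin dotL hh hk

theorem delBar_dot {h k : ℂ → C7} {x : ℂ} (hh : DifferentiableAt ℝ h x)
    (hk : DifferentiableAt ℝ k x) :
    delBar (fun y => dot (h y) (k y)) x = dot (delBar h x) (k x) + dot (h x) (delBar k x) :=
  delBar_bilin dotL hh hk

theorem del_bicross {h k : ℂ → C7} {x : ℂ} (hh : DifferentiableAt ℝ h x)
    (hk : DifferentiableAt ℝ k x) :
    del (fun y => bicross (h y) (k y)) x = bicross (del h x) (k x) + bicross (h x) (del k x) :=
  del_bilin bicrossL hh hk

theorem delBar_bicross {h k : ℂ → C7} {x : ℂ} (hh : DifferentiableAt ℝ h x)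
    (hk : DifferentiableAt ℝ k x) :
    delBar (fun y => bicross (h y) (k y)) x =
      bicross (delBar h x) (k x) + bicross (h x) (delBar k x) :=
  delBar_bilin bicrossL hh hk

theorem contDiffOn_cj {h : ℂ → C7} {T : Set ℂ} (hh : ContDiffOn ℝ ∞ h T) :
    ContDiffOn ℝ ∞ (fun x => cj (h x)) T := cj.contDiff.comp_contDiffOn hh

theorem contDiffOn_dot {h k : ℂ → C7} {T : Set ℂ} (hh : ContDiffOn ℝ ∞ h T)
    (hk : ContDiffOn ℝ ∞ k T) : ContDiffOn ℝ ∞ (fun x => dot (h x) (k x)) T :=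
  (((dotL (𝕜 := ℂ)).bilinearRestrictScalars ℝ).isBoundedBilinearMap.contDiff
    (n := ∞)).comp_contDiffOn (hh.prodMk hk)

theorem contDiffOn_bicross {h k : ℂ → C7} {T : Set ℂ} (hh : ContDiffOn ℝ ∞ h T)
    (hk : ContDiffOn ℝ ∞ k T) : ContDiffOn ℝ ∞ (fun x => bicross (h x) (k x)) T := by
  have := ((((bicrossL (𝕜 := ℂ)).bilinearRestrictScalars ℝ).isBoundedBilinearMap.contDiff
    (n := ∞)).comp_contDiffOn (hh.prodMk hk))
  refine this.congr fun x _ => ?_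
  simp only [Function.comp_apply, ContinuousLinearMap.bilinearRestrictScalars_apply_apply,
    bicrossL_apply]

theorem norm_dot_le (x y : C7) : ‖dot x y‖ ≤ ‖cj x‖ * ‖y‖ := by
  have := norm_inner_le_norm (𝕜 := ℂ) (cj x) y
  rwa [inner_eq_dot, cj_cj] at this

theorem del_delBar_dot_cj_self {A : ℂ → C7 →L[ℂ] C7} {g : ℂ → C7} {T : Set ℂ} (hT : IsOpen T)
    (hA : ContDiffOn ℝ ∞ A T) (hg : ContDiffOn ℝ ∞ g T) (heq : ∀ x ∈ T, delBar g x = A x (g x))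
    {x : ℂ} (hx : x ∈ T) :
    del (delBar fun y => dot (cj (g y)) (g y)) x =
      dot (cj (del A x (g x) + A x (del g x))) (g x) + dot (cj (del g x)) (del g x) +
        (dot (cj (A x (g x))) (A x (g x)) +
          dot (cj (g x)) (del A x (g x) + A x (del g x))) := by
  have hcg := contDiffOn_cj hg
  have hAg : ContDiffOn ℝ ∞ (fun y => A y (g y)) T :=
    (contDiffOn_delBar hT hg).congr fun y hy => (heq y hy).symm
  have hdg := contDiffOn_del hT hg
  have dA := differentiableAt_of_contDiffOn hT hA hx
  have dg := differentiableAt_of_contDiffOn hT hg hx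
  have dAg := differentiableAt_of_contDiffOn hT hAg hx
  have ddg := differentiableAt_of_contDiffOn hT hdg hx
  have dcg := differentiableAt_of_contDiffOn hT hcg hx
  have dcdg := differentiableAt_of_contDiffOn hT (contDiffOn_cj hdg) hx
  have hwdel : del (fun y => A y (g y)) x = del A x (g x) + A x (del g x) :=
    del_clm_apply dA dg
  have hwbar : delBar (del g) x = del A x (g x) + A x (del g x) := by
    rw [← del_delBar (contDiffAt_two hT hg hx), ← hwdel]
    refine del_congr ?_
    filter_upwards [hT.mem_nhds hx] with y hy using heq y hy
  have e1 : delBar (fun y => dot (cj (g y)) (g y)) =ᶠ[𝓝 x]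
      fun y => dot (cj (del g y)) (g y) + dot (cj (g y)) (A y (g y)) := by
    filter_upwards [hT.mem_nhds hx] with y hy
    have dgy := differentiableAt_of_contDiffOn hT hg hy
    rw [delBar_dot (differentiableAt_of_contDiffOn hT hcg hy) dgy, delBar_cj dgy, heq y hy]
  rw [del_congr e1, del_add (differentiableAt_of_contDiffOn hT
      (contDiffOn_dot (contDiffOn_cj hdg) hg) hx)
    (differentiableAt_of_contDiffOn hT (contDiffOn_dot hcg hAg) hx), del_dot dcdg dg,
    del_dot dcg dAg, del_cj ddg, del_cj dg, hwbar, hwdel, heq x hx]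

/-- This is `Δ = 4 ∂∂̄` applied to `(ḡ, g)`, with the mixed derivative of `g` rewritten through the
equation as `∂(A g)`. -/
theorem laplacian_normSq_eq {A : ℂ → C7 →L[ℂ] C7} {g : ℂ → C7} {T : Set ℂ} (hT : IsOpen T)
    (hA : ContDiffOn ℝ ∞ A T) (hg : ContDiffOn ℝ ∞ g T) (heq : ∀ x ∈ T, delBar g x = A x (g x))
    {x : ℂ} (hx : x ∈ T) :
    fderiv ℝ (fderiv ℝ fun y => ‖g y‖ ^ 2) x 1 1 +
      fderiv ℝ (fderiv ℝ fun y => ‖g y‖ ^ 2) x Complex.I Complex.I =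
    4 * (‖del g x‖ ^ 2 + ‖A x (g x)‖ ^ 2 +
      2 * (dot (cj (g x)) (del A x (g x) + A x (del g x))).re) := by
  have e2 := del_delBar_dot_cj_self hT hA hg heq hx
  have hN2 := contDiffAt_two hT (contDiffOn_dot (contDiffOn_cj hg) hg) hx
  have hu2 : ContDiffAt ℝ 2 (fun y => ‖g y‖ ^ 2) x := contDiffAt_two hT (hg.norm_sq ℂ) hx
  have hNu : (fun y => dot (cj (g y)) (g y)) = fun y => Complex.ofRealCLM (‖g y‖ ^ 2) := by
    funext y; rw [dot_cj_self]; rfl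
  rw [del_delBar hN2, delBar_del hN2, hNu, snd_fderiv_clm_comp Complex.ofRealCLM hu2,
    snd_fderiv_clm_comp Complex.ofRealCLM hu2, ← map_add] at e2
  set w : C7 := del A x (g x) + A x (del g x)
  have hconj : dot (cj w) (g x) = (starRingEnd ℂ) (dot (cj (g x)) w) := by
    rw [conj_dot, cj_cj, dot_comm]
  rw [hconj, dot_cj_self, dot_cj_self] at e2
  have hre := congrArg Complex.re e2
  have h4 : ∀ r : ℝ, ((1 / 4 : ℂ) • Complex.ofRealCLM r).re = r / 4 := fun r => by
    rw [Complex.ofRealCLM_apply, smul_eq_mul,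
      show (1 / 4 : ℂ) * (r : ℂ) = ((r / 4 : ℝ) : ℂ) by push_cast; ring, Complex.ofReal_re]
  rw [h4] at hre
  simp only [Complex.add_re, Complex.conj_re, Complex.ofReal_re] at hre
  linarith

/-- The term `2K |g| |∂g|` is absorbed into `|∂g|²` by completing the square, at the cost of `K²
|g|²`. The constant involves `A` and `∂A` only, so it is common to all quotients of one solution. -/
theorem laplacian_normSq_ge {A : ℂ → C7 →L[ℂ] C7} {g : ℂ → C7} {T : Set ℂ} (hT : IsOpen T)
    (hA : ContDiffOn ℝ ∞ A T) (hg : ContDiffOn ℝ ∞ g T) (heq : ∀ x ∈ T, delBar g x = A x (g x))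
    {x : ℂ} (hx : x ∈ T) {K : ℝ} (hK1 : ‖A x‖ ≤ K) (hK2 : ‖del A x‖ ≤ K) :
    -(4 * (2 * K + K ^ 2) * ‖g x‖ ^ 2) ≤
      fderiv ℝ (fderiv ℝ fun y => ‖g y‖ ^ 2) x 1 1 +
      fderiv ℝ (fderiv ℝ fun y => ‖g y‖ ^ 2) x Complex.I Complex.I := by
  rw [laplacian_normSq_eq hT hA hg heq hx]
  set w : C7 := del A x (g x) + A x (del g x)
  have hb : |(dot (cj (g x)) w).re| ≤ ‖g x‖ * ‖w‖ := by
    refine (Complex.abs_re_le_norm _).trans ?_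
    simpa using norm_dot_le (cj (g x)) w
  have hw' : ‖w‖ ≤ K * ‖g x‖ + K * ‖del g x‖ := by
    refine (norm_add_le _ _).trans (add_le_add ?_ ?_)
    · exact ((del A x).le_opNorm _).trans (by gcongr)
    · exact ((A x).le_opNorm _).trans (by gcongr)
  have h1 := (abs_le.1 hb).1
  have h2 := mul_le_mul_of_nonneg_left hw' (norm_nonneg (g x))
  nlinarith [sq_nonneg (‖del g x‖ - K * ‖g x‖), sq_nonneg ‖A x (g x)‖]

/-- A solution of `∂h/∂z̄ = A h` that is divisible by all powers of `z - c`, with quotients solving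
the same equation, vanishes near `c`. -/
theorem eventually_eq_zero_of_divisible {A : ℂ → C7 →L[ℂ] C7} {h : ℂ → C7} {T : Set ℂ}
    (hT : IsOpen T) (hA : ContDiffOn ℝ ∞ A T) {c : ℂ} (hc : c ∈ T)
    (hdiv : ∀ k : ℕ, ∃ g : ℂ → C7, ContDiffOn ℝ ∞ g T ∧ (∀ z ∈ T, h z = (z - c) ^ k • g z) ∧
      ∀ x ∈ T, delBar g x = A x (g x)) : ∀ᶠ z in 𝓝 c, h z = 0 := by
  obtain ⟨R₀, hR₀, hRT⟩ := Metric.nhds_basis_closedBall.mem_iff.1 (hT.mem_nhds hc)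
  obtain ⟨K₁, hK₁⟩ := (isCompact_closedBall c R₀).exists_bound_of_continuousOn
    (hA.continuousOn.mono hRT)
  obtain ⟨K₂, hK₂⟩ := (isCompact_closedBall c R₀).exists_bound_of_continuousOn
    ((contDiffOn_del hT hA).continuousOn.mono hRT)
  have hcont : ContinuousOn h T := by
    obtain ⟨g, hg, hgh, -⟩ := hdiv 0
    exact hg.continuousOn.congr fun z hz => by simp [hgh z hz]
  obtain ⟨S, hS⟩ := (isCompact_closedBall c R₀).exists_bound_of_continuousOn (hcont.mono hRT)
  set K := max (max K₁ K₂) 0 with hKdef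
  set K' := 4 * (2 * K + K ^ 2) with hK'
  have hK0 : 0 ≤ K := le_max_right _ _
  have hK'0 : 0 ≤ K' := by positivity
  -- With this radius `R ≤ 1` and `K' R ≤ 1`, so `K' · 2R² ≤ 2`, below the threshold 4 of the
  -- maximum principle.
  set R := min R₀ (1 / (K' + 1)) with hRdef
  have hR : 0 < R := lt_min hR₀ (by positivity)
  have hRR : R ≤ R₀ := min_le_left _ _
  have hR1 : R * (K' + 1) ≤ 1 := by
    rw [← le_div_iff₀ (by positivity)]; exact min_le_right _ _
  have hRK : K' * (2 * R ^ 2) < 4 := by nlinarith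
  have hsub : Metric.closedBall c R ⊆ Metric.closedBall c R₀ := Metric.closedBall_subset_closedBall hRR
  have hbound : ∀ k : ℕ, ∀ z ∈ Metric.closedBall c R,
      ‖h z‖ ^ 2 ≤ 2 * S ^ 2 * ((‖z - c‖ / R) ^ 2) ^ k := by
    intro k z hz
    obtain ⟨g, hg, hgh, hgeq⟩ := hdiv k
    -- On the boundary circle the quotient is at most `S / R^k`; the maximum principle carries this
    -- inside with a factor independent of `k`.
    have key := le_of_neg_mul_le_laplacian (u := fun y => ‖g y‖ ^ 2) (S := S ^ 2 / (R ^ 2) ^ k)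
      hR hRK hK'0
      (((hg.norm_sq ℂ).continuousOn).mono (hsub.trans hRT))
      (fun y hy => contDiffAt_two hT (hg.norm_sq ℂ)
        (hRT (hsub (Metric.ball_subset_closedBall hy))))
      (fun y hy => by
        have hy' := hsub (Metric.ball_subset_closedBall hy)
        exact laplacian_normSq_ge hT hA hg hgeq (hRT hy')
          ((hK₁ y hy').trans ((le_max_left _ _).trans (le_max_left _ _)))
          ((hK₂ y hy').trans ((le_max_right _ _).trans (le_max_left _ _))))
      (fun y _ => by positivity)
      (fun y hy => by
        have hy' := hsub (Metric.sphere_subset_closedBall hy)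
        have h1 := hS y hy'
        rw [hgh y (hRT hy'), norm_smul, norm_pow, mem_sphere_iff_norm.1 hy] at h1
        rw [le_div_iff₀ (by positivity)]
        calc ‖g y‖ ^ 2 * (R ^ 2) ^ k = (R ^ k * ‖g y‖) ^ 2 := by ring
          _ ≤ S ^ 2 := pow_le_pow_left₀ (by positivity) h1 2) z hz
    rw [hgh z (hRT (hsub hz)), norm_smul, norm_pow]
    calc (‖z - c‖ ^ k * ‖g z‖) ^ 2 = (‖z - c‖ ^ 2) ^ k * ‖g z‖ ^ 2 := by ring
      _ ≤ (‖z - c‖ ^ 2) ^ k * (2 * (S ^ 2 / (R ^ 2) ^ k)) := by gcongr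
      _ = 2 * S ^ 2 * ((‖z - c‖ / R) ^ 2) ^ k := by rw [div_pow, div_pow]; ring
  filter_upwards [Metric.ball_mem_nhds c hR] with z hz
  have hz1 : (‖z - c‖ / R) ^ 2 < 1 := by
    rw [mem_ball_iff_norm] at hz
    exact pow_lt_one₀ (by positivity) ((div_lt_one hR).2 hz) two_ne_zero
  have hlim := (tendsto_pow_atTop_nhds_zero_of_lt_one (by positivity) hz1).const_mul (2 * S ^ 2)
  rw [mul_zero] at hlim
  have h0 := ge_of_tendsto' hlim fun k => hbound k z (Metric.ball_subset_closedBall hz)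
  have h1 : ‖h z‖ ^ 2 = 0 := le_antisymm h0 (by positivity)
  simpa using h1

/-- Zeros of solutions of `∂h/∂z̄ = A h`: locally, `h` vanishes identically or is a power of the
coordinate times a nowhere vanishing function. -/
theorem eventually_eq_zero_or_exists_eq_pow_smul {A : ℂ → C7 →L[ℂ] C7} {h : ℂ → C7} {T : Set ℂ}
    (hT : IsOpen T) (hA : ContDiffOn ℝ ∞ A T) (hh : ContDiffOn ℝ ∞ h T)
    (heq : ∀ x ∈ T, delBar h x = A x (h x)) {c : ℂ} (hc : c ∈ T) :
    (∀ᶠ z in 𝓝 c, h z = 0) ∨ ∃ (k : ℕ) (g : ℂ → C7), ContDiffOn ℝ ∞ g T ∧ g c ≠ 0 ∧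
      ∀ z ∈ T, h z = (z - c) ^ k • g z := by
  by_contra! hcon
  obtain ⟨hne, hcon⟩ := hcon
  refine hne ?_
  simp only [not_not]
  -- If no quotient is nonzero at `c`, division by `z - c` never stops.
  refine eventually_eq_zero_of_divisible hT hA hc fun k => ?_
  induction k with
  | zero => exact ⟨h, hh, by simp, heq⟩
  | succ k ih =>
    obtain ⟨g, hg, hgh, hgeq⟩ := ih
    have h0 : g c = 0 := by
      by_contra h0
      obtain ⟨z, hz, hz'⟩ := hcon k g hg h0
      exact hz' (hgh z hz)
    obtain ⟨g', hg', hgg', hgeq'⟩ := exists_eq_smul_of_delBar_eq hT hA hg hgeq hc h0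
    exact ⟨g', hg', fun z hz => by rw [hgh z hz, hgg' z hz, smul_smul, pow_succ], hgeq'⟩

/-! ### Conformal harmonic maps in a coordinate -/

/-- `f : T → ℂ⁷`, `T` open in `ℂ`, is the complexification of a conformal harmonic immersion into
the sphere `S⁶`. -/
structure IsHarmonicChart (T : Set ℂ) (f : ℂ → C7) : Prop where
  isOpen : IsOpen T
  smooth : ContDiffOn ℝ ∞ f T
  real : ∀ x ∈ T, cj (f x) = f x
  unit : ∀ x ∈ T, dot (f x) (f x) = 1
  conformal : ∀ x ∈ T, dot (del f x) (del f x) = 0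
  immersion : ∀ x ∈ T, del f x ≠ 0
  harmonic : ∀ x ∈ T, ∃ c : ℂ, delBar (del f) x = c • f x

/-- The squared length of `∂f/∂z`. -/
def energy (f : ℂ → C7) (x : ℂ) : ℂ := dot (del f x) (cj (del f x))

/-- The component of `∂²f/∂z²` orthogonal to `∂f/∂z`. -/
def second (f : ℂ → C7) (x : ℂ) : C7 :=
  del (del f) x - (dot (del (del f) x) (cj (del f x)) / energy f x) • del f x

/-- The endomorphism in the equation `∂f₂/∂z̄ = A f₂` for `f₂ = second f`. -/
def secondEnd (f : ℂ → C7) (x : ℂ) : C7 →L[ℂ] C7 :=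
  (-(energy f x)⁻¹) •
    ContinuousLinearMap.smulRightL ℂ C7 C7 (dotL (cj (second f x))) (del f x)

/-- The direction of the cross product of the two coordinate derivatives. -/
def normalDir (f : ℂ → C7) (x : ℂ) : C7 :=
  (-Complex.I * (energy f x)⁻¹) • bicross (del f x) (cj (del f x))

namespace IsHarmonicChart

variable {T : Set ℂ} {f : ℂ → C7} (h : IsHarmonicChart T f)
include h

theorem dAt {W : Type*} [NormedAddCommGroup W] [NormedSpace ℝ W] {g : ℂ → W}
    (hg : ContDiffOn ℝ ∞ g T) {x : ℂ} (hx : x ∈ T) : DifferentiableAt ℝ g x :=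
  (hg.contDiffAt (h.isOpen.mem_nhds hx)).differentiableAt (by simp)

theorem del_eq_of_eqOn {W : Type*} [NormedAddCommGroup W] [NormedSpace ℝ W] [NormedSpace ℂ W]
    [IsScalarTower ℝ ℂ W] {g k : ℂ → W} (hgk : ∀ x ∈ T, g x = k x) {x : ℂ} (hx : x ∈ T) :
    del g x = del k x :=
  del_congr (by filter_upwards [h.isOpen.mem_nhds hx] with y hy using hgk y hy)

theorem delBar_eq_of_eqOn {W : Type*} [NormedAddCommGroup W] [NormedSpace ℝ W] [NormedSpace ℂ W]
    [IsScalarTower ℝ ℂ W] {g k : ℂ → W} (hgk : ∀ x ∈ T, g x = k x) {x : ℂ} (hx : x ∈ T) :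
    delBar g x = delBar k x :=
  delBar_congr (by filter_upwards [h.isOpen.mem_nhds hx] with y hy using hgk y hy)

theorem smooth_del : ContDiffOn ℝ ∞ (del f) T := contDiffOn_del h.isOpen h.smooth

theorem smooth_del_del : ContDiffOn ℝ ∞ (del (del f)) T := contDiffOn_del h.isOpen h.smooth_del

theorem smooth_energy : ContDiffOn ℝ ∞ (energy f) T :=
  contDiffOn_dot h.smooth_del (contDiffOn_cj h.smooth_del)

variable {x : ℂ} (hx : x ∈ T)
include hx

theorem delBar_eq : delBar f x = cj (del f x) := by
  rw [← delBar_cj (h.dAt h.smooth hx)]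
  exact h.delBar_eq_of_eqOn (fun y hy => (h.real y hy).symm) hx

theorem energy_ne_zero : energy f x ≠ 0 := by
  rw [energy, dot_comm]
  exact fun h0 => h.immersion x hx (dot_cj_self_eq_zero.1 h0)

omit h hx in
theorem conj_energy : (starRingEnd ℂ) (energy f x) = energy f x := by
  rw [energy, conj_dot, cj_cj, dot_comm]

theorem dot_del : dot (f x) (del f x) = 0 := by
  have h1 := h.del_eq_of_eqOn (k := fun _ => 1) h.unit hx
  rw [del_const, del_dot (h.dAt h.smooth hx) (h.dAt h.smooth hx), dot_comm (del f x)] at h1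
  linear_combination h1 / 2

theorem dot_cj_del : dot (f x) (cj (del f x)) = 0 := by
  have := congrArg (starRingEnd ℂ) (h.dot_del hx)
  rwa [conj_dot, h.real x hx, map_zero] at this

/-- Harmonicity only provides some multiple of `f`; the factor comes from the `z̄`-derivative of
`(f, f_z) = 0`. -/
theorem delBar_del_eq : delBar (del f) x = -energy f x • f x := by
  obtain ⟨c, hc⟩ := h.harmonic x hx
  have h1 := h.delBar_eq_of_eqOn (g := fun y => dot (f y) (del f y)) (k := fun _ => 0)
    (fun y hy => h.dot_del hy) hx
  rw [delBar_const, delBar_dot (h.dAt h.smooth hx) (h.dAt h.smooth_del hx), h.delBar_eq hx, hc,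
    dot_smul_right, h.unit x hx, dot_comm] at h1
  rw [hc, energy]
  congr 1
  linear_combination h1

theorem dot_del_del : dot (f x) (del (del f) x) = 0 := by
  have h1 := h.del_eq_of_eqOn (g := fun y => dot (f y) (del f y)) (k := fun _ => 0)
    (fun y hy => h.dot_del hy) hx
  rw [del_const, del_dot (h.dAt h.smooth hx) (h.dAt h.smooth_del hx), h.conformal x hx] at h1
  simpa using h1

theorem del_dot_del_del : dot (del f x) (del (del f) x) = 0 := by
  have h1 := h.del_eq_of_eqOn (k := fun _ => 0) h.conformal hx
  rw [del_const, del_dot (h.dAt h.smooth_del hx) (h.dAt h.smooth_del hx),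
    dot_comm (del (del f) x)] at h1
  linear_combination h1 / 2

theorem del_energy : del (energy f) x = dot (del (del f) x) (cj (del f x)) := by
  have h1 : del (energy f) x = dot (del (del f) x) (cj (del f x)) +
      dot (del f x) (del (fun y => cj (del f y)) x) :=
    del_dot (h.dAt h.smooth_del hx) (h.dAt (contDiffOn_cj h.smooth_del) hx)
  rw [h1, del_cj (h.dAt h.smooth_del hx), h.delBar_del_eq hx, cj_smul, h.real x hx,
    dot_smul_right, dot_comm _ (f x), h.dot_del hx]
  simp

theorem delBar_del_del_eq : delBar (del (del f)) x =
    -dot (del (del f) x) (cj (del f x)) • f x - energy f x • del f x := by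
  rw [← del_delBar (contDiffAt_two h.isOpen h.smooth_del hx),
    h.del_eq_of_eqOn (fun y hy => h.delBar_del_eq hy) hx,
    del_smul (h.dAt h.smooth_energy.neg hx) (h.dAt h.smooth hx)]
  have : del (fun y => -energy f y) x = -del (energy f) x := by
    have := del_sub (differentiableAt_const (0 : ℂ)) (h.dAt h.smooth_energy hx)
    simpa using this
  rw [this, h.del_energy hx, neg_smul (energy f x), sub_eq_add_neg]

theorem dot_second : dot (f x) (second f x) = 0 := by
  rw [second, dot_sub_right, dot_smul_right, h.dot_del_del hx, h.dot_del hx]; simp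

theorem del_dot_second : dot (del f x) (second f x) = 0 := by
  rw [second, dot_sub_right, dot_smul_right, h.del_dot_del_del hx, h.conformal x hx]; simp

theorem second_dot_cj_del : dot (second f x) (cj (del f x)) = 0 := by
  have := h.energy_ne_zero hx
  rw [second, dot_sub_left, dot_smul_left, ← energy]
  field_simp
  ring

theorem second_dot_second : dot (second f x) (second f x) =
    dot (del (del f) x) (del (del f) x) := by
  conv_lhs => rw [second]
  rw [dot_sub_left, dot_smul_left, ← second, h.del_dot_second hx, second, dot_sub_right,
    dot_smul_right, dot_comm _ (del f x), h.del_dot_del_del hx]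
  ring

omit hx in
theorem smooth_coeff :
    ContDiffOn ℝ ∞ (fun y => dot (del (del f) y) (cj (del f y)) / energy f y) T := by
  simp only [div_eq_mul_inv]
  exact (contDiffOn_dot h.smooth_del_del (contDiffOn_cj h.smooth_del)).mul
    (h.smooth_energy.inv fun _ hy => h.energy_ne_zero hy)

omit hx in
theorem smooth_second : ContDiffOn ℝ ∞ (second f) T :=
  h.smooth_del_del.sub (h.smooth_coeff.smul h.smooth_del)

/-- The `f`-components cancel, leaving a multiple of `f_z`. Its coefficient is read off from the
`z̄`-derivative of `(f₂, f̄_z) = 0`. -/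
theorem delBar_second :
    delBar (second f) x = -(dot (second f x) (cj (second f x)) / energy f x) • del f x := by
  set ξ : ℂ → ℂ := fun y => dot (del (del f) y) (cj (del f y)) / energy f y with hξ
  have hξs : ContDiffOn ℝ ∞ ξ T := h.smooth_coeff
  have hE := h.energy_ne_zero hx
  have h1 : delBar (second f) x = (-energy f x - delBar ξ x) • del f x := by
    have e : second f = fun y => del (del f) y - ξ y • del f y := rfl
    have hs : ContDiffOn ℝ ∞ (fun y => ξ y • del f y) T := hξs.smul h.smooth_del
    rw [e, delBar_sub (h.dAt h.smooth_del_del hx) (h.dAt hs hx),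
      delBar_smul (h.dAt hξs hx) (h.dAt h.smooth_del hx), h.delBar_del_del_eq hx,
      h.delBar_del_eq hx]
    simp only [hξ]
    match_scalars
    · field_simp
      ring
    · ring
  have h2 := h.delBar_eq_of_eqOn (g := fun y => dot (second f y) (cj (del f y))) (k := fun _ => 0)
    (fun y hy => h.second_dot_cj_del hy) hx
  rw [delBar_const, delBar_dot (h.dAt h.smooth_second hx)
    (h.dAt (contDiffOn_cj h.smooth_del) hx), delBar_cj (h.dAt h.smooth_del hx), h1,
    dot_smul_left, ← energy] at h2
  have h3 : dot (second f x) (cj (second f x)) = dot (second f x) (cj (del (del f) x)) := by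
    conv_lhs => rw [second.eq_def f x, map_sub, cj_smul, ← second]
    rw [dot_sub_right, dot_smul_right, h.second_dot_cj_del hx]
    ring
  rw [h1]
  congr 1
  rw [h3]
  field_simp
  linear_combination h2

/-- The right-hand side depends on both `f₂` and `f̄₂`. Treating `f̄₂` as a known smooth coefficient
makes it complex linear in `f₂`, which is enough for the study of zeros. -/
theorem delBar_second_eq_secondEnd : delBar (second f) x = secondEnd f x (second f x) := by
  rw [h.delBar_second hx, secondEnd]
  simp [smul_smul, dot_comm, div_eq_mul_inv, mul_comm]

omit hx in
theorem smooth_secondEnd : ContDiffOn ℝ ∞ (secondEnd f) T := by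
  have h1 : ContDiffOn ℝ ∞ (fun y => dotL (𝕜 := ℂ) (cj (second f y))) T :=
    ((dotL (𝕜 := ℂ)).restrictScalars ℝ).contDiff.comp_contDiffOn (contDiffOn_cj h.smooth_second)
  have h2 := (((ContinuousLinearMap.smulRightL ℂ C7 C7).bilinearRestrictScalars
    ℝ).isBoundedBilinearMap.contDiff (n := ∞)).comp_contDiffOn (h1.prodMk h.smooth_del)
  exact ((h.smooth_energy.inv fun _ hy => h.energy_ne_zero hy).neg).smul h2

/-- The zeros of the second element of the harmonic sequence. -/
theorem second_eventually_eq_zero_or :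
    (∀ᶠ z in 𝓝 x, second f z = 0) ∨ ∃ (k : ℕ) (g : ℂ → C7), ContDiffOn ℝ ∞ g T ∧ g x ≠ 0 ∧
      ∀ z ∈ T, second f z = (z - x) ^ k • g z :=
  eventually_eq_zero_or_exists_eq_pow_smul h.isOpen h.smooth_secondEnd h.smooth_second
    (fun _ hy => h.delBar_second_eq_secondEnd hy) hx

theorem isIsotropicFrame (hA : dot (del (del f) x) (del (del f) x) = 0) :
    IsIsotropicFrame (f x) (del f x) (second f x) where
  real := h.real x hx
  unit := h.unit x hx
  ne_zero := h.immersion x hx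
  dot_zero_one := h.dot_del hx
  dot_zero_two := h.dot_second hx
  dot_one_one := h.conformal x hx
  dot_one_two := h.del_dot_second hx
  dot_two_two := by rw [h.second_dot_second hx, hA]
  dot_cj_one_two := by rw [dot_comm, h.second_dot_cj_del hx]

omit h hx in
theorem del_del_eq (x : ℂ) : del (del f) x =
    second f x + (dot (del (del f) x) (cj (del f x)) / energy f x) • del f x := by
  rw [second, sub_add_cancel]

/-- The vectors `f × ∂f` and `∂f × v` are orthogonal. -/
theorem dot_bicross_del (v : C7) : dot (bicross (f x) (del f x)) (bicross (del f x) v) = 0 := by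
  rw [bicross_anticomm (f x), dot_neg_left, dot_bicross_bicross, h.conformal x hx, dot_comm _ (f x),
    h.dot_del hx]
  ring

omit hx in
theorem smooth_normalDir : ContDiffOn ℝ ∞ (normalDir f) T :=
  (contDiffOn_const.mul (h.smooth_energy.inv fun _ hy => h.energy_ne_zero hy)).smul
    (contDiffOn_bicross h.smooth_del (contDiffOn_cj h.smooth_del))

omit h hx in
theorem cj_normalDir : cj (normalDir f x) = normalDir f x := by
  rw [normalDir, cj_smul, cj_bicross, cj_cj, bicross_anticomm (cj (del f x)), map_mul, map_neg,
    Complex.conj_I, map_inv₀, conj_energy]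
  module

omit h hx in
theorem dot_normalDir : dot (del f x) (normalDir f x) = 0 := by
  rw [normalDir, dot_smul_right, dot_bicross_left, mul_zero]

theorem normalDir_bicross_del : bicross (normalDir f x) (del f x) = Complex.I • del f x := by
  have := h.energy_ne_zero hx
  rw [bicross_anticomm, normalDir, bicross_smul_right, bicross_bicross_self, h.conformal x hx,
    ← energy, zero_smul, sub_zero, smul_smul, ← neg_smul]
  congr 1
  field_simp

omit hx in
/-- If `f` satisfies the two conditions that characterize isotropy of the associated surface, then
`∂f × f̄₂ = 0`. -/
theorem bicross_cj_second_eq_zero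
    (hA : ∀ x ∈ T, dot (del (del f) x) (del (del f) x) = 0)
    (hB : ∀ x ∈ T, dot (bicross (f x) (del (del f) x)) (bicross (del f x) (cj (del f x))) = 0) :
    ∀ x ∈ T, bicross (del f x) (cj (second f x)) = 0 := by
  -- The `f_z`-component of `f_zz` contributes nothing to condition B.
  have hP : ∀ x ∈ T, dot (bicross (f x) (second f x)) (bicross (del f x) (cj (del f x))) = 0 := by
    intro x hx
    rw [second, bicross_sub_right, bicross_smul_right, dot_sub_left, dot_smul_left, hB x hx,
      h.dot_bicross_del hx]
    ring
  -- This is the `z̄`-derivative of condition B: the terms `e1` and `e2` cancel, and the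
  -- `f_z`-components drop out again.
  have hQ : ∀ x ∈ T,
      dot (bicross (f x) (second f x)) (bicross (del f x) (cj (second f x))) = 0 := by
    intro x hx
    have d0 := h.dAt h.smooth hx
    have d1 := h.dAt h.smooth_del hx
    have d2 := h.dAt h.smooth_del_del hx
    have dc := h.dAt (contDiffOn_cj h.smooth_del) hx
    have h1 := h.delBar_eq_of_eqOn (k := fun _ => 0) hB hx
    rw [delBar_const, delBar_dot
      (h.dAt (contDiffOn_bicross h.smooth h.smooth_del_del) hx)
      (h.dAt (contDiffOn_bicross h.smooth_del (contDiffOn_cj h.smooth_del)) hx),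
      delBar_bicross d0 d2, delBar_bicross d1 dc, delBar_cj d1, h.delBar_eq hx,
      h.delBar_del_del_eq hx, h.delBar_del_eq hx] at h1
    simp only [bicross_sub_right, bicross_smul_right, bicross_smul_left, bicross_self,
      dot_add_left, dot_add_right, dot_sub_left, dot_smul_left, dot_smul_right, smul_zero,
      dot_zero_left, h.dot_bicross_del hx] at h1
    have e1 : dot (bicross (cj (del f x)) (del (del f) x)) (bicross (del f x) (cj (del f x))) =
        dot (del (del f) x) (cj (del f x)) * energy f x := by
      rw [bicross_anticomm (del f x), dot_neg_right, dot_bicross_bicross, energy,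
        dot_comm (del (del f) x) (del f x), h.del_dot_del_del hx, dot_comm (cj (del f x)) (del f x),
        dot_comm (cj (del f x)) (del (del f) x)]
      ring
    have e2 : dot (bicross (f x) (del (del f) x)) (bicross (f x) (cj (del f x))) =
        dot (del (del f) x) (cj (del f x)) := by
      rw [dot_bicross_bicross, h.unit x hx, h.dot_del_del hx]; ring
    rw [e1, e2] at h1
    have h2 : dot (bicross (f x) (del (del f) x)) (bicross (del f x) (cj (del (del f) x))) = 0 := by
      linear_combination h1
    rw [del_del_eq x, map_add, cj_smul] at h2
    simp only [bicross_add_right, bicross_smul_right, dot_add_left, dot_add_right, dot_smul_left,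
      dot_smul_right, h.dot_bicross_del hx, hP x hx] at h2
    linear_combination h2
  have hY : ContinuousOn (fun x => bicross (del f x) (cj (second f x))) T :=
    (contDiffOn_bicross h.smooth_del (contDiffOn_cj h.smooth_second)).continuousOn
  intro x hx
  by_contra hne
  -- Where `f_z × f̄₂ ≠ 0`, the algebraic alternative gives `f_z × f₂ = 0` on a neighbourhood. Its
  -- `z̄`-derivative is a nonzero multiple of `f × f₂`, so `f₂ = 0`, a contradiction.
  have hnear : ∀ᶠ y in 𝓝 x, bicross (del f y) (second f y) = 0 := by
    filter_upwards [(hY.continuousAt (h.isOpen.mem_nhds hx)).eventually_ne hne,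
      h.isOpen.mem_nhds hx] with y hy hyT
    exact ((h.isIsotropicFrame hyT (hA y hyT)).bicross_eq_zero_or (hP y hyT)
      (hQ y hyT)).resolve_right hy
  have hX : delBar (fun y => bicross (del f y) (second f y)) x = 0 := by
    rw [delBar_congr hnear, delBar_const]
  rw [delBar_bicross (h.dAt h.smooth_del hx) (h.dAt h.smooth_second hx), h.delBar_del_eq hx,
    h.delBar_second hx, bicross_smul_left, bicross_smul_right, bicross_self, smul_zero,
    add_zero] at hX
  have h1 : bicross (f x) (second f x) = 0 :=
    (smul_eq_zero.1 hX).resolve_left (neg_ne_zero.2 (h.energy_ne_zero hx))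
  have h2 := (h.isIsotropicFrame hx (hA x hx)).eq_zero_of_bicross_eq_zero
    (by rw [h.second_dot_second hx, hA x hx]) h1
  exact hne (by rw [h2, map_zero, bicross_zero_right])

/-- The conjugate of `hY` is `f₂ × f̄_z = 0`, so only the `f_z`-component of `f_zz` enters the
derivative of `f_z × f̄_z`, and the derivative of the energy cancels it. What remains comes from `∂
f̄_z = -energy · f`. -/
theorem del_normalDir (hY : bicross (del f x) (cj (second f x)) = 0) :
    del (normalDir f) x = -Complex.I • bicross (f x) (del f x) := by
  have hE := h.energy_ne_zero hx
  have hY' : bicross (second f x) (cj (del f x)) = 0 := by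
    have := congrArg cj hY
    rwa [cj_bicross, cj_cj, map_zero, bicross_anticomm, neg_eq_zero] at this
  have hH : del (fun y => bicross (del f y) (cj (del f y))) x =
      (dot (del (del f) x) (cj (del f x)) / energy f x) • bicross (del f x) (cj (del f x)) +
        energy f x • bicross (f x) (del f x) := by
    rw [del_bicross (h.dAt h.smooth_del hx) (h.dAt (contDiffOn_cj h.smooth_del) hx),
      del_cj (h.dAt h.smooth_del hx), h.delBar_del_eq hx, cj_smul, h.real x hx, bicross_smul_right,
      bicross_anticomm (del f x) (f x), map_neg, conj_energy]
    conv_lhs => rw [del_del_eq x, bicross_add_left, hY', bicross_smul_left]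
    module
  have e1 : energy f x • del (normalDir f) x + del (energy f) x • normalDir f x =
      -Complex.I • del (fun y => bicross (del f y) (cj (del f y))) x := by
    have h1 := h.del_eq_of_eqOn (g := fun y => energy f y • normalDir f y)
      (k := fun y => (fun _ => -Complex.I) y • bicross (del f y) (cj (del f y))) (fun y hy => by
        have := h.energy_ne_zero hy
        rw [normalDir, smul_smul]
        congr 1
        field_simp) hx
    rw [del_smul (h.dAt h.smooth_energy hx) (h.dAt h.smooth_normalDir hx),
      del_smul (differentiableAt_const _)
        (h.dAt (contDiffOn_bicross h.smooth_del (contDiffOn_cj h.smooth_del)) hx), del_const,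
      zero_smul, zero_add] at h1
    rw [← h1, add_comm]
  rw [hH, h.del_energy hx, normalDir.eq_def f x] at e1
  have e2 : energy f x • del (normalDir f) x =
      energy f x • (-Complex.I • bicross (f x) (del f x)) := by
    rw [← sub_eq_iff_eq_add.2 e1.symm]
    match_scalars
    · field_simp
      ring
    · field_simp
  exact smul_right_injective C7 hE e2

omit h hx in
theorem fderiv_eq_zero_of_del {W : Type*} [NormedAddCommGroup W] [NormedSpace ℝ W] [NormedSpace ℂ W]
    [IsScalarTower ℝ ℂ W] {g : ℂ → W} (h1 : del g x = 0) (h2 : delBar g x = 0) :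
    fderiv ℝ g x = 0 := by
  ext u
  · simp [fderiv_eq_del, h1, h2]

/-- Here `n` is orthogonal to `f_z`, and `n_z`, a multiple of `f × f_z`, is orthogonal to `f`. The
function is real, so its `z̄`-derivative is the conjugate of its `z`-derivative. -/
theorem fderiv_dot_normalDir (hY : bicross (del f x) (cj (second f x)) = 0) :
    fderiv ℝ (fun y => dot (f y) (normalDir f y)) x = 0 := by
  have h1 : del (fun y => dot (f y) (normalDir f y)) x = 0 := by
    rw [del_dot (h.dAt h.smooth hx) (h.dAt h.smooth_normalDir hx), dot_normalDir,
      h.del_normalDir hx hY, dot_smul_right, dot_bicross_left]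
    simp
  have h2 : delBar (fun y => dot (f y) (normalDir f y)) x = 0 := by
    have h3 : delBar (normalDir f) x = cj (del (normalDir f) x) := by
      rw [← delBar_cj (h.dAt h.smooth_normalDir hx)]
      exact h.delBar_eq_of_eqOn (fun y hy => cj_normalDir.symm) hx
    rw [delBar_dot (h.dAt h.smooth hx) (h.dAt h.smooth_normalDir hx), h.delBar_eq hx, h3]
    nth_rw 1 [← h.real x hx]
    rw [← cj_normalDir, ← conj_dot, ← conj_dot, ← map_add, ← del_dot (h.dAt h.smooth hx)
      (h.dAt h.smooth_normalDir hx), h1, map_zero]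
  exact fderiv_eq_zero_of_del h1 h2

/-- The two Leibniz terms are `f_z × n = -i f_z` and `f × n_z = -i f × (f × f_z) = i f_z`. -/
theorem fderiv_bicross_normalDir (hY : bicross (del f x) (cj (second f x)) = 0) :
    fderiv ℝ (fun y => bicross (f y) (normalDir f y)) x = 0 := by
  have h1 : del (fun y => bicross (f y) (normalDir f y)) x = 0 := by
    rw [del_bicross (h.dAt h.smooth hx) (h.dAt h.smooth_normalDir hx),
      h.del_normalDir hx hY, bicross_smul_right, bicross_bicross_self, h.dot_del hx, h.unit x hx,
      bicross_anticomm (del f x), h.normalDir_bicross_del hx]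
    module
  have h2 : delBar (fun y => bicross (f y) (normalDir f y)) x = 0 := by
    have h3 : delBar (fun y => bicross (f y) (normalDir f y)) x =
        cj (del (fun y => bicross (f y) (normalDir f y)) x) := by
      rw [← delBar_cj (h.dAt (contDiffOn_bicross h.smooth h.smooth_normalDir) hx)]
      exact h.delBar_eq_of_eqOn (fun y hy => by rw [cj_bicross, h.real y hy, cj_normalDir]) hx
    rw [h3, h1, map_zero]
  exact fderiv_eq_zero_of_del h1 h2

end IsHarmonicChart

/-! ### Change of coordinates -/

section Holomorphic

variable {V : Type*} [NormedAddCommGroup V] [NormedSpace ℝ V] [NormedSpace ℂ V]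
  [IsScalarTower ℝ ℂ V]

theorem eventually_del_comp {h : ℂ → V} {τ : ℂ → ℂ} {y : ℂ} (hτ : AnalyticAt ℂ τ y)
    (hh : ContDiffAt ℝ 2 h (τ y)) :
    del (h ∘ τ) =ᶠ[𝓝 y] fun z => deriv τ z • (del h ∘ τ) z := by
  have h1 : ∀ᶠ z in 𝓝 y, DifferentiableAt ℝ h (τ z) :=
    hτ.continuousAt.eventually ((hh.eventually (by simp)).mono fun z hz =>
      hz.differentiableAt (by simp))
  filter_upwards [h1, hτ.eventually_analyticAt] with z hz hz'
  exact del_comp_holomorphic hz'.differentiableAt.hasDerivAt hz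

theorem differentiableAt_del {h : ℂ → V} {x : ℂ} (hh : ContDiffAt ℝ 2 h x) :
    DifferentiableAt ℝ (del h) x := by
  have hd : DifferentiableAt ℝ (fderiv ℝ h) x :=
    (hh.fderiv_right (m := 1) (by norm_num)).differentiableAt (by simp)
  exact ((hd.clm_apply (differentiableAt_const 1)).sub
    ((hd.clm_apply (differentiableAt_const Complex.I)).const_smul Complex.I)).const_smul (1 / 2 : ℂ)

theorem del_del_comp {h : ℂ → V} {τ : ℂ → ℂ} {y : ℂ} (hτ : AnalyticAt ℂ τ y)
    (hh : ContDiffAt ℝ 2 h (τ y)) :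
    del (del (h ∘ τ)) y =
      deriv (deriv τ) y • del h (τ y) + (deriv τ y ^ 2) • del (del h) (τ y) := by
  have hd := differentiableAt_del hh
  have hτd := hτ.differentiableAt.hasDerivAt
  have hτr : DifferentiableAt ℝ τ y := (hτd.hasFDerivAt.restrictScalars ℝ).differentiableAt
  have hτ2 := hτ.deriv.differentiableAt.hasDerivAt
  rw [del_congr (eventually_del_comp hτ hh),
    del_smul (hτ2.hasFDerivAt.restrictScalars ℝ).differentiableAt (hd.comp y hτr),
    del_of_hasDerivAt hτ2, del_comp_holomorphic hτd hd, smul_smul, sq]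
  rfl

theorem delBar_del_comp {h : ℂ → V} {τ : ℂ → ℂ} {y : ℂ} (hτ : AnalyticAt ℂ τ y)
    (hh : ContDiffAt ℝ 2 h (τ y)) :
    delBar (del (h ∘ τ)) y =
      (deriv τ y * (starRingEnd ℂ) (deriv τ y)) • delBar (del h) (τ y) := by
  have hd := differentiableAt_del hh
  have hτd := hτ.differentiableAt.hasDerivAt
  have hτr : DifferentiableAt ℝ τ y := (hτd.hasFDerivAt.restrictScalars ℝ).differentiableAt
  have hτ2 := hτ.deriv.differentiableAt.hasDerivAt
  rw [delBar_congr (eventually_del_comp hτ hh),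
    delBar_smul (hτ2.hasFDerivAt.restrictScalars ℝ).differentiableAt (hd.comp y hτr),
    delBar_of_hasDerivAt hτ2, delBar_comp_holomorphic hτd hd, smul_smul, zero_smul, zero_add]

end Holomorphic

section Charts

variable {M : Type*} [TopologicalSpace M] [ChartedSpace ℂ M] [IsManifold 𝓘(ℂ) ω M]

theorem contDiffOn_of_mem_atlas {e e' : OpenPartialHomeomorph M ℂ} (he : e ∈ atlas ℂ M)
    (he' : e' ∈ atlas ℂ M) : ContDiffOn ℂ ω (e' ∘ e.symm) (e.symm ≫ₕ e').source := by
  have h := (contDiffGroupoid ω 𝓘(ℂ)).compatible he he'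
  rw [contDiffGroupoid, mem_groupoid_of_pregroupoid] at h
  simpa [contDiffPregroupoid] using h.1

omit [IsManifold 𝓘(ℂ) ω M] in
theorem mem_transition_source {p q : M} (hq : q ∈ (chartAt ℂ p).source) :
    chartAt ℂ q q ∈ ((chartAt ℂ q).symm ≫ₕ chartAt ℂ p).source := by
  simp [hq, mfld_simps]

theorem isManifold_real : IsManifold 𝓘(ℝ, ℂ) ∞ M := by
  refine isManifold_of_contDiffOn _ _ _ fun e e' he he' => ?_
  have := ((contDiffOn_of_mem_atlas he he').restrict_scalars ℝ).of_le (m := ∞) le_top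
  simpa using this

variable {E : Type*} [NormedAddCommGroup E] [NormedSpace ℝ E]

omit [IsManifold 𝓘(ℂ) ω M] in
theorem D_eq_fderiv {s : M → E} {p : M} (hs : MDifferentiableAt 𝓘(ℝ, ℂ) 𝓘(ℝ, E) s p) :
    D s p = fderiv ℝ (loc s p) (chartAt ℂ p p) := by
  have h : D s p = fderivWithin ℝ (writtenInExtChartAt 𝓘(ℝ, ℂ) 𝓘(ℝ, E) p s)
      (Set.range 𝓘(ℝ, ℂ)) (extChartAt 𝓘(ℝ, ℂ) p p) := hs.mfderiv
  rw [h]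
  simp only [writtenInExtChartAt, extChartAt_model_space_eq_id, PartialEquiv.refl_coe,
    Function.id_comp, modelWithCornersSelf_coe, Set.range_id, fderivWithin_univ]
  rfl

theorem contDiffOn_loc {s : M → E} (hs : ContMDiff 𝓘(ℝ, ℂ) 𝓘(ℝ, E) ∞ s) (p : M) :
    ContDiffOn ℝ ∞ (loc s p) (chartAt ℂ p).target := by
  have := isManifold_real (M := M)
  exact contMDiffOn_iff_contDiffOn.1 (hs.comp_contMDiffOn (contMDiffOn_chart_symm (n := ∞)))

omit [IsManifold 𝓘(ℂ) ω M] in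
theorem D_eq_fderiv_of_smooth {s : M → E} (hs : ContMDiff 𝓘(ℝ, ℂ) 𝓘(ℝ, E) ∞ s) (p : M) :
    D s p = fderiv ℝ (loc s p) (chartAt ℂ p p) :=
  D_eq_fderiv (hs.mdifferentiableAt (by simp))

/-- The transition map from the chart at `q` to the chart at `p`. -/
def transition (q p : M) : ℂ → ℂ := chartAt ℂ p ∘ (chartAt ℂ q).symm

omit [IsManifold 𝓘(ℂ) ω M] in
@[simp] theorem transition_apply_self (q p : M) :
    transition q p (chartAt ℂ q q) = chartAt ℂ p q := by
  simp [transition]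

theorem analyticAt_transition {p q : M} (hq : q ∈ (chartAt ℂ p).source) :
    AnalyticAt ℂ (transition q p) (chartAt ℂ q q) :=
  ((contDiffOn_of_mem_atlas (chart_mem_atlas ℂ q) (chart_mem_atlas ℂ p)).contDiffAt
    ((OpenPartialHomeomorph.open_source _).mem_nhds (mem_transition_source hq))).analyticAt

omit [IsManifold 𝓘(ℂ) ω M] in
theorem eventually_symm_mem_source {p q : M} (hq : q ∈ (chartAt ℂ p).source) :
    ∀ᶠ y in 𝓝 (chartAt ℂ q q), y ∈ (chartAt ℂ q).target ∧
      (chartAt ℂ q).symm y ∈ (chartAt ℂ p).source := by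
  filter_upwards [(OpenPartialHomeomorph.open_source _).mem_nhds (mem_transition_source hq)]
    with y hy
  simpa [mfld_simps] using hy

theorem deriv_transition_ne_zero {p q : M} (hq : q ∈ (chartAt ℂ p).source) :
    deriv (transition q p) (chartAt ℂ q q) ≠ 0 := by
  have h1 := (analyticAt_transition hq).differentiableAt.hasDerivAt
  have h2 : DifferentiableAt ℂ (chartAt ℂ q ∘ (chartAt ℂ p).symm) (chartAt ℂ p q) := by
    refine ((contDiffOn_of_mem_atlas (chart_mem_atlas ℂ p) (chart_mem_atlas ℂ q)).contDiffAt
      ((OpenPartialHomeomorph.open_source _).mem_nhds ?_)).differentiableAt (by simp)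
    simp [hq, mfld_simps]
  have h3 : DifferentiableAt ℂ (chartAt ℂ q ∘ (chartAt ℂ p).symm)
      (transition q p (chartAt ℂ q q)) := by rwa [transition_apply_self]
  have h4 := h3.hasDerivAt.comp _ h1
  have e : (chartAt ℂ q ∘ (chartAt ℂ p).symm) ∘ transition q p =ᶠ[𝓝 (chartAt ℂ q q)] id := by
    filter_upwards [eventually_symm_mem_source hq] with y hy
    simp [transition, hy.1, hy.2]
  intro h0
  rw [h0, mul_zero] at h4
  exact one_ne_zero ((hasDerivAt_id _).unique (h4.congr_of_eventuallyEq e.symm))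

omit [IsManifold 𝓘(ℂ) ω M] in
theorem loc_eventuallyEq {W : Type*} (s : M → W) {p q : M} (hq : q ∈ (chartAt ℂ p).source) :
    (fun y => s ((chartAt ℂ q).symm y)) =ᶠ[𝓝 (chartAt ℂ q q)]
      (fun x => s ((chartAt ℂ p).symm x)) ∘ transition q p := by
  filter_upwards [eventually_symm_mem_source hq] with y hy
  simp [transition, hy.2]

/-- The complexification of `φ` in the chart at `p`. -/
def chartMap (φ : M → E7) (p : M) (x : ℂ) : C7 := toC (loc φ p x)

omit [IsManifold 𝓘(ℂ) ω M] in
theorem chartMap_eventuallyEq (φ : M → E7) {p q : M} (hq : q ∈ (chartAt ℂ p).source) :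
    chartMap φ q =ᶠ[𝓝 (chartAt ℂ q q)] chartMap φ p ∘ transition q p :=
  loc_eventuallyEq (fun x => toC (φ x)) hq

theorem contDiffOn_chartMap {φ : M → E7} (hφ : ContMDiff 𝓘(ℝ, ℂ) 𝓘(ℝ, E7) ∞ φ) (p : M) :
    ContDiffOn ℝ ∞ (chartMap φ p) (chartAt ℂ p).target :=
  toC.contDiff.comp_contDiffOn (contDiffOn_loc hφ p)

section Transform

variable {φ : M → E7} (hφ : ContMDiff 𝓘(ℝ, ℂ) 𝓘(ℝ, E7) ∞ φ) {p q : M}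
  (hq : q ∈ (chartAt ℂ p).source)
include hφ hq

theorem contDiffAt_chartMap :
    ContDiffAt ℝ 2 (chartMap φ p) (transition q p (chartAt ℂ q q)) := by
  rw [transition_apply_self]
  exact contDiffAt_two (chartAt ℂ p).open_target (contDiffOn_chartMap hφ p)
    ((chartAt ℂ p).map_source hq)

theorem del_chartMap : del (chartMap φ q) (chartAt ℂ q q) =
    deriv (transition q p) (chartAt ℂ q q) • del (chartMap φ p) (chartAt ℂ p q) := by
  rw [del_congr (chartMap_eventuallyEq φ hq), del_comp_holomorphic
    (analyticAt_transition hq).differentiableAt.hasDerivAt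
    ((contDiffAt_chartMap hφ hq).differentiableAt (by simp)), transition_apply_self]

theorem del_del_chartMap : del (del (chartMap φ q)) (chartAt ℂ q q) =
    deriv (deriv (transition q p)) (chartAt ℂ q q) • del (chartMap φ p) (chartAt ℂ p q) +
      (deriv (transition q p) (chartAt ℂ q q) ^ 2) •
        del (del (chartMap φ p)) (chartAt ℂ p q) := by
  rw [del_congr (eventuallyEq_del (chartMap_eventuallyEq φ hq)),
    del_del_comp (analyticAt_transition hq) (contDiffAt_chartMap hφ hq), transition_apply_self]

theorem delBar_del_chartMap : delBar (del (chartMap φ q)) (chartAt ℂ q q) =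
    (deriv (transition q p) (chartAt ℂ q q) *
      (starRingEnd ℂ) (deriv (transition q p) (chartAt ℂ q q))) •
        delBar (del (chartMap φ p)) (chartAt ℂ p q) := by
  rw [delBar_congr (eventuallyEq_del (chartMap_eventuallyEq φ hq)),
    delBar_del_comp (analyticAt_transition hq) (contDiffAt_chartMap hφ hq), transition_apply_self]

end Transform

/-! ### Conformal harmonic immersions in charts -/

theorem fderiv_toC {g : ℂ → E7} {x : ℂ} (hg : DifferentiableAt ℝ g x) (u : ℂ) :
    fderiv ℝ (fun y => toC (g y)) x u = toC (fderiv ℝ g x u) := by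
  have := (toC.hasFDerivAt.comp x hg.hasFDerivAt).fderiv
  simp only [Function.comp_def] at this
  rw [this]; rfl

theorem contDiffAt_loc {φ : M → E7} (hφ : ContMDiff 𝓘(ℝ, ℂ) 𝓘(ℝ, E7) ∞ φ) (p : M) :
    ContDiffAt ℝ 2 (loc φ p) (chartAt ℂ p p) :=
  contDiffAt_two (chartAt ℂ p).open_target (contDiffOn_loc hφ p) (mem_chart_target ℂ p)

theorem del_chartMap_self {φ : M → E7} (hφ : ContMDiff 𝓘(ℝ, ℂ) 𝓘(ℝ, E7) ∞ φ) (p : M) :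
    del (chartMap φ p) (chartAt ℂ p p) =
      (1 / 2 : ℂ) • (toC (D φ p 1) - Complex.I • toC (D φ p Complex.I)) := by
  have hd : DifferentiableAt ℝ (loc φ p) (chartAt ℂ p p) :=
    (contDiffAt_loc hφ p).differentiableAt (by simp)
  rw [D_eq_fderiv_of_smooth hφ, ← fderiv_toC hd, ← fderiv_toC hd]
  rfl

theorem snd_fderiv_chartMap {φ : M → E7} (hφ : ContMDiff 𝓘(ℝ, ℂ) 𝓘(ℝ, E7) ∞ φ) (p : M) (u v : ℂ) :
    fderiv ℝ (fderiv ℝ (chartMap φ p)) (chartAt ℂ p p) u v = toC (D2 φ p u v) :=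
  snd_fderiv_clm_comp toC (contDiffAt_loc hφ p) u v

theorem contDiffAt_chartMap_self {φ : M → E7} (hφ : ContMDiff 𝓘(ℝ, ℂ) 𝓘(ℝ, E7) ∞ φ) (p : M) :
    ContDiffAt ℝ 2 (chartMap φ p) (chartAt ℂ p p) :=
  contDiffAt_two (chartAt ℂ p).open_target (contDiffOn_chartMap hφ p) (mem_chart_target ℂ p)

theorem delBar_del_chartMap_self {φ : M → E7} (hφ : ContMDiff 𝓘(ℝ, ℂ) 𝓘(ℝ, E7) ∞ φ) (p : M) :
    delBar (del (chartMap φ p)) (chartAt ℂ p p) =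
      (1 / 4 : ℂ) • toC (D2 φ p 1 1 + D2 φ p Complex.I Complex.I) := by
  rw [delBar_del (contDiffAt_chartMap_self hφ p), snd_fderiv_chartMap hφ, snd_fderiv_chartMap hφ,
    map_add]

theorem del_del_chartMap_self {φ : M → E7} (hφ : ContMDiff 𝓘(ℝ, ℂ) 𝓘(ℝ, E7) ∞ φ) (p : M) :
    del (del (chartMap φ p)) (chartAt ℂ p p) =
      (1 / 4 : ℂ) • (toC (D2 φ p 1 1 - D2 φ p Complex.I Complex.I) -
        (2 * Complex.I) • toC (D2 φ p 1 Complex.I)) := by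
  rw [del_del (contDiffAt_chartMap_self hφ p), snd_fderiv_chartMap hφ, snd_fderiv_chartMap hφ,
    snd_fderiv_chartMap hφ, map_sub]

theorem dot_wirtinger_self (a b : E7) :
    dot ((1 / 2 : ℂ) • (toC a - Complex.I • toC b)) ((1 / 2 : ℂ) • (toC a - Complex.I • toC b)) =
      (1 / 4 : ℂ) * ((⟪a, a⟫_ℝ : ℂ) - ⟪b, b⟫_ℝ - 2 * Complex.I * ⟪a, b⟫_ℝ) := by
  simp only [dot_smul_left, dot_smul_right, dot_sub_left, dot_sub_right, dot_toC,
    real_inner_comm a b]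
  linear_combination (1 / 4 * (⟪b, b⟫_ℝ : ℂ)) * Complex.I_mul_I

theorem dot_wirtinger_cj (a b : E7) :
    dot ((1 / 2 : ℂ) • (toC a - Complex.I • toC b))
      (cj ((1 / 2 : ℂ) • (toC a - Complex.I • toC b))) =
      (1 / 4 : ℂ) * ((⟪a, a⟫_ℝ : ℂ) + ⟪b, b⟫_ℝ) := by
  simp only [cj_smul, map_sub, cj_toC, dot_smul_left, dot_smul_right, dot_sub_left, dot_sub_right,
    dot_toC, real_inner_comm a b, Complex.conj_I, map_div₀, map_one, Complex.conj_ofNat]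
  linear_combination (-1 / 4 * (⟪b, b⟫_ℝ : ℂ)) * Complex.I_mul_I

theorem IsConformalMap.inner_eq {L : ℂ →L[ℝ] E7} (hL : IsConformalMap L) :
    ⟪L 1, L Complex.I⟫_ℝ = 0 ∧ ⟪L 1, L 1⟫_ℝ = ⟪L Complex.I, L Complex.I⟫_ℝ ∧
      0 < ⟪L 1, L 1⟫_ℝ := by
  obtain ⟨c, hc, li, rfl⟩ := hL
  have hc2 : 0 < c ^ 2 := by positivity
  simp [inner_smul_left, inner_smul_right, Complex.inner, norm_smul, hc2]

/-- `D` and `D2` at `q` refer to the chart preferred at `q`, which changes from point to point. The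
transition maps transport the pointwise hypotheses to one fixed chart, in which further derivatives
can be taken. -/
theorem isHarmonicChart {φ : M → E7} (hφ : IsSmoothIntoS6 φ) (hharm : IsHarmonicMap φ)
    (hconf : IsConformalImmersion φ) (p : M) :
    IsHarmonicChart (chartAt ℂ p).target (chartMap φ p) := by
  have hpt : ∀ x ∈ (chartAt ℂ p).target, ∃ q ∈ (chartAt ℂ p).source, chartAt ℂ p q = x :=
    fun x hx => ⟨(chartAt ℂ p).symm x, (chartAt ℂ p).map_target hx, (chartAt ℂ p).right_inv hx⟩
  refine ⟨(chartAt ℂ p).open_target, contDiffOn_chartMap hφ.smooth p, fun x _ => cj_toC _, ?_, ?_,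
    ?_, ?_⟩
  · intro x _
    rw [chartMap, dot_toC, real_inner_self_eq_norm_sq, loc, Function.comp_apply,
      mem_sphere_zero_iff_norm.1 (hφ.mem_sphere _)]
    simp
  · intro x hx
    obtain ⟨q, hq, rfl⟩ := hpt x hx
    obtain ⟨h1, h2, -⟩ := IsConformalMap.inner_eq (hconf q)
    have h3 := dot_wirtinger_self (D φ q 1) (D φ q Complex.I)
    rw [← del_chartMap_self hφ.smooth, del_chartMap hφ.smooth hq, h1, h2, dot_smul_left,
      dot_smul_right] at h3
    have h4 := deriv_transition_ne_zero hq
    simpa [h4] using h3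
  · intro x hx h0
    obtain ⟨q, hq, rfl⟩ := hpt x hx
    obtain ⟨-, h2, h3⟩ := IsConformalMap.inner_eq (hconf q)
    have h4 := dot_wirtinger_cj (D φ q 1) (D φ q Complex.I)
    rw [← del_chartMap_self hφ.smooth, del_chartMap hφ.smooth hq, h0, ← h2, smul_zero,
      dot_zero_left] at h4
    have h5 : (⟪D φ q 1, D φ q 1⟫_ℝ : ℂ) = 0 := by linear_combination -2 * h4
    exact h3.ne' (by exact_mod_cast h5)
  · intro x hx
    obtain ⟨q, hq, rfl⟩ := hpt x hx
    set Δ := D2 φ q 1 1 + D2 φ q Complex.I Complex.I with hΔ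
    have hφq : ⟪φ q, φ q⟫_ℝ = 1 := by
      rw [real_inner_self_eq_norm_sq, mem_sphere_zero_iff_norm.1 (hφ.mem_sphere _), one_pow]
    have h1 : Δ = ⟪φ q, Δ⟫_ℝ • φ q := by
      have h2 : ⟪φ q, Δ - ⟪φ q, Δ⟫_ℝ • φ q⟫_ℝ = 0 := by
        rw [inner_sub_right, inner_smul_right, hφq]; ring
      have h3 := hharm q _ h2
      rw [← sub_eq_zero, ← inner_self_eq_zero (𝕜 := ℝ), inner_sub_left, h3, inner_smul_left, h2]
      simp
    have h2 := delBar_del_chartMap_self hφ.smooth q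
    rw [delBar_del_chartMap hφ.smooth hq, ← hΔ, h1] at h2
    have h4 := deriv_transition_ne_zero hq
    set a := deriv (transition q p) (chartAt ℂ q q)
    have ha : a * (starRingEnd ℂ) a ≠ 0 := by simpa using h4
    have h5 : chartMap φ p (chartAt ℂ p q) = toC (φ q) := by simp [chartMap, loc, hq]
    refine ⟨(a * (starRingEnd ℂ) a)⁻¹ * (1 / 4 * (⟪φ q, Δ⟫_ℝ : ℂ)), ?_⟩
    apply smul_right_injective C7 ha
    change _ • _ = _ • _
    rw [h2, h5, map_smul, smul_smul, mul_inv_cancel_left₀ ha, mul_smul]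
    congr 1

/-- The condition `(φ_zz, φ_zz) = 0`. -/
def CondA (φ : M → E7) (p : M) : Prop :=
  dot (del (del (chartMap φ p)) (chartAt ℂ p p)) (del (del (chartMap φ p)) (chartAt ℂ p p)) = 0

/-- The condition `(φ × φ_zz, φ_z × φ_z̄) = 0`. -/
def CondB (φ : M → E7) (p : M) : Prop :=
  dot (bicross (toC (φ p)) (del (del (chartMap φ p)) (chartAt ℂ p p)))
    (bicross (del (chartMap φ p) (chartAt ℂ p p)) (cj (del (chartMap φ p) (chartAt ℂ p p)))) = 0

section Conditions

variable {φ : M → E7} (hφ : IsSmoothIntoS6 φ) (hharm : IsHarmonicMap φ)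
    (hconf : IsConformalImmersion φ) {p : M} {x : ℂ} (hx : x ∈ (chartAt ℂ p).target)
include hφ hharm hconf hx

/-- A holomorphic change of coordinate multiplies `f_zz` by a nonzero factor and adds a multiple of
`f_z`; the latter is invisible because `f_z` is isotropic and orthogonal to `f_zz`. -/
theorem condA_iff : CondA φ ((chartAt ℂ p).symm x) ↔
    dot (del (del (chartMap φ p)) x) (del (del (chartMap φ p)) x) = 0 := by
  have h := isHarmonicChart hφ hharm hconf p
  obtain ⟨q, hq, rfl⟩ : ∃ q ∈ (chartAt ℂ p).source, chartAt ℂ p q = x :=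
    ⟨(chartAt ℂ p).symm x, (chartAt ℂ p).map_target hx, (chartAt ℂ p).right_inv hx⟩
  have h4 := deriv_transition_ne_zero hq
  rw [(chartAt ℂ p).left_inv hq, CondA, del_del_chartMap hφ.smooth hq]
  simp only [dot_add_left, dot_add_right, dot_smul_left, dot_smul_right, h.conformal _ hx,
    h.del_dot_del_del hx, dot_comm _ (del (chartMap φ p) _)]
  simp [h4]

/-- The added multiple of `f_z` is removed by `dot_bicross_del`, and only nonzero factors remain. -/
theorem condB_iff : CondB φ ((chartAt ℂ p).symm x) ↔
    dot (bicross (chartMap φ p x) (del (del (chartMap φ p)) x))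
      (bicross (del (chartMap φ p) x) (cj (del (chartMap φ p) x))) = 0 := by
  have h := isHarmonicChart hφ hharm hconf p
  obtain ⟨q, hq, rfl⟩ : ∃ q ∈ (chartAt ℂ p).source, chartAt ℂ p q = x :=
    ⟨(chartAt ℂ p).symm x, (chartAt ℂ p).map_target hx, (chartAt ℂ p).right_inv hx⟩
  have h4 := deriv_transition_ne_zero hq
  have h5 : chartMap φ p (chartAt ℂ p q) = toC (φ q) := by simp [chartMap, loc, hq]
  have h6 := h.dot_bicross_del hx
  rw [h5] at h6 ⊢
  rw [(chartAt ℂ p).left_inv hq, CondB, del_del_chartMap hφ.smooth hq, del_chartMap hφ.smooth hq]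
  simp only [cj_smul, bicross_add_right, bicross_smul_left, bicross_smul_right, dot_add_left,
    dot_smul_left, dot_smul_right, h6]
  simp [h4]

end Conditions

end Charts

/-! ### The harmonic sequence -/

section HarmonicSequence

variable {M : Type*} [TopologicalSpace M] [ChartedSpace ℂ M]

theorem continuousAt_inner {X : Type*} [TopologicalSpace X] {g h : X → C7} {x : X}
    (hg : ContinuousAt g x) (hh : ContinuousAt h x) :
    ContinuousAt (fun y => ⟪g y, h y⟫_ℂ) x :=
  Filter.Tendsto.inner hg hh

/-- Being parallel to `g` is a closed condition at `p`, since `g` is continuous and nonzero there,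
so taking the closure adds no other direction. Conversely `g p` is a limit of elements of the image.
-/
theorem nextBundle_eq_span {L : M → Submodule ℂ C7} {p : M} {g : M → C7} (hg : ContinuousAt g p)
    (hg0 : g p ≠ 0) (h1 : ∀ᶠ q in 𝓝 p, ∀ w ∈ secondFundImage L q, ∃ c : ℂ, w = c • g q)
    (h2 : ∃ᶠ q in 𝓝 p, g q ∈ secondFundImage L q) : nextBundle L p = Submodule.span ℂ {g p} := by
  apply le_antisymm
  · refine Submodule.span_le.2 fun w hw => ?_
    set Φ : M × C7 → C7 := fun y => ⟪g y.1, g y.1⟫_ℂ • y.2 - ⟪g y.1, y.2⟫_ℂ • g y.1 with hΦ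
    have hgc : ContinuousAt (fun y : M × C7 => g y.1) (p, w) :=
      ContinuousAt.comp (f := Prod.fst) (x := (p, w)) hg continuousAt_fst
    have hc : ContinuousAt Φ (p, w) :=
      ((continuousAt_inner hgc hgc).smul continuousAt_snd).sub
        ((continuousAt_inner hgc continuousAt_snd).smul hgc)
    have hf := mem_closure_iff_frequently.1 hw
    have hev : ∀ᶠ y : M × C7 in 𝓝 (p, w), y.2 ∈ secondFundImage L y.1 → Φ y = 0 := by
      filter_upwards [(continuousAt_fst (p := (p, w))).eventually h1] with y hy hyS
      obtain ⟨c, hc⟩ := hy _ hyS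
      simp only [hΦ, hc, inner_smul_right, smul_smul]
      rw [mul_comm, sub_self]
    have h0 : Φ (p, w) = 0 := by
      by_contra hne
      obtain ⟨y, hy1, hy2, hy3⟩ := (hf.and_eventually (hev.and (hc.eventually_ne hne))).exists
      exact hy3 (hy2 hy1)
    have h3 : ⟪g p, g p⟫_ℂ ≠ 0 := inner_self_ne_zero.2 hg0
    refine Submodule.mem_span_singleton.2 ⟨(⟪g p, g p⟫_ℂ)⁻¹ * ⟪g p, w⟫_ℂ, ?_⟩
    rw [mul_smul, ← sub_eq_zero.1 h0, smul_smul, inv_mul_cancel₀ h3, one_smul]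
  · rw [Submodule.span_singleton_le_iff_mem]
    refine Submodule.subset_span ?_
    exact mem_closure_of_frequently_of_tendsto h2 (continuousAt_id.prodMk hg)

theorem nextBundle_eq_bot {L : M → Submodule ℂ C7} {p : M}
    (h : ∀ᶠ q in 𝓝 p, secondFundImage L q ⊆ {0}) : nextBundle L p = ⊥ := by
  rw [nextBundle, Submodule.span_eq_bot]
  intro w hw
  by_contra hne
  obtain ⟨y, hy1, hy2, hy3⟩ := ((mem_closure_iff_frequently.1 hw).and_eventually
    (((continuousAt_fst (p := (p, w))).eventually h).and
      ((continuousAt_snd (p := (p, w))).eventually_ne hne))).exists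
  exact hy3 (hy2 hy1)

theorem mem_nextBundle {L : M → Submodule ℂ C7} {p : M} {w : C7} (hw : w ∈ secondFundImage L p) :
    w ∈ nextBundle L p :=
  Submodule.subset_span (subset_closure hw)

variable [IsManifold 𝓘(ℂ) ω M]

theorem contDiffAt_comp_chart_symm {s : M → C7} {p q : M}
    (hs : ContMDiffAt 𝓘(ℝ, ℂ) 𝓘(ℝ, C7) ∞ s q) (hq : q ∈ (chartAt ℂ p).source) :
    ContDiffAt ℝ ∞ (fun x => s ((chartAt ℂ p).symm x)) (chartAt ℂ p q) := by
  have := isManifold_real (M := M)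
  have h1 : ContMDiffAt 𝓘(ℝ, ℂ) 𝓘(ℝ, ℂ) ∞ (chartAt ℂ p).symm (chartAt ℂ p q) :=
    (contMDiffOn_chart_symm (n := ∞)).contMDiffAt
      ((chartAt ℂ p).open_target.mem_nhds ((chartAt ℂ p).map_source hq))
  have h2 : ContMDiffAt 𝓘(ℝ, ℂ) 𝓘(ℝ, C7) ∞ s ((chartAt ℂ p).symm (chartAt ℂ p q)) := by
    rwa [(chartAt ℂ p).left_inv hq]
  exact contMDiffAt_iff_contDiffAt.1 (h2.comp _ h1)

theorem contMDiffOn_comp_chart {g : ℂ → C7} {p : M}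
    (hg : ContDiffOn ℝ ∞ g (chartAt ℂ p).target) :
    ContMDiffOn 𝓘(ℝ, ℂ) 𝓘(ℝ, C7) ∞ (fun q => g (chartAt ℂ p q)) (chartAt ℂ p).source := by
  have := isManifold_real (M := M)
  exact (contMDiffOn_iff_contDiffOn.2 hg).comp (contMDiffOn_chart (n := ∞))
    fun q hq => (chartAt ℂ p).map_source hq

theorem dz_eq_del {s : M → C7} {p q : M} (hs : ContMDiffAt 𝓘(ℝ, ℂ) 𝓘(ℝ, C7) ∞ s q)
    (hq : q ∈ (chartAt ℂ p).source) :
    dz s q = deriv (transition q p) (chartAt ℂ q q) •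
      del (fun x => s ((chartAt ℂ p).symm x)) (chartAt ℂ p q) := by
  have h1 : dz s q = del (fun y => s ((chartAt ℂ q).symm y)) (chartAt ℂ q q) := by
    rw [dz, D_eq_fderiv (hs.mdifferentiableAt (by simp))]; rfl
  have h2 := (contDiffAt_comp_chart_symm hs hq).differentiableAt (by simp)
  rw [← transition_apply_self q p] at h2
  rw [h1, del_congr (loc_eventuallyEq s hq), del_comp_holomorphic
    (analyticAt_transition hq).differentiableAt.hasDerivAt h2, transition_apply_self]

omit [IsManifold 𝓘(ℂ) ω M] in
theorem dz_eq_del_self {s : M → C7} {q : M} (hs : ContMDiffAt 𝓘(ℝ, ℂ) 𝓘(ℝ, C7) ∞ s q) :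
    dz s q = del (fun y => s ((chartAt ℂ q).symm y)) (chartAt ℂ q q) := by
  rw [dz, D_eq_fderiv (hs.mdifferentiableAt (by simp))]; rfl

theorem starProjection_orthogonal_span (v w : C7) :
    (Submodule.span ℂ {v})ᗮ.starProjection w = w - (dot w (cj v) / dot v (cj v)) • v := by
  rw [Submodule.starProjection_orthogonal_val, Submodule.starProjection_singleton, inner_eq_dot,
    dot_comm w, dot_comm v (cj v), dot_cj_self]
  rfl

/-- The image of the second fundamental form of a line bundle with a nowhere vanishing section. -/
theorem mem_secondFundImage_iff {L : M → Submodule ℂ C7} {σ : M → C7} {q : M}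
    (hσ : ContMDiffAt 𝓘(ℝ, ℂ) 𝓘(ℝ, C7) ∞ σ q) (h0 : σ q ≠ 0)
    (hL : ∀ᶠ x in 𝓝 q, L x = Submodule.span ℂ {σ x}) (w : C7) :
    w ∈ secondFundImage L q ↔
      ∃ c : ℂ, w = c • (Submodule.span ℂ {σ q})ᗮ.starProjection (dz σ q) := by
  have hqs := mem_chart_source ℂ q
  have hLq : ∀ v, (L q)ᗮ.starProjection v = (Submodule.span ℂ {σ q})ᗮ.starProjection v := by
    intro v
    simp only [hL.self_of_nhds]
  constructor
  · rintro ⟨s, hs, hsL, rfl⟩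
    have hŝ := contDiffAt_comp_chart_symm hs hqs
    have hσ' := contDiffAt_comp_chart_symm hσ hqs
    set s' : ℂ → C7 := fun x => s ((chartAt ℂ q).symm x) with hs'
    set σ' : ℂ → C7 := fun x => σ ((chartAt ℂ q).symm x) with hσ'def
    set y := chartAt ℂ q q with hy
    have hσy : σ' y = σ q := by simp [hσ'def, hy]
    -- The coefficient of `s` along `σ`, written as a Hermitian quotient so that it is visibly
    -- smooth. Its derivative multiplies `σ` and is killed by the projection.
    set lam : ℂ → ℂ := fun x => ⟪σ' x, s' x⟫_ℂ * (⟪σ' x, σ' x⟫_ℂ)⁻¹ with hlam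
    have h0' : ⟪σ' y, σ' y⟫_ℂ ≠ 0 := by rw [hσy]; exact inner_self_ne_zero.2 h0
    have hlamd : DifferentiableAt ℝ lam y :=
      ((hσ'.inner ℂ hŝ).mul ((hσ'.inner ℂ hσ').inv h0')).differentiableAt (by simp)
    have hcont : Filter.Tendsto (chartAt ℂ q).symm (𝓝 y) (𝓝 q) := by
      have := (chartAt ℂ q).continuousAt_symm ((chartAt ℂ q).map_source hqs)
      rwa [ContinuousAt, (chartAt ℂ q).left_inv hqs] at this
    have e : s' =ᶠ[𝓝 y] fun x => lam x • σ' x := by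
      filter_upwards [hcont.eventually hsL, hcont.eventually hL,
        hσ'.continuousAt.eventually_ne (by rw [hσy]; exact h0)] with x h1 h2 h3
      rw [h2] at h1
      obtain ⟨c, hc⟩ := Submodule.mem_span_singleton.1 h1
      have h4 : ⟪σ' x, σ' x⟫_ℂ ≠ 0 := inner_self_ne_zero.2 h3
      have h5 : s' x = c • σ' x := hc.symm
      simp only [hlam, h5, inner_smul_right, mul_inv_cancel_right₀ h4]
    refine ⟨lam y, ?_⟩
    rw [dz_eq_del_self hs, dz_eq_del_self hσ, del_congr e,
      del_smul hlamd (hσ'.differentiableAt (by simp)), hLq, map_add, map_smul, map_smul, hσy]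
    have h6 : (Submodule.span ℂ {σ q})ᗮ.starProjection (σ q) = 0 := by
      rw [Submodule.starProjection_apply_eq_zero_iff, Submodule.orthogonal_orthogonal]
      exact Submodule.mem_span_singleton_self _
    rw [h6, smul_zero, zero_add]
  · rintro ⟨c, rfl⟩
    have hcσ : ContMDiffAt 𝓘(ℝ, ℂ) 𝓘(ℝ, C7) ∞ (fun x => c • σ x) q :=
      (contDiff_const_smul (𝕜 := ℝ) (n := ∞) c).contMDiff.contMDiffAt.comp q hσ
    refine ⟨fun x => c • σ x, hcσ, ?_, ?_⟩
    · filter_upwards [hL] with x hx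
      rw [hx]
      exact Submodule.smul_mem _ _ (Submodule.mem_span_singleton_self _)
    · rw [dz_eq_del_self hcσ, dz_eq_del_self hσ, del_smul (differentiableAt_const c)
        ((contDiffAt_comp_chart_symm hσ hqs).differentiableAt (by simp)), del_const, zero_smul,
        zero_add, map_smul, hLq]

variable {φ : M → E7} (hφ : IsSmoothIntoS6 φ) (hharm : IsHarmonicMap φ)
    (hconf : IsConformalImmersion φ)
include hφ hharm hconf

theorem mem_secondFundImage_zero {p q : M} (hq : q ∈ (chartAt ℂ p).source) (w : C7) :
    w ∈ secondFundImage (harmonicSeq φ 0) q ↔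
      ∃ c : ℂ, w = c • del (chartMap φ p) (chartAt ℂ p q) := by
  have h := isHarmonicChart hφ hharm hconf p
  have hx := (chartAt ℂ p).map_source hq
  have hσ : ContMDiffAt 𝓘(ℝ, ℂ) 𝓘(ℝ, C7) ∞ (fun x => toC (φ x)) q :=
    toC.contDiff.contMDiff.contMDiffAt.comp q hφ.smooth.contMDiffAt
  have h5 : chartMap φ p (chartAt ℂ p q) = toC (φ q) := by simp [chartMap, loc, hq]
  have hunit := h.unit _ hx
  have hdot := h.dot_del hx
  rw [h5] at hunit hdot
  change w ∈ secondFundImage (fun x => Submodule.span ℂ {toC (φ x)}) q ↔ _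
  have h4 := deriv_transition_ne_zero hq
  rw [mem_secondFundImage_iff hσ (fun h0 => by rw [h0] at hunit; simp at hunit)
    (Filter.Eventually.of_forall fun x => rfl), dz_eq_del hσ hq, map_smul,
    starProjection_orthogonal_span, cj_toC, hunit, dot_comm]
  have e : del (fun x => toC (φ ((chartAt ℂ p).symm x))) = del (chartMap φ p) := rfl
  rw [e, hdot, zero_div, zero_smul, sub_zero]
  exact ⟨fun ⟨c, hc⟩ => ⟨c * _, by rw [hc, smul_smul]⟩, fun ⟨c, hc⟩ => ⟨c * _⁻¹, by
    rw [hc, smul_smul, inv_mul_cancel_right₀ h4]⟩⟩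

theorem harmonicSeq_one {p q : M} (hq : q ∈ (chartAt ℂ p).source) :
    harmonicSeq φ 1 q = Submodule.span ℂ {del (chartMap φ p) (chartAt ℂ p q)} := by
  have h := isHarmonicChart hφ hharm hconf p
  have hx := (chartAt ℂ p).map_source hq
  have hnear : ∀ᶠ x in 𝓝 q, x ∈ (chartAt ℂ p).source := (chartAt ℂ p).open_source.mem_nhds hq
  refine nextBundle_eq_span (g := fun q => del (chartMap φ p) (chartAt ℂ p q)) ?_
    (h.immersion _ hx) ?_ (Filter.Eventually.frequently ?_)
  · exact ContinuousAt.comp (f := chartAt ℂ p)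
      (h.smooth_del.continuousOn.continuousAt (h.isOpen.mem_nhds hx))
      ((chartAt ℂ p).continuousAt hq)
  · filter_upwards [hnear] with x hx w hw
    exact (mem_secondFundImage_zero hφ hharm hconf hx w).1 hw
  · filter_upwards [hnear] with x hx
    exact (mem_secondFundImage_zero hφ hharm hconf hx _).2 ⟨1, (one_smul _ _).symm⟩

theorem mem_secondFundImage_one {p q : M} (hq : q ∈ (chartAt ℂ p).source) (w : C7) :
    w ∈ secondFundImage (harmonicSeq φ 1) q ↔
      ∃ c : ℂ, w = c • second (chartMap φ p) (chartAt ℂ p q) := by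
  have h := isHarmonicChart hφ hharm hconf p
  have hx := (chartAt ℂ p).map_source hq
  have hσ : ContMDiffAt 𝓘(ℝ, ℂ) 𝓘(ℝ, C7) ∞ (fun x => del (chartMap φ p) (chartAt ℂ p x)) q :=
    (contMDiffOn_comp_chart h.smooth_del).contMDiffAt ((chartAt ℂ p).open_source.mem_nhds hq)
  have h4 := deriv_transition_ne_zero hq
  have e : del (fun x => del (chartMap φ p) (chartAt ℂ p ((chartAt ℂ p).symm x)))
      (chartAt ℂ p q) = del (del (chartMap φ p)) (chartAt ℂ p q) :=
    h.del_eq_of_eqOn (fun y hy => by rw [(chartAt ℂ p).right_inv hy]) hx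
  rw [mem_secondFundImage_iff hσ (h.immersion _ hx) (by
    filter_upwards [(chartAt ℂ p).open_source.mem_nhds hq] with x hx
    exact harmonicSeq_one hφ hharm hconf hx), dz_eq_del hσ hq, map_smul,
    starProjection_orthogonal_span, e]
  exact ⟨fun ⟨c, hc⟩ => ⟨c * _, by rw [hc, smul_smul]; rfl⟩, fun ⟨c, hc⟩ => ⟨c * _⁻¹, by
    rw [hc, smul_smul, inv_mul_cancel_right₀ h4]; rfl⟩⟩

theorem secondFundImage_subset_zero_iff {p q : M} (hq : q ∈ (chartAt ℂ p).source) :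
    secondFundImage (harmonicSeq φ 1) q ⊆ {0} ↔
      second (chartMap φ p) (chartAt ℂ p q) = 0 := by
  constructor
  · intro h
    exact h ((mem_secondFundImage_one hφ hharm hconf hq _).2 ⟨1, (one_smul _ _).symm⟩)
  · intro h w hw
    obtain ⟨c, rfl⟩ := (mem_secondFundImage_one hφ hharm hconf hq _).1 hw
    rw [h, smul_zero]; rfl

omit hφ hharm hconf [IsManifold 𝓘(ℂ) ω M] in
theorem frequently_ne (p q : M) : ∃ᶠ x in 𝓝 q, x ≠ p := by
  intro hev
  simp only [not_not] at hev
  have hqs := mem_chart_source ℂ q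
  have h1 : ∀ᶠ z in 𝓝 (chartAt ℂ q q), z = chartAt ℂ q q := by
    rw [← (chartAt ℂ q).map_nhds_eq hqs, Filter.eventually_map]
    filter_upwards [hev] with x hx
    rw [hx, hev.self_of_nhds]
  have h2 : ∃ᶠ z in 𝓝 (chartAt ℂ q q), z ∈ ({chartAt ℂ q q} : Set ℂ)ᶜ :=
    mem_closure_iff_frequently.1 (dense_compl_singleton _ _)
  obtain ⟨z, hz, hz'⟩ := (h2.and_eventually h1).exists
  exact hz hz'

/-- Locally, the second element of the harmonic sequence vanishes or is spanned by a nowhere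
vanishing section. -/
theorem harmonicSeq_two_local (p : M) :
    (∀ᶠ q in 𝓝 p, secondFundImage (harmonicSeq φ 1) q ⊆ {0}) ∨
    ((∀ᶠ q in 𝓝 p, q ≠ p → ¬ secondFundImage (harmonicSeq φ 1) q ⊆ {0}) ∧
      ∃ U : Set M, IsOpen U ∧ p ∈ U ∧ ∃ s : M → C7, ContMDiffOn 𝓘(ℝ, ℂ) 𝓘(ℝ, C7) ∞ s U ∧
        ContinuousAt s p ∧
        (∀ q ∈ U, s q ≠ 0 ∧ harmonicSeq φ 2 q = Submodule.span ℂ {s q}) ∧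
        ∀ q ∈ U, q ≠ p → ∃ c : ℂ, s q = c • second (chartMap φ p) (chartAt ℂ p q)) := by
  have h := isHarmonicChart hφ hharm hconf p
  have hps := mem_chart_source ℂ p
  have hx := (chartAt ℂ p).map_source hps
  have hnear : ∀ᶠ x in 𝓝 p, x ∈ (chartAt ℂ p).source := (chartAt ℂ p).open_source.mem_nhds hps
  rcases h.second_eventually_eq_zero_or hx with h0 | ⟨k, g, hg, hg0, hgk⟩
  · left
    filter_upwards [((chartAt ℂ p).continuousAt hps).eventually h0, hnear] with q hq hqs
    exact (secondFundImage_subset_zero_iff hφ hharm hconf hqs).2 hq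
  right
  -- On the set where the factor `g` is nonzero, `g` itself is the section that spans the bundle
  -- across the removed zero.
  have hUo : IsOpen ((chartAt ℂ p).target ∩ g ⁻¹' {0}ᶜ) :=
    hg.continuousOn.isOpen_inter_preimage h.isOpen isOpen_compl_singleton
  have hU := (chartAt ℂ p).isOpen_inter_preimage hUo
  set U : Set M := (chartAt ℂ p).source ∩ chartAt ℂ p ⁻¹' ((chartAt ℂ p).target ∩ g ⁻¹' {0}ᶜ)
    with hUdef
  have hpU : p ∈ U := ⟨hps, hx, hg0⟩
  have hne : ∀ q ∈ U, q ≠ p → chartAt ℂ p q - chartAt ℂ p p ≠ 0 := fun q hq hqp h0 =>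
    hqp ((chartAt ℂ p).injOn hq.1 hps (sub_eq_zero.1 h0))
  have hsm : ContMDiffOn 𝓘(ℝ, ℂ) 𝓘(ℝ, C7) ∞ (fun q => g (chartAt ℂ p q)) U :=
    (contMDiffOn_comp_chart hg).mono fun q hq => hq.1
  have hmem : ∀ q ∈ U, q ≠ p → g (chartAt ℂ p q) =
      ((chartAt ℂ p q - chartAt ℂ p p) ^ k)⁻¹ • second (chartMap φ p) (chartAt ℂ p q) := by
    intro q hq hqp
    rw [hgk _ hq.2.1, smul_smul, inv_mul_cancel₀ (pow_ne_zero _ (hne q hq hqp)), one_smul]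
  refine ⟨?_, U, hU, hpU, fun q => g (chartAt ℂ p q), hsm, ?_, fun q hq => ⟨hq.2.2, ?_⟩,
    fun q hq hqp => ⟨_, hmem q hq hqp⟩⟩
  · filter_upwards [hU.mem_nhds hpU] with q hq hqp hzero
    rw [secondFundImage_subset_zero_iff hφ hharm hconf hq.1] at hzero
    have := hmem q hq hqp
    rw [hzero, smul_zero] at this
    exact hq.2.2 this
  · exact (hsm.contMDiffAt (hU.mem_nhds hpU)).continuousAt
  · refine nextBundle_eq_span (g := fun q => g (chartAt ℂ p q))
      (hsm.contMDiffAt (hU.mem_nhds hq)).continuousAt hq.2.2 ?_ ?_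
    · filter_upwards [hU.mem_nhds hq] with y hy w hw
      obtain ⟨c, rfl⟩ := (mem_secondFundImage_one hφ hharm hconf hy.1 _).1 hw
      exact ⟨c * _, by rw [hgk _ hy.2.1, smul_smul]⟩
    · refine ((frequently_ne p q).and_eventually (hU.mem_nhds hq)).mono fun y hy => ?_
      exact (mem_secondFundImage_one hφ hharm hconf hy.2.1 _).2 ⟨_, hmem y hy.2 hy.1⟩

theorem condA_iff_second (p : M) : CondA φ p ↔
    dot (second (chartMap φ p) (chartAt ℂ p p)) (second (chartMap φ p) (chartAt ℂ p p)) = 0 := by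
  rw [CondA, (isHarmonicChart hφ hharm hconf p).second_dot_second (mem_chart_target ℂ p)]

/-- The set of points near which `f₂` vanishes is open, and it is closed because any other zero is
isolated. Connectedness leaves only the two extremes. -/
theorem harmonicSeq_two_zero_or_lineBundle [PreconnectedSpace M] :
    IsZeroBundle (harmonicSeq φ 2) ∨ ∀ p : M,
      ¬ ∀ᶠ q in 𝓝 p, secondFundImage (harmonicSeq φ 1) q ⊆ {0} := by
  set Z : Set M := {p | ∀ᶠ q in 𝓝 p, secondFundImage (harmonicSeq φ 1) q ⊆ {0}} with hZ
  have hopen : IsOpen Z := isOpen_setOfPred_eventually_nhds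
  have hclosed : IsClosed Z := by
    refine isClosed_of_closure_subset fun p hp => ?_
    rcases harmonicSeq_two_local hφ hharm hconf p with h | ⟨h, -⟩
    · exact h
    exfalso
    obtain ⟨q, hq, hqZ⟩ := ((mem_closure_iff_frequently.1 hp).and_eventually
      h.eventually_nhds).exists
    obtain ⟨x, hx, hx1, hx2⟩ := ((frequently_ne p q).and_eventually (hqZ.and hq)).exists
    exact hx1 hx hx2
  rcases isClopen_iff.1 ⟨hclosed, hopen⟩ with h | h
  · right
    intro p hp
    exact (h ▸ (show p ∈ Z from hp) : p ∈ (∅ : Set M))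
  · left
    intro p
    exact nextBundle_eq_bot (show p ∈ Z by rw [h]; trivial)

/-- Off the removed zeros the spanning section is a multiple of `f₂`, and `(f₂, f₂) = (f_zz, f_zz)`;
continuity of the section extends isotropy to the zeros. -/
theorem harmonicSeq_two_isotropic_iff [PreconnectedSpace M] :
    (IsZeroBundle (harmonicSeq φ 2) ∨ IsIsotropicLineBundle (harmonicSeq φ 2)) ↔
      ∀ p, CondA φ p := by
  constructor
  · intro h p
    rw [condA_iff_second hφ hharm hconf]
    have hmem : second (chartMap φ p) (chartAt ℂ p p) ∈ harmonicSeq φ 2 p :=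
      mem_nextBundle ((mem_secondFundImage_one hφ hharm hconf (mem_chart_source ℂ p) _).2
        ⟨1, (one_smul _ _).symm⟩)
    rcases h with h | h
    · rw [h p, Submodule.mem_bot] at hmem
      rw [hmem, dot_zero_left]
    · exact h.isotropic p _ hmem _ hmem
  · intro hA
    refine (harmonicSeq_two_zero_or_lineBundle hφ hharm hconf).imp_right fun hne => ?_
    have hloc := fun p => (harmonicSeq_two_local hφ hharm hconf p).resolve_left (hne p)
    refine ⟨fun p => ?_, fun p x hx y hy => ?_⟩
    · obtain ⟨-, U, hU, hpU, s, hs, -, hsU, -⟩ := hloc p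
      exact ⟨U, hU, hpU, s, hs, hsU⟩
    · obtain ⟨-, U, hU, hpU, s, -, hsc, hsU, hsec⟩ := hloc p
      have h0 : dot (s p) (s p) = 0 := by
        by_contra h1
        have hc : ContinuousAt (fun q => dot (s q) (s q)) p := by
          unfold dot; fun_prop
        obtain ⟨q, hqp, hq, hqU, hqs⟩ := ((frequently_ne p p).and_eventually
          ((hc.eventually_ne h1).and ((Filter.eventually_of_mem (hU.mem_nhds hpU) fun _ h => h).and
            ((chartAt ℂ p).open_source.mem_nhds (mem_chart_source ℂ p))))).exists
        obtain ⟨c, hc⟩ := hsec q hqU hqp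
        apply hq
        have hx := (chartAt ℂ p).map_source hqs
        have h2 := (condA_iff hφ hharm hconf hx).1 (hA _)
        rw [hc, dot_smul_left, dot_smul_right,
          (isHarmonicChart hφ hharm hconf p).second_dot_second hx, h2, mul_zero, mul_zero]
      rw [(hsU p hpU).2] at hx hy
      obtain ⟨a, rfl⟩ := Submodule.mem_span_singleton.1 hx
      obtain ⟨b, rfl⟩ := Submodule.mem_span_singleton.1 hy
      change dot (a • s p) (b • s p) = 0
      rw [dot_smul_left, dot_smul_right, h0, mul_zero, mul_zero]

end HarmonicSequence

/-! ### The fundamental forms of the associated surface -/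

/-- The relations satisfied by a unit vector `f`, the first derivatives `a`, `b` and the second
derivatives `Q = f_xy`, `R = f_yy` of a conformal harmonic map to the sphere. -/
structure IsHarmonicJet (e : ℝ) (f a b Q R : E7) : Prop where
  pos : 0 < e
  ff : dot f f = 1
  fa : dot f a = 0
  fb : dot f b = 0
  ab : dot a b = 0
  aa : dot a a = e
  bb : dot b b = e
  fQ : dot f Q = 0
  fR : dot f R = -e
  aR : dot a R = -dot b Q
  bR : dot b R = dot a Q

/-- The component of `w` orthogonal to `f × a` and `f × b`. -/
def normalPart (e : ℝ) (f a b w : E7) : E7 :=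
  w - (dot w (bicross f a) / e) • bicross f a - (dot w (bicross f b) / e) • bicross f b

theorem normalPart_add (e : ℝ) (f a b v w : E7) :
    normalPart e f a b (v + w) = normalPart e f a b v + normalPart e f a b w := by
  simp only [normalPart, dot_add_left, add_div]; module

theorem normalPart_smul (e : ℝ) (f a b w : E7) (r : ℝ) :
    normalPart e f a b (r • w) = r • normalPart e f a b w := by
  simp only [normalPart, dot_smul_left, mul_div_assoc]; module

namespace IsHarmonicJet

variable {e : ℝ} {f a b Q R : E7} (h : IsHarmonicJet e f a b Q R)
include h

theorem dot_tangent (v w : E7) (hv : dot f v = 0) :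
    dot (bicross f v) (bicross f w) = dot v w := by
  rw [dot_bicross_bicross, h.ff, hv]; ring

theorem dot_cross_left : dot (bicross a b) (bicross f a) = 0 := by
  rw [bicross_anticomm f a, dot_neg_right, dot_bicross_bicross, dot_comm a f, dot_comm b f, h.fa,
    h.fb]
  simp

theorem dot_cross_right : dot (bicross a b) (bicross f b) = 0 := by
  rw [bicross_anticomm a b, bicross_anticomm f b, dot_neg_left, dot_neg_right, dot_bicross_bicross,
    dot_comm a f, dot_comm b f, dot_comm b a, h.fa, h.fb, h.ab]
  simp

theorem dot_cross_cross : dot (bicross a b) (bicross a b) = e ^ 2 := by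
  rw [dot_bicross_bicross, h.aa, h.bb, h.ab]; ring

theorem normalPart_cross : normalPart e f a b (bicross a b) = bicross a b := by
  simp [normalPart, h.dot_cross_left, h.dot_cross_right]

theorem dot_normalPart_normalPart (v w : E7) :
    dot (normalPart e f a b v) (normalPart e f a b w) = dot v w -
      (dot v (bicross f a) * dot w (bicross f a) + dot v (bicross f b) * dot w (bicross f b)) / e := by
  have he := h.pos.ne'
  have h1 := h.dot_tangent a b h.fa
  have h2 := h.dot_tangent b a h.fb
  have h3 := h.dot_tangent a a h.fa
  have h4 := h.dot_tangent b b h.fb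
  simp only [normalPart, dot_sub_left, dot_sub_right, dot_smul_left, dot_smul_right, h1, h2, h3, h4,
    h.aa, h.bb, h.ab, dot_comm b a, dot_comm (bicross f _) w]
  field_simp
  ring

theorem dot_normalPart_cross (w : E7) :
    dot (normalPart e f a b w) (bicross a b) = dot w (bicross a b) := by
  have h1 := h.dot_cross_left
  have h2 := h.dot_cross_right
  simp [normalPart, dot_sub_left, dot_smul_left, dot_comm (bicross f _) (bicross a b), h1, h2]

theorem dot_normalPart_left (w : E7) : dot (normalPart e f a b w) (bicross f a) = 0 := by
  have he := h.pos.ne'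
  have h2 := h.dot_tangent b a h.fb
  have h3 := h.dot_tangent a a h.fa
  simp only [normalPart, dot_sub_left, dot_smul_left, h2, h3, h.aa, dot_comm b a, h.ab]
  field_simp
  ring

theorem dot_normalPart_right (w : E7) : dot (normalPart e f a b w) (bicross f b) = 0 := by
  have he := h.pos.ne'
  have h2 := h.dot_tangent a b h.fa
  have h3 := h.dot_tangent b b h.fb
  simp only [normalPart, dot_sub_left, dot_smul_left, h2, h3, h.bb, h.ab]
  field_simp
  ring

theorem normSq_Q : dot (normalPart e f a b (bicross f Q)) (normalPart e f a b (bicross f Q)) =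
    dot Q Q - (dot a Q ^ 2 + dot b Q ^ 2) / e := by
  rw [h.dot_normalPart_normalPart, h.dot_tangent Q Q h.fQ, h.dot_tangent Q a h.fQ,
    h.dot_tangent Q b h.fQ, dot_comm Q a, dot_comm Q b]
  ring

theorem normSq_R : dot (normalPart e f a b (bicross f R)) (normalPart e f a b (bicross f R)) =
    dot R R - e ^ 2 - (dot a Q ^ 2 + dot b Q ^ 2) / e := by
  rw [h.dot_normalPart_normalPart, dot_bicross_bicross, dot_comm (bicross f R) (bicross f a),
    dot_comm (bicross f R) (bicross f b), h.dot_tangent a R h.fa, h.dot_tangent b R h.fb, h.ff, h.fR,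
    h.aR, h.bR]
  ring

theorem dot_Q_R : dot (normalPart e f a b (bicross f Q)) (normalPart e f a b (bicross f R)) =
    dot Q R := by
  rw [h.dot_normalPart_normalPart, dot_comm (bicross f R) (bicross f a),
    dot_comm (bicross f R) (bicross f b), h.dot_tangent a R h.fa, h.dot_tangent b R h.fb,
    h.dot_tangent Q a h.fQ, h.dot_tangent Q b h.fQ, h.dot_tangent Q R h.fQ, dot_comm Q a,
    dot_comm Q b, h.aR, h.bR]
  ring

end IsHarmonicJet

/-- The squared length of a quadratic vector-valued form is constant on a circle if and only if
the form traces a circle or is constant. -/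
theorem circle_constant_iff {e N₀ b₁ b₂ q₁ q₂ q : ℝ} (he : 0 < e) :
    (∀ x y x' y' : ℝ, e * (x ^ 2 + y ^ 2) = 1 → e * (x' ^ 2 + y' ^ 2) = 1 →
      (x ^ 2 + y ^ 2) ^ 2 * N₀ + 2 * (x ^ 2 + y ^ 2) * (x ^ 2 - y ^ 2) * b₁ +
        2 * (x ^ 2 + y ^ 2) * (2 * x * y) * b₂ + (x ^ 2 - y ^ 2) ^ 2 * q₁ +
        (2 * x * y) ^ 2 * q₂ + 2 * (x ^ 2 - y ^ 2) * (2 * x * y) * q =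
      (x' ^ 2 + y' ^ 2) ^ 2 * N₀ + 2 * (x' ^ 2 + y' ^ 2) * (x' ^ 2 - y' ^ 2) * b₁ +
        2 * (x' ^ 2 + y' ^ 2) * (2 * x' * y') * b₂ + (x' ^ 2 - y' ^ 2) ^ 2 * q₁ +
        (2 * x' * y') ^ 2 * q₂ + 2 * (x' ^ 2 - y' ^ 2) * (2 * x' * y') * q) ↔
      b₁ = 0 ∧ b₂ = 0 ∧ q₁ = q₂ ∧ q = 0 := by
  constructor
  · intro H
    -- The test points lie on the circle of radius `t = e^(-1/2)`. The axes give `b₁`, the diagonals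
    -- (`r = 1/√2`) give `b₂`, and comparing an axis with a diagonal gives `q₁ = q₂`.
    set t := Real.sqrt e⁻¹ with ht
    have ht2 : t ^ 2 = e⁻¹ := Real.sq_sqrt (by positivity)
    have he2 : e * t ^ 2 = 1 := by rw [ht2, mul_inv_cancel₀ he.ne']
    set r := Real.sqrt 2⁻¹ with hr
    have hr2 : r ^ 2 = 2⁻¹ := Real.sq_sqrt (by positivity)
    have ht4 : t ^ 4 ≠ 0 := by
      rw [show t ^ 4 = (t ^ 2) ^ 2 by ring, ht2]; positivity
    have e1 := H t 0 0 t (by linear_combination he2) (by linear_combination he2)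
    have e2 := H (t * r) (t * r) (t * r) (-(t * r))
      (by linear_combination he2 + 2 * e * t ^ 2 * hr2)
      (by linear_combination he2 + 2 * e * t ^ 2 * hr2)
    have e3 := H t 0 (t * r) (t * r) (by linear_combination he2)
      (by linear_combination he2 + 2 * e * t ^ 2 * hr2)
    have hb₁ : b₁ = 0 := by
      apply mul_left_cancel₀ ht4
      linear_combination e1 / 4
    have hb₂ : b₂ = 0 := by
      apply mul_left_cancel₀ ht4
      have : t ^ 4 * (r ^ 2 * r ^ 2) * b₂ * 16 = 0 := by linear_combination e2
      rw [hr2] at this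
      linear_combination this / 4
    have hq : q₁ = q₂ := by
      apply mul_left_cancel₀ ht4
      rw [hb₁, hb₂] at e3
      have : t ^ 4 * (q₁ + N₀) - 4 * t ^ 4 * (r ^ 2 * r ^ 2) * (N₀ + q₂) = 0 := by
        linear_combination e3
      rw [hr2] at this
      linear_combination this
    -- At the 3-4-5 point the double angle has cosine 7/25 and sine 24/25, so the surviving term is
    -- `336/625` times `q`.
    have e4 := H t 0 (t * (4 / 5)) (t * (3 / 5)) (by linear_combination he2)
      (by linear_combination he2)
    refine ⟨hb₁, hb₂, hq, ?_⟩
    apply mul_left_cancel₀ ht4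
    rw [hb₁, hb₂, hq] at e4
    linear_combination -(625 / 336 : ℝ) * e4
  · rintro ⟨rfl, rfl, rfl, rfl⟩ x y x' y' h1 h2
    have h3 : x ^ 2 + y ^ 2 = x' ^ 2 + y' ^ 2 := mul_left_cancel₀ he.ne' (h1.trans h2.symm)
    linear_combination (x ^ 2 + y ^ 2 + x' ^ 2 + y' ^ 2) * (N₀ + q₁) * h3

theorem eq_zero_of_re_add_im {x y : ℝ} {z : ℂ} (hz : z = (x : ℂ) + Complex.I * y) (h : z = 0) :
    x = 0 ∧ y = 0 := by
  rw [hz] at h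
  have h1 := congrArg Complex.re h
  have h2 := congrArg Complex.im h
  simp at h1 h2
  exact ⟨h1, h2⟩

theorem bicross_wirtinger_cj (a b : E7) : bicross ((1 / 2 : ℂ) • (toC a - Complex.I • toC b))
    (cj ((1 / 2 : ℂ) • (toC a - Complex.I • toC b))) = (1 / 2 * Complex.I) • toC (bicross a b) := by
  rw [← cross_eq_bicross, toC_cross]
  simp only [cj_smul, map_sub, cj_toC, bicross_smul_left, bicross_smul_right, bicross_sub_left,
    bicross_sub_right, bicross_self, Complex.conj_I, map_div₀, map_one, Complex.conj_ofNat,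
    bicross_anticomm (toC b) (toC a)]
  module

/-! ### Conditions A and B on the real 2-jet -/

section Jet

variable {M : Type*} [TopologicalSpace M] [ChartedSpace ℂ M] [IsManifold 𝓘(ℂ) ω M]
  {φ : M → E7} (hφ : IsSmoothIntoS6 φ) (hharm : IsHarmonicMap φ)
    (hconf : IsConformalImmersion φ)
include hφ hharm hconf

/-- Harmonicity in the form `Δf = -2 |f_x|² f`, used to eliminate `f_xx` throughout. -/
theorem D2_add_D2 (p : M) : D2 φ p 1 1 =
    -(2 * ⟪D φ p 1, D φ p 1⟫_ℝ) • φ p - D2 φ p Complex.I Complex.I := by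
  have h := isHarmonicChart hφ hharm hconf p
  have hx := mem_chart_target ℂ p
  obtain ⟨-, h2, -⟩ := IsConformalMap.inner_eq (hconf p)
  have h1 := h.delBar_del_eq hx
  have h3 : chartMap φ p (chartAt ℂ p p) = toC (φ p) := by simp [chartMap, loc]
  rw [delBar_del_chartMap_self hφ.smooth, energy, del_chartMap_self hφ.smooth, dot_wirtinger_cj,
    ← h2, h3] at h1
  apply toC_injective
  have h4 : toC (D2 φ p 1 1 + D2 φ p Complex.I Complex.I) =
      toC (-(2 * ⟪D φ p 1, D φ p 1⟫_ℝ) • φ p) := by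
    apply smul_right_injective C7 (show (1 / 4 : ℂ) ≠ 0 by norm_num)
    change (1 / 4 : ℂ) • _ = (1 / 4 : ℂ) • _
    rw [h1, map_smul, ← Complex.coe_smul, smul_smul]
    congr 1
    push_cast
    ring
  rw [map_sub, ← h4, map_add, add_sub_cancel_right]

/-- The relations are the real and imaginary parts of `(f, f_z) = 0`, `(f, f_zz) = 0` and `(f_z,
f_zz) = 0`, together with conformality and `|f| = 1`. -/
theorem isHarmonicJet (p : M) : IsHarmonicJet ⟪D φ p 1, D φ p 1⟫_ℝ (φ p) (D φ p 1)
    (D φ p Complex.I) (D2 φ p 1 Complex.I) (D2 φ p Complex.I Complex.I) := by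
  have h := isHarmonicChart hφ hharm hconf p
  have hx := mem_chart_target ℂ p
  obtain ⟨h1, h2, h3⟩ := IsConformalMap.inner_eq (hconf p)
  have hφp : ⟪φ p, φ p⟫_ℝ = 1 := by
    rw [real_inner_self_eq_norm_sq, mem_sphere_zero_iff_norm.1 (hφ.mem_sphere _), one_pow]
  have h4 : chartMap φ p (chartAt ℂ p p) = toC (φ p) := by simp [chartMap, loc]
  have e1 := h.dot_del hx
  have e2 := h.dot_del_del hx
  have e3 := h.del_dot_del_del hx
  have hP := D2_add_D2 hφ hharm hconf p
  rw [del_del_chartMap_self hφ.smooth, hP] at e2 e3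
  rw [del_chartMap_self hφ.smooth] at e1 e3
  rw [h4] at e1 e2
  set e := ⟪D φ p 1, D φ p 1⟫_ℝ with he
  set a := D φ p 1
  set b := D φ p Complex.I
  set f := φ p
  set Q := D2 φ p 1 Complex.I
  set R := D2 φ p Complex.I Complex.I
  simp only [dot_smul_left, dot_smul_right, dot_sub_left, dot_sub_right, dot_toC, map_sub, map_smul,
    ← Complex.coe_smul] at e1 e2 e3
  obtain ⟨f1, f2⟩ := eq_zero_of_re_add_im (x := 1 / 2 * ⟪f, a⟫_ℝ)
    (y := -1 / 2 * ⟪f, b⟫_ℝ) (by push_cast; ring) e1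
  have hfa : ⟪f, a⟫_ℝ = 0 := by linarith
  have hfb : ⟪f, b⟫_ℝ = 0 := by linarith
  rw [hφp] at e2
  obtain ⟨f3, f4⟩ := eq_zero_of_re_add_im (x := 1 / 4 * (-2 * e - 2 * ⟪f, R⟫_ℝ))
    (y := -1 / 2 * ⟪f, Q⟫_ℝ) (by push_cast; ring) e2
  rw [real_inner_comm f a, real_inner_comm f b, hfa, hfb] at e3
  obtain ⟨f5, f6⟩ := eq_zero_of_re_add_im
    (x := 1 / 8 * (-2 * ⟪a, R⟫_ℝ - 2 * ⟪b, Q⟫_ℝ)) (y := 1 / 8 * (-2 * ⟪a, Q⟫_ℝ + 2 * ⟪b, R⟫_ℝ))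
    (by push_cast; linear_combination (1 / 4 * ⟪b, Q⟫_ℝ : ℂ) * Complex.I_mul_I) e3
  simp only [inner_eq_dot_real] at *
  exact ⟨h3, hφp, hfa, hfb, h1, he.symm, h2.symm.trans he.symm, by linarith, by linarith,
    by linarith, by linarith⟩

theorem condA_iff_jet (p : M) : CondA φ p ↔
    dot (D2 φ p 1 Complex.I) (D2 φ p 1 Complex.I) =
      dot (D2 φ p Complex.I Complex.I) (D2 φ p Complex.I Complex.I) - ⟪D φ p 1, D φ p 1⟫_ℝ ^ 2 ∧
    dot (D2 φ p 1 Complex.I) (D2 φ p Complex.I Complex.I) = 0 := by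
  have hJ := isHarmonicJet hφ hharm hconf p
  have hP := D2_add_D2 hφ hharm hconf p
  rw [CondA, del_del_chartMap_self hφ.smooth, hP]
  set e := ⟪D φ p 1, D φ p 1⟫_ℝ with he
  set f := φ p
  set Q := D2 φ p 1 Complex.I
  set R := D2 φ p Complex.I Complex.I
  have h1 := hJ.ff
  have h2 := hJ.fQ
  have h3 := hJ.fR
  have h2' := dot_comm f Q
  have h3' := dot_comm f R
  have h4 := dot_comm R Q
  rw [h2] at h2'
  rw [h3] at h3'
  simp only [dot_smul_left, dot_smul_right, dot_sub_left, dot_sub_right, dot_toC, map_sub, map_smul,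
    ← Complex.coe_smul, inner_eq_dot_real, h1, h2, h3, ← h2', ← h3', h4]
  constructor
  · intro h
    obtain ⟨f1, f2⟩ := eq_zero_of_re_add_im
      (x := 1 / 4 * (dot R R - e ^ 2 - dot Q Q)) (y := 1 / 2 * dot Q R)
      (by push_cast; linear_combination (1 / 4 * dot Q Q : ℂ) * Complex.I_mul_I) h
    exact ⟨by linarith, by linarith⟩
  · rintro ⟨f1, f2⟩
    rw [f1, f2]
    push_cast
    linear_combination (1 / 4 * (dot R R - e ^ 2) : ℂ) * Complex.I_mul_I

theorem condB_iff_jet (p : M) : CondB φ p ↔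
    dot (bicross (φ p) (D2 φ p 1 Complex.I)) (bicross (D φ p 1) (D φ p Complex.I)) = 0 ∧
    dot (bicross (φ p) (D2 φ p Complex.I Complex.I)) (bicross (D φ p 1) (D φ p Complex.I)) = 0 := by
  have hP := D2_add_D2 hφ hharm hconf p
  rw [CondB, del_del_chartMap_self hφ.smooth, del_chartMap_self hφ.smooth, hP]
  set e := ⟪D φ p 1, D φ p 1⟫_ℝ with he
  set f := φ p
  set a := D φ p 1
  set b := D φ p Complex.I
  set Q := D2 φ p 1 Complex.I
  set R := D2 φ p Complex.I Complex.I
  have h2 : bicross (toC f) ((1 / 4 : ℂ) • (toC (-(2 * e) • f - R - R) -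
      (2 * Complex.I) • toC Q)) =
      (-1 / 2 : ℂ) • (toC (bicross f R) + Complex.I • toC (bicross f Q)) := by
    simp only [← cross_eq_bicross, toC_cross, map_sub, map_smul, ← Complex.coe_smul,
      bicross_smul_right, bicross_sub_right, bicross_self]
    module
  rw [bicross_wirtinger_cj, h2]
  simp only [dot_smul_left, dot_smul_right, dot_add_left, dot_toC, inner_eq_dot_real]
  constructor
  · intro h
    obtain ⟨f1, f2⟩ := eq_zero_of_re_add_im
      (x := 1 / 4 * dot (bicross f Q) (bicross a b))
      (y := -1 / 4 * dot (bicross f R) (bicross a b))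
      (by push_cast; linear_combination (-1 / 4 * dot (bicross f Q) (bicross a b) : ℂ) *
        Complex.I_mul_I) h
    exact ⟨by linarith, by linarith⟩
  · rintro ⟨f1, f2⟩
    rw [f1, f2]
    simp

end Jet

/-! ### Fundamental forms of `F` in terms of the jet of `φ` -/

section FundamentalForms

variable {M : Type*} [TopologicalSpace M] [ChartedSpace ℂ M] [IsManifold 𝓘(ℂ) ω M]

/-- A first-order equation `D F u = φ × D φ (i u)` in the chart at `p`. -/
theorem IsAssociatedSurface.fderiv_loc {φ F : M → E7} (hF : IsAssociatedSurface φ F)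
    (hφ : ContMDiff 𝓘(ℝ, ℂ) 𝓘(ℝ, E7) ∞ φ) (p : M) {x : ℂ} (hx : x ∈ (chartAt ℂ p).target) (u : ℂ) :
    fderiv ℝ (loc F p) x u = bicross (loc φ p x) (fderiv ℝ (loc φ p) x (Complex.I * u)) := by
  obtain ⟨q, hq, rfl⟩ : ∃ q ∈ (chartAt ℂ p).source, chartAt ℂ p q = x :=
    ⟨(chartAt ℂ p).symm x, (chartAt ℂ p).map_target hx, (chartAt ℂ p).right_inv hx⟩
  have h4 := deriv_transition_ne_zero hq
  have hτ := ((analyticAt_transition hq).differentiableAt.hasDerivAt.hasFDerivAt).restrictScalars ℝ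
  have key : ∀ {s : M → E7}, ContMDiff 𝓘(ℝ, ℂ) 𝓘(ℝ, E7) ∞ s → ∀ v : ℂ,
      D s q v = fderiv ℝ (loc s p) (chartAt ℂ p q)
        (v * deriv (transition q p) (chartAt ℂ q q)) := by
    intro s hs v
    have hd : DifferentiableAt ℝ (loc s p) (transition q p (chartAt ℂ q q)) := by
      rw [transition_apply_self]
      exact (contDiffAt_two (chartAt ℂ p).open_target (contDiffOn_loc hs p)
        hx).differentiableAt (by simp)
    have e : loc s q =ᶠ[𝓝 (chartAt ℂ q q)] loc s p ∘ transition q p := loc_eventuallyEq s hq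
    rw [D_eq_fderiv_of_smooth hs, e.fderiv_eq, (hd.hasFDerivAt.comp _ hτ).fderiv,
      transition_apply_self]
    simp
  have h := hF.deriv_eq q (u / deriv (transition q p) (chartAt ℂ q q))
  rw [key hF.smooth, key hφ, div_mul_cancel₀ _ h4, mul_assoc, div_mul_cancel₀ _ h4] at h
  rw [h, cross_eq_bicross]
  simp [loc, hq]

theorem IsAssociatedSurface.D2_eq {φ F : M → E7} (hF : IsAssociatedSurface φ F)
    (hφ : ContMDiff 𝓘(ℝ, ℂ) 𝓘(ℝ, E7) ∞ φ) (p : M) (u v : ℂ) :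
    D2 F p u v = bicross (D φ p u) (D φ p (Complex.I * v)) +
      bicross (φ p) (D2 φ p u (Complex.I * v)) := by
  have hx := mem_chart_target ℂ p
  have hd : ∀ {s : M → E7}, ContMDiff 𝓘(ℝ, ℂ) 𝓘(ℝ, E7) ∞ s →
      DifferentiableAt ℝ (fderiv ℝ (loc s p)) (chartAt ℂ p p) := fun hs =>
    ((contDiffAt_loc hs p).fderiv_right (m := 1) (by norm_num)).differentiableAt (by simp)
  have happ : ∀ {s : M → E7}, ContMDiff 𝓘(ℝ, ℂ) 𝓘(ℝ, E7) ∞ s → ∀ w : ℂ,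
      HasFDerivAt (fun x => fderiv ℝ (loc s p) x w)
        ((fderiv ℝ (fderiv ℝ (loc s p)) (chartAt ℂ p p)).flip w) (chartAt ℂ p p) := fun hs w => by
    simpa using (hd hs).hasFDerivAt.clm_apply (hasFDerivAt_const w _)
  have e : (fun x => fderiv ℝ (loc F p) x v) =ᶠ[𝓝 (chartAt ℂ p p)] fun x =>
      bicrossL (loc φ p x) (fderiv ℝ (loc φ p) x (Complex.I * v)) := by
    filter_upwards [(chartAt ℂ p).open_target.mem_nhds hx] with x hx
    exact hF.fderiv_loc hφ p hx v
  have h1 := ((bicrossL (𝕜 := ℝ)).hasFDerivAt_of_bilinear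
    ((contDiffAt_loc hφ p).differentiableAt (by simp)).hasFDerivAt (happ hφ (Complex.I * v)))
  have h2 := congrArg (fun L => L u) ((happ hF.smooth v).unique (h1.congr_of_eventuallyEq e))
  have h3 : loc φ p (chartAt ℂ p p) = φ p := by simp [loc]
  rw [D_eq_fderiv_of_smooth hφ]
  simpa [D2, h3, add_comm] using h2

variable {φ F : M → E7} (hφ : IsSmoothIntoS6 φ) (hharm : IsHarmonicMap φ)
    (hconf : IsConformalImmersion φ) (hF : IsAssociatedSurface φ F)

omit [IsManifold 𝓘(ℂ) ω M] in
theorem D_apply_eq (s : M → E7) (p : M) (u : ℂ) :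
    D s p u = u.re • D s p 1 + u.im • D s p Complex.I := by
  conv_lhs => rw [← Complex.re_add_im u, ← mul_one (u.re : ℂ)]
  rw [map_add, ← Complex.real_smul, ← Complex.real_smul, map_smul, map_smul]

include hφ in
theorem D2_apply_eq (p : M) (u v : ℂ) :
    D2 φ p u v = (u.re * v.re) • D2 φ p 1 1 +
      (u.re * v.im + u.im * v.re) • D2 φ p 1 Complex.I +
      (u.im * v.im) • D2 φ p Complex.I Complex.I := by
  have hsymm : D2 φ p Complex.I 1 = D2 φ p 1 Complex.I :=
    (contDiffAt_loc hφ.smooth p).isSymmSndFDerivAt (by simp) _ _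
  have hu : u = u.re • (1 : ℂ) + u.im • Complex.I := by simp
  have hv : v = v.re • (1 : ℂ) + v.im • Complex.I := by simp
  have h : D2 φ p u v = D2 φ p (u.re • (1 : ℂ) + u.im • Complex.I)
    (v.re • (1 : ℂ) + v.im • Complex.I) := by rw [← hu, ← hv]
  rw [h]
  simp only [D2, map_add, map_smul, add_apply,
    smul_apply] at hsymm ⊢
  rw [hsymm]
  module

include hF in
omit [IsManifold 𝓘(ℂ) ω M] in
theorem IsAssociatedSurface.D_apply (p : M) (u : ℂ) : D F p u =
    u.re • bicross (φ p) (D φ p Complex.I) - u.im • bicross (φ p) (D φ p 1) := by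
  rw [hF.deriv_eq, D_apply_eq, cross_eq_bicross, bicross_add_right, bicross_smul_right,
    bicross_smul_right]
  simp
  module

include hφ hharm hconf hF

theorem firstFF_eq (p : M) (u v : ℂ) :
    firstFF F p u v = ⟪D φ p 1, D φ p 1⟫_ℝ * (u.re * v.re + u.im * v.im) := by
  have hJ := isHarmonicJet hφ hharm hconf p
  rw [firstFF, inner_eq_dot_real (D F p u), hF.D_apply, hF.D_apply]
  simp only [dot_sub_left, dot_sub_right, dot_smul_left, dot_smul_right, hJ.dot_tangent _ _ hJ.fa,
    hJ.dot_tangent _ _ hJ.fb, hJ.aa, hJ.bb, hJ.ab, dot_comm (D φ p Complex.I) (D φ p 1)]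
  ring

theorem starProjection_range (p : M) (w : E7) :
    (LinearMap.range (D F p).toLinearMap)ᗮ.starProjection w =
      normalPart ⟪D φ p 1, D φ p 1⟫_ℝ (φ p) (D φ p 1) (D φ p Complex.I) w := by
  have hJ := isHarmonicJet hφ hharm hconf p
  set e := ⟪D φ p 1, D φ p 1⟫_ℝ
  rw [Submodule.starProjection_orthogonal_val, normalPart, sub_sub]
  congr 1
  refine Submodule.eq_starProjection_of_mem_of_inner_eq_zero ?_ ?_
  · refine ⟨⟨dot w (bicross (φ p) (D φ p Complex.I)) / e,
      -(dot w (bicross (φ p) (D φ p 1)) / e)⟩, ?_⟩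
    change D F p _ = _
    rw [hF.D_apply]
    module
  · rintro _ ⟨u, rfl⟩
    change ⟪_, D F p u⟫_ℝ = 0
    have h1 := hJ.dot_normalPart_left w
    have h2 := hJ.dot_normalPart_right w
    rw [normalPart, sub_sub] at h1 h2
    rw [hF.D_apply, inner_eq_dot_real, dot_sub_right, dot_smul_right, dot_smul_right, h1, h2]
    ring

/-- In the derivative of `dF = φ × *dφ`, the products of first derivatives give the trace part `f_x
× f_y`. The terms `f × f_xy` and `f × f_yy` give the traceless part, because `f × f_xx = -f × f_yy`.
-/
theorem secondFF_eq (p : M) (u v : ℂ) : secondFF F p u v =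
    (u.re * v.re + u.im * v.im) • bicross (D φ p 1) (D φ p Complex.I) +
    (u.re * v.re - u.im * v.im) • normalPart ⟪D φ p 1, D φ p 1⟫_ℝ (φ p) (D φ p 1)
      (D φ p Complex.I) (bicross (φ p) (D2 φ p 1 Complex.I)) +
    (u.re * v.im + u.im * v.re) • normalPart ⟪D φ p 1, D φ p 1⟫_ℝ (φ p) (D φ p 1)
      (D φ p Complex.I) (bicross (φ p) (D2 φ p Complex.I Complex.I)) := by
  have hJ := isHarmonicJet hφ hharm hconf p
  have hP := D2_add_D2 hφ hharm hconf p
  rw [secondFF, starProjection_range hφ hharm hconf hF, hF.D2_eq hφ.smooth]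
  set e := ⟪D φ p 1, D φ p 1⟫_ℝ
  have h1 : bicross (D φ p u) (D φ p (Complex.I * v)) +
      bicross (φ p) (D2 φ p u (Complex.I * v)) =
      (u.re * v.re + u.im * v.im) • bicross (D φ p 1) (D φ p Complex.I) +
      (u.re * v.re - u.im * v.im) • bicross (φ p) (D2 φ p 1 Complex.I) +
      (u.re * v.im + u.im * v.re) • bicross (φ p) (D2 φ p Complex.I Complex.I) := by
    rw [D2_apply_eq hφ, hP, D_apply_eq φ p u, D_apply_eq φ p (Complex.I * v)]
    simp only [bicross_add_left, bicross_add_right, bicross_smul_left, bicross_smul_right,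
      bicross_self, bicross_sub_right, bicross_anticomm (D φ p Complex.I) (D φ p 1),
      Complex.I_mul_re, Complex.I_mul_im]
    module
  rw [h1]
  simp only [normalPart_add, normalPart_smul, hJ.normalPart_cross]

theorem meanCurvature_eq (p : M) : meanCurvature F p =
    (⟪D φ p 1, D φ p 1⟫_ℝ)⁻¹ • bicross (D φ p 1) (D φ p Complex.I) := by
  have he := (isHarmonicJet hφ hharm hconf p).pos.ne'
  have h1 : (Matrix.of fun k l => firstFF F p (frame k) (frame l))⁻¹ =
      (⟪D φ p 1, D φ p 1⟫_ℝ)⁻¹ • (1 : Matrix (Fin 2) (Fin 2) ℝ) := by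
    refine Matrix.inv_eq_right_inv ?_
    ext i j
    rw [Matrix.mul_smul, Matrix.mul_one, Matrix.smul_apply, Matrix.of_apply,
      firstFF_eq hφ hharm hconf hF]
    generalize ⟪D φ p 1, D φ p 1⟫_ℝ = e at he ⊢
    fin_cases i <;> fin_cases j <;> simp [frame, he]
  rw [meanCurvature, h1]
  simp only [secondFF_eq hφ hharm hconf hF, Fin.sum_univ_two, Matrix.smul_apply]
  simp [frame]
  module

/-- The mean curvature vector is the unit vector along `f_x × f_y`, so the trace part already
contributes `λ = 1`; condition B says that the traceless part is orthogonal to it. -/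
theorem isPseudoUmbilical_iff : IsPseudoUmbilical F ↔ ∀ p, CondB φ p := by
  have hII : ∀ p u v, ⟪secondFF F p u v, meanCurvature F p⟫_ℝ =
      (⟪D φ p 1, D φ p 1⟫_ℝ)⁻¹ * ((u.re * v.re + u.im * v.im) * ⟪D φ p 1, D φ p 1⟫_ℝ ^ 2 +
      (u.re * v.re - u.im * v.im) *
        dot (bicross (φ p) (D2 φ p 1 Complex.I)) (bicross (D φ p 1) (D φ p Complex.I)) +
      (u.re * v.im + u.im * v.re) * dot (bicross (φ p) (D2 φ p Complex.I Complex.I))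
        (bicross (D φ p 1) (D φ p Complex.I))) := by
    intro p u v
    have hJ := isHarmonicJet hφ hharm hconf p
    rw [inner_eq_dot_real, secondFF_eq hφ hharm hconf hF, meanCurvature_eq hφ hharm hconf hF]
    simp only [dot_add_left, dot_smul_left, dot_smul_right, hJ.dot_cross_cross,
      hJ.dot_normalPart_cross]
  constructor
  · rintro ⟨l, -, hl⟩ p
    have he := (isHarmonicJet hφ hharm hconf p).pos.ne'
    have h1 := hl p 1 1
    have h2 := hl p Complex.I Complex.I
    have h3 := hl p 1 Complex.I
    rw [hII, firstFF_eq hφ hharm hconf hF] at h1 h2 h3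
    generalize ⟪D φ p 1, D φ p 1⟫_ℝ = e at he h1 h2 h3
    simp [he] at h1 h2 h3
    rw [condB_iff_jet hφ hharm hconf]
    field_simp at h1 h2
    exact ⟨by linarith, h3⟩
  · intro h
    refine ⟨fun _ => 1, contMDiff_const, fun p u v => ?_⟩
    have he := (isHarmonicJet hφ hharm hconf p).pos.ne'
    obtain ⟨h1, h2⟩ := (condB_iff_jet hφ hharm hconf p).1 (h p)
    rw [hII, firstFF_eq hφ hharm hconf hF, h1, h2]
    field_simp
    ring

/-- With `u` at angle `θ`, `II(u,u)` is a constant multiple of `C + cos 2θ B₁ + sin 2θ B₂`. Its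
length is constant exactly when `C` is orthogonal to `B₁` and `B₂` (condition B) and these two are
orthogonal of equal length (condition A). -/
theorem isIsotropicImmersion_iff :
    IsIsotropicImmersion F ↔ ∀ p, CondA φ p ∧ CondB φ p := by
  refine forall_congr' fun p => ?_
  have hJ := isHarmonicJet hφ hharm hconf p
  rw [condA_iff_jet hφ hharm hconf, condB_iff_jet hφ hharm hconf]
  have hn : ∀ x y : ℝ, ‖secondFF F p ⟨x, y⟩ ⟨x, y⟩‖ ^ 2 = _ := fun x y => by
    rw [← real_inner_self_eq_norm_sq, inner_eq_dot_real, secondFF_eq hφ hharm hconf hF]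
  have h1 := hJ.normSq_Q
  have h2 := hJ.normSq_R
  have h3 := hJ.dot_Q_R
  have h4 := hJ.dot_normalPart_cross (bicross (φ p) (D2 φ p 1 Complex.I))
  have h5 := hJ.dot_normalPart_cross (bicross (φ p) (D2 φ p Complex.I Complex.I))
  have h6 := hJ.dot_cross_cross
  have he := hJ.pos
  have hI : ∀ x y : ℝ, firstFF F p ⟨x, y⟩ ⟨x, y⟩ = _ := fun x y => firstFF_eq hφ hharm hconf hF p _ _
  set e := ⟪D φ p 1, D φ p 1⟫_ℝ
  set Q := D2 φ p 1 Complex.I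
  set R := D2 φ p Complex.I Complex.I
  set C := bicross (D φ p 1) (D φ p Complex.I)
  set B₁ := normalPart e (φ p) (D φ p 1) (D φ p Complex.I) (bicross (φ p) Q)
  set B₂ := normalPart e (φ p) (D φ p 1) (D φ p Complex.I) (bicross (φ p) R)
  simp only [dot_add_left, dot_add_right, dot_smul_left, dot_smul_right, dot_comm C, dot_comm B₂ B₁,
    h3, h4, h5, h6] at hn
  have hcirc := circle_constant_iff (N₀ := e ^ 2) (b₁ := dot (bicross (φ p) Q) C)
    (b₂ := dot (bicross (φ p) R) C) (q₁ := dot B₁ B₁) (q₂ := dot B₂ B₂) (q := dot Q R) he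
  have hA : dot Q Q = dot R R - e ^ 2 ↔ dot B₁ B₁ = dot B₂ B₂ := by
    rw [h1, h2]
    exact (sub_left_inj).symm
  rw [hA]
  trans (dot (bicross (φ p) Q) C = 0 ∧ dot (bicross (φ p) R) C = 0 ∧ dot B₁ B₁ = dot B₂ B₂ ∧
    dot Q R = 0)
  · rw [← hcirc]
    constructor
    · intro H x y x' y' hx hy
      have := congrArg (· ^ 2) (H ⟨x, y⟩ ⟨x', y'⟩ (by rw [hI]; simp; linarith)
        (by rw [hI]; simp; linarith))
      simp only [hn] at this
      linear_combination this
    · rintro H ⟨x, y⟩ ⟨x', y'⟩ hx hy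
      rw [hI] at hx hy
      simp only at hx hy
      refine (sq_eq_sq₀ (norm_nonneg _) (norm_nonneg _)).1 ?_
      rw [hn, hn]
      linear_combination H x y x' y' (by linarith) (by linarith)
  · tauto

end FundamentalForms

/-! ### Constancy of the angle between the surface and its normal direction -/

section Constancy

variable {M : Type*} [TopologicalSpace M] [ChartedSpace ℂ M]

/-- The unit vector `f_x × f_y / |f_x|²`. -/
def unitNormal (φ : M → E7) (p : M) : E7 :=
  (⟪D φ p 1, D φ p 1⟫_ℝ)⁻¹ • bicross (D φ p 1) (D φ p Complex.I)

theorem eq_of_fderiv_eq_zero [PreconnectedSpace M] {W : Type*} [NormedAddCommGroup W]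
    [NormedSpace ℝ W] {g : M → W}
    (h : ∀ p : M, ∃ k : ℂ → W, DifferentiableOn ℝ k (chartAt ℂ p).target ∧
      (∀ x ∈ (chartAt ℂ p).target, fderiv ℝ k x = 0) ∧
      ∀ x ∈ (chartAt ℂ p).target, g ((chartAt ℂ p).symm x) = k x) (p q : M) : g p = g q := by
  refine IsLocallyConstant.apply_eq_of_preconnectedSpace
    ((IsLocallyConstant.iff_eventually_eq g).2 fun p => ?_) p q
  obtain ⟨k, hk, hk0, hgk⟩ := h p
  have hps := mem_chart_source ℂ p
  obtain ⟨r, hr, hball⟩ := Metric.isOpen_iff.1 (chartAt ℂ p).open_target _ (mem_chart_target ℂ p)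
  filter_upwards [(chartAt ℂ p).open_source.mem_nhds hps,
    ((chartAt ℂ p).continuousAt hps).eventually (Metric.ball_mem_nhds _ hr)] with x hx hxr
  have h1 := Metric.isOpen_ball.is_const_of_fderiv_eq_zero (𝕜 := ℝ)
    (convex_ball (chartAt ℂ p p) r).isPreconnected
    (hk.mono hball) (fun y hy => hk0 y (hball hy)) hxr (Metric.mem_ball_self hr)
  rw [← hgk _ (hball hxr), ← hgk _ (mem_chart_target ℂ p), (chartAt ℂ p).left_inv hx,
    (chartAt ℂ p).left_inv hps] at h1
  exact h1

variable [IsManifold 𝓘(ℂ) ω M]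

/-- The energy and the cross product both scale by the squared modulus of the transition derivative,
so `n` is globally defined. -/
theorem normalDir_chartMap {φ : M → E7} (hφ : ContMDiff 𝓘(ℝ, ℂ) 𝓘(ℝ, E7) ∞ φ) {p q : M}
    (hq : q ∈ (chartAt ℂ p).source) : normalDir (chartMap φ q) (chartAt ℂ q q) =
      normalDir (chartMap φ p) (chartAt ℂ p q) := by
  have h4 := deriv_transition_ne_zero hq
  rw [normalDir, normalDir, energy, energy, del_chartMap hφ hq]
  set c := deriv (transition q p) (chartAt ℂ q q)
  have h5 : (starRingEnd ℂ) c ≠ 0 := by simpa using h4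
  simp only [cj_smul, dot_smul_left, dot_smul_right, bicross_smul_left, bicross_smul_right,
    smul_smul]
  congr 1
  field_simp

variable {φ : M → E7} (hφ : IsSmoothIntoS6 φ) (hharm : IsHarmonicMap φ)
    (hconf : IsConformalImmersion φ)

include hφ hconf in
theorem normalDir_chartMap_self (p : M) :
    normalDir (chartMap φ p) (chartAt ℂ p p) = toC (unitNormal φ p) := by
  obtain ⟨-, h2, h3⟩ := IsConformalMap.inner_eq (hconf p)
  rw [normalDir, energy, del_chartMap_self hφ.smooth, dot_wirtinger_cj, bicross_wirtinger_cj,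
    unitNormal, ← h2, map_smul, ← Complex.coe_smul, smul_smul]
  congr 1
  have h4 : (⟪D φ p 1, D φ p 1⟫_ℝ : ℂ) ≠ 0 := by exact_mod_cast h3.ne'
  generalize (⟪D φ p 1, D φ p 1⟫_ℝ) = e at h4
  push_cast
  field_simp
  linear_combination -4 * Complex.I_sq

include hφ hconf in
theorem normalDir_of_mem_target {p : M} {x : ℂ} (hx : x ∈ (chartAt ℂ p).target) :
    toC (unitNormal φ ((chartAt ℂ p).symm x)) = normalDir (chartMap φ p) x := by
  rw [← normalDir_chartMap_self hφ hconf, normalDir_chartMap hφ.smooth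
    ((chartAt ℂ p).map_target hx), (chartAt ℂ p).right_inv hx]

include hφ hharm hconf

theorem bicross_cj_second_chart (hA : ∀ p, CondA φ p) (hB : ∀ p, CondB φ p) (p : M) {x : ℂ}
    (hx : x ∈ (chartAt ℂ p).target) :
    bicross (del (chartMap φ p) x) (cj (second (chartMap φ p) x)) = 0 :=
  (isHarmonicChart hφ hharm hconf p).bicross_cj_second_eq_zero
    (fun _ hy => (condA_iff hφ hharm hconf hy).1 (hA _))
    (fun _ hy => (condB_iff hφ hharm hconf hy).1 (hB _)) x hx

theorem dot_unitNormal_eq [PreconnectedSpace M] (hA : ∀ p, CondA φ p) (hB : ∀ p, CondB φ p)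
    (p q : M) : dot (φ p) (unitNormal φ p) = dot (φ q) (unitNormal φ q) := by
  have := eq_of_fderiv_eq_zero (g := fun p => dot (toC (φ p)) (toC (unitNormal φ p)))
    (fun p => by
      have h := isHarmonicChart hφ hharm hconf p
      refine ⟨fun y => dot (chartMap φ p y) (normalDir (chartMap φ p) y), ?_, ?_, ?_⟩
      · exact (contDiffOn_dot h.smooth h.smooth_normalDir).differentiableOn (by simp)
      · exact fun x hx => h.fderiv_dot_normalDir hx
          (bicross_cj_second_chart hφ hharm hconf hA hB p hx)
      · intro x hx
        simp only [normalDir_of_mem_target hφ hconf hx]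
        rfl) p q
  simp only [dot_toC, Complex.ofReal_inj, inner_eq_dot_real] at this
  exact this

theorem bicross_unitNormal_eq [PreconnectedSpace M] (hA : ∀ p, CondA φ p) (hB : ∀ p, CondB φ p)
    (p q : M) : bicross (φ p) (unitNormal φ p) = bicross (φ q) (unitNormal φ q) := by
  have := eq_of_fderiv_eq_zero (g := fun p => bicross (toC (φ p)) (toC (unitNormal φ p)))
    (fun p => by
      have h := isHarmonicChart hφ hharm hconf p
      refine ⟨fun y => bicross (chartMap φ p y) (normalDir (chartMap φ p) y), ?_, ?_, ?_⟩
      · exact (contDiffOn_bicross h.smooth h.smooth_normalDir).differentiableOn (by simp)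
      · exact fun x hx => h.fderiv_bicross_normalDir hx
          (bicross_cj_second_chart hφ hharm hconf hA hB p hx)
      · intro x hx
        simp only [normalDir_of_mem_target hφ hconf hx]
        rfl) p q
  simp only [← toC_cross] at this
  exact toC_injective this

omit hharm hφ in
omit [IsManifold 𝓘(ℂ) ω M] in
-- On the tangent plane `n × ·` is always the complex structure of the surface; almost complexity of
-- `φ` is thus the question whether `n = ±φ`.
theorem unitNormal_bicross (p : M) (u : ℂ) :
    bicross (unitNormal φ p) (D φ p u) = D φ p (Complex.I * u) := by
  obtain ⟨h1, h2, h3⟩ := IsConformalMap.inner_eq (hconf p)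
  have e1 : bicross (unitNormal φ p) (D φ p 1) = D φ p Complex.I := by
    rw [unitNormal, bicross_anticomm, bicross_smul_right, bicross_bicross_self,
      ← inner_eq_dot_real, ← inner_eq_dot_real, h1, zero_smul, zero_sub, smul_neg, neg_neg,
      smul_smul, inv_mul_cancel₀ h3.ne', one_smul]
  have e2 : bicross (unitNormal φ p) (D φ p Complex.I) = -D φ p 1 := by
    rw [unitNormal, bicross_anticomm, bicross_smul_right, bicross_anticomm (D φ p 1),
      bicross_neg_right, bicross_bicross_self, ← inner_eq_dot_real, ← inner_eq_dot_real,
      real_inner_comm (D φ p 1) (D φ p Complex.I), h1, ← h2, zero_smul, zero_sub, neg_neg, smul_smul,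
      inv_mul_cancel₀ h3.ne', one_smul]
  rw [D_apply_eq φ p u, D_apply_eq φ p (Complex.I * u), bicross_add_right, bicross_smul_right,
    bicross_smul_right, e1, e2]
  simp
  module

omit hharm hφ in
omit [IsManifold 𝓘(ℂ) ω M] in
theorem dot_unitNormal_self (p : M) : dot (unitNormal φ p) (unitNormal φ p) = 1 := by
  obtain ⟨h1, h2, h3⟩ := IsConformalMap.inner_eq (hconf p)
  rw [unitNormal, dot_smul_left, dot_smul_right, dot_bicross_bicross, ← inner_eq_dot_real,
    ← inner_eq_dot_real, ← inner_eq_dot_real, h1, ← h2]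
  field_simp
  ring

omit hharm hφ hconf in
omit [IsManifold 𝓘(ℂ) ω M] in
theorem dot_unitNormal_D (p : M) (u : ℂ) : dot (unitNormal φ p) (D φ p u) = 0 := by
  rw [D_apply_eq φ p u, unitNormal, dot_smul_left, dot_add_right, dot_smul_right, dot_smul_right,
    dot_comm _ (D φ p 1), dot_comm _ (D φ p Complex.I), dot_bicross_left, dot_bicross_right]
  ring

theorem dot_D (p : M) (u : ℂ) : dot (φ p) (D φ p u) = 0 := by
  have hJ := isHarmonicJet hφ hharm hconf p
  rw [D_apply_eq φ p u, dot_add_right, dot_smul_right, dot_smul_right, hJ.fa, hJ.fb]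
  ring

omit hharm hφ in
omit [IsManifold 𝓘(ℂ) ω M] in
theorem exists_ne [Nonempty M] : ∃ p q : M, φ p ≠ φ q := by
  by_contra! hc
  obtain ⟨p⟩ := ‹Nonempty M›
  obtain ⟨-, -, h3⟩ := IsConformalMap.inner_eq (hconf p)
  have h : φ = fun _ => φ p := funext fun q => hc q p
  have h0 : D φ p = 0 := by rw [h]; exact mfderiv_const
  rw [h0] at h3
  simp at h3

/-- If `φ` is parallel to its normal direction, then it is an almost complex curve. -/
theorem isAlmostComplexCurve_of_bicross_eq_zero [PreconnectedSpace M] [Nonempty M]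
    (hA : ∀ p, CondA φ p) (hB : ∀ p, CondB φ p)
    (h0 : ∀ p, bicross (φ p) (unitNormal φ p) = 0) :
    ∃ ε : ℤˣ, IsAlmostComplexCurve ε φ := by
  obtain ⟨p₀⟩ := ‹Nonempty M›
  set k := dot (φ p₀) (unitNormal φ p₀) with hk
  have hn : ∀ p, unitNormal φ p = k • φ p := by
    intro p
    have h1 := bicross_bicross_self (φ p) (unitNormal φ p)
    rw [h0, bicross_zero_right, (isHarmonicJet hφ hharm hconf p).ff, one_smul,
      dot_unitNormal_eq hφ hharm hconf hA hB p p₀] at h1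
    exact (sub_eq_zero.1 h1.symm).symm
  have hk2 : k * k = 1 := by
    have h1 := dot_unitNormal_self hconf p₀
    rwa [hn, dot_smul_left, dot_smul_right, (isHarmonicJet hφ hharm hconf p₀).ff, mul_one] at h1
  have key : ∀ p u, D φ p (Complex.I * u) = k • bicross (φ p) (D φ p u) := by
    intro p u
    rw [← unitNormal_bicross hconf, hn, bicross_smul_left]
  have hne := exists_ne (φ := φ) hconf
  -- The sign relating `n` to `φ` decides for which orientation the curve is almost complex.
  rcases mul_self_eq_one_iff.1 hk2 with h1 | h1
  · refine ⟨1, hφ, hne, fun p u => ?_⟩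
    rw [cross_eq_bicross]
    simpa [h1] using key p u
  · refine ⟨-1, hφ, hne, fun p u => ?_⟩
    rw [cross_eq_bicross]
    have := key p u
    rw [h1, neg_one_smul] at this
    simp [this]

end Constancy

/-! ### Rotated almost complex curves -/

section Rotation

/-- When all three scalar products vanish, the polarized double product formula reduces to
anti-associativity. -/
theorem bicross_bicross_of_orthogonal {v f X : E7} (hvf : dot v f = 0) (hvX : dot v X = 0)
    (hfX : dot f X = 0) : bicross (bicross v f) X = -bicross v (bicross f X) := by
  rw [bicross_anticomm, bicross_bicross_swap, bicross_anticomm X f, bicross_neg_right,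
    dot_comm X f, hfX, hvf, dot_comm X v, hvX]
  simp

/-- For `v` a unit vector, `f, X, Z = f × X` orthogonal to `v` and `f` orthogonal to `X`, the map
`x ↦ cos β x - sin β v × x` and the cross product. -/
theorem bicross_rotated {v f X : E7} (hv : dot v v = 1) (hvf : dot v f = 0) (hvX : dot v X = 0)
    (hfX : dot f X = 0) (hvZ : dot v (bicross f X) = 0) (c s : ℝ) :
    bicross (c • f - s • bicross v f) (c • X - s • bicross v X) =
      (c ^ 2 - s ^ 2) • bicross f X + (2 * s * c) • bicross v (bicross f X) := by
  have e1 : bicross f (bicross v X) = -bicross v (bicross f X) := by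
    rw [bicross_bicross_swap, hvX, hfX, dot_comm f v, hvf]
    simp
  have e2 := bicross_bicross_of_orthogonal hvf hvX hfX
  have e3 : bicross (bicross v f) (bicross v X) = -bicross f X := by
    rw [bicross_bicross_swap, e2, hvX, bicross_neg_right, bicross_bicross_self, hvZ, hv,
      dot_comm (bicross v f) v, dot_bicross_left, dot_comm (bicross v f) X, dot_bicross_cyclic, hvZ]
    rw [dot_bicross_cyclic] at hvZ
    simp
  -- With `J = v × ·`, the relations `e1`, `e2`, `e3` say that the product is conjugate linear in
  -- each factor. Two factors `c - sJ` therefore come out as `(c + sJ)² = c² - s² + 2scJ`.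
  simp only [bicross_sub_left, bicross_sub_right, bicross_smul_left, bicross_smul_right, e1, e2, e3]
  module

theorem rotation_rotated {v f : E7} (hv : dot v v = 1) (hvf : dot v f = 0) (β : ℝ) :
    rotation v β (Real.cos β • f - Real.sin β • bicross v f) = f := by
  have h1 : ⟪v, Real.cos β • f - Real.sin β • bicross v f⟫_ℝ = 0 := by
    rw [inner_eq_dot_real, dot_sub_right, dot_smul_right, dot_smul_right, hvf, dot_bicross_left]
    ring
  rw [rotation, h1, cross_eq_bicross, bicross_sub_right, bicross_smul_right, bicross_smul_right,
    bicross_bicross_self, hvf, hv]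
  have h2 := Real.sin_sq_add_cos_sq β
  match_scalars
  all_goals first
    | linear_combination h2
    | linear_combination (0 : ℝ) * h2

end Rotation

/-! ### Linear fullness in a totally geodesic five-sphere -/

section Full

/-- The complement of the frame is two-dimensional and contains `v`, `v × f` and `w`, so `w` is
locally a multiple of `v × f`. Then the constant vector `v × w` is a multiple of the moving vector
`f`, which is possible only if it is zero. -/
theorem IsHarmonicChart.eq_zero_of_orthogonal {T : Set ℂ} {f : ℂ → C7} (h : IsHarmonicChart T f)
    {x : ℂ} (hx : x ∈ T) (hA : ∀ y ∈ T, dot (del (del f) y) (del (del f) y) = 0)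
    (h2 : second f x ≠ 0) {v w : C7} (hvc : cj v = v) (hwc : cj w = w) (hv : dot v v = 1)
    (hvf : ∀ y ∈ T, dot v (f y) = 0) (hvz : ∀ y ∈ T, dot v (bicross (f y) (del f y)) = 0)
    (hvw : dot v w = 0) (hwf : ∀ y ∈ T, dot w (f y) = 0) : w = 0 := by
  have ortho : ∀ {u : C7} (k : ℂ → C7), ContDiffOn ℝ ∞ k T → (∀ y ∈ T, dot u (k y) = 0) →
      ∀ y ∈ T, dot u (del k y) = 0 := by
    intro u k hk h0 y hy
    have h1 := h.del_eq_of_eqOn (g := fun y => dot u (k y)) (k := fun _ => 0) h0 hy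
    rw [del_const, del_dot (differentiableAt_const u) (h.dAt hk hy), del_const, dot_zero_left,
      zero_add] at h1
    exact h1
  have mem : ∀ {u : C7}, cj u = u → ∀ y ∈ T, dot u (f y) = 0 → dot u (del f y) = 0 →
      dot u (del (del f) y) = 0 → u ∈ IsIsotropicFrame.normal (f y) (del f y) (second f y) := by
    intro u hu y hy h0 h1 h3
    have hs : dot u (second f y) = 0 := by
      rw [second, dot_sub_right, dot_smul_right, h1, h3, mul_zero, sub_zero]
    have c : ∀ {z : C7}, dot u z = 0 → dot (cj z) u = 0 := fun {z} hz => by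
      rw [dot_comm, ← hu, ← conj_dot, hz, map_zero]
    exact ⟨by rw [dot_comm, h0], by rw [dot_comm, h1], c h1, by rw [dot_comm, hs], c hs⟩
  have hmv : ∀ {u : C7}, cj u = u → (∀ y ∈ T, dot u (f y) = 0) → ∀ y ∈ T,
      u ∈ IsIsotropicFrame.normal (f y) (del f y) (second f y) := fun hu h0 y hy =>
    mem hu y hy (h0 y hy) (ortho f h.smooth h0 y hy)
      (ortho (del f) h.smooth_del (ortho f h.smooth h0) y hy)
  have hvf1 : ∀ y ∈ T, dot (bicross v (f y)) (del f y) = 0 := fun y hy => by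
    rw [dot_comm, dot_bicross_cyclic, hvz y hy]
  have hmb : ∀ y ∈ T, bicross v (f y) ∈ IsIsotropicFrame.normal (f y) (del f y) (second f y) := by
    intro y hy
    refine mem (by rw [cj_bicross, hvc, h.real y hy]) y hy (by rw [dot_comm, dot_bicross_right])
      (hvf1 y hy) ?_
    have h1 := ortho (fun y => bicross (f y) (del f y)) (contDiffOn_bicross h.smooth h.smooth_del)
      hvz y hy
    rw [del_bicross (h.dAt h.smooth hy) (h.dAt h.smooth_del hy), bicross_self, zero_add] at h1
    rw [dot_comm, dot_bicross_cyclic, h1]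
  have hv0 : v ≠ 0 := fun h0 => by simp [h0] at hv
  have hnb : ∀ y ∈ T, dot (bicross v (f y)) (bicross v (f y)) = 1 := fun y hy => by
    rw [dot_bicross_bicross, hv, h.unit y hy, hvf y hy]; ring
  have hev : ∀ᶠ y in 𝓝 x, w = dot (bicross v (f y)) w • bicross v (f y) := by
    filter_upwards [h.isOpen.mem_nhds hx,
      (h.dAt h.smooth_second hx).continuousAt.eventually_ne h2] with y hy h2y
    have hb0 : bicross v (f y) ≠ 0 := fun h0 => by simpa [h0] using hnb y hy
    rw [← sub_eq_zero]
    refine (h.isIsotropicFrame hy (hA y hy)).eq_zero h2y hv0 hb0 ?_ (hmv hvc hvf y hy) (hmb y hy)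
      (sub_mem (hmv hwc hwf y hy) (Submodule.smul_mem _ _ (hmb y hy))) ?_ ?_
    · rw [hvc, dot_bicross_left]
    · rw [hvc, dot_sub_right, dot_smul_right, hvw, dot_bicross_left]; ring
    · rw [cj_bicross, hvc, h.real y hy, dot_sub_right, dot_smul_right, hnb y hy]; ring
  have hev2 : (fun _ => bicross v w) =ᶠ[𝓝 x] fun y => dot (bicross v w) (f y) • f y := by
    filter_upwards [hev, h.isOpen.mem_nhds hx] with y hy hyT
    have h1 : bicross v w = -dot (bicross v (f y)) w • f y := by
      conv_lhs => rw [hy]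
      rw [bicross_smul_right, bicross_bicross_self, hv, hvf y hyT]
      module
    rw [h1, dot_smul_left, h.unit y hyT, mul_one]
  -- Differentiating the constant vector and pairing with `f̄_z`, which is orthogonal to `f`,
  -- isolates the coefficient of `f`.
  have h3 := del_congr hev2
  have hfd := h.dAt h.smooth hx
  have hdd : DifferentiableAt ℝ (fun y => dot (bicross v w) (f y)) x :=
    ((dotL (bicross v w)).restrictScalars ℝ).differentiableAt.comp x hfd
  have h0 := hev2.self_of_nhds
  simp only at h0
  rw [del_const, del_smul hdd hfd]
    at h3
  have h4 := congrArg (dot (cj (del f x))) h3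
  rw [dot_zero_right, dot_add_right, dot_smul_right, dot_smul_right, dot_comm (cj (del f x)) (f x),
    h.dot_cj_del hx, dot_comm (cj (del f x))] at h4
  have h5 : dot (bicross v w) (f x) = 0 := by
    have := h.energy_ne_zero hx
    rw [energy] at this
    simpa [this] using h4.symm
  rw [h5, zero_smul] at h0
  have h6 := bicross_bicross_self v w
  rw [h0, bicross_zero_right, hvw, hv] at h6
  simpa using h6.symm

end Full

theorem toC_add_I_smul_eq_zero {x y : E7} (h : toC x + Complex.I • toC y = 0) :
    x = 0 ∧ y = 0 := by
  have h1 : ∀ i, ((x i : ℝ) : ℂ) + Complex.I * (y i : ℝ) = 0 := fun i => by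
    simpa using congrArg (fun z : C7 => z i) h
  exact ⟨PiLp.ext fun i => (eq_zero_of_re_add_im rfl (h1 i)).1,
    PiLp.ext fun i => (eq_zero_of_re_add_im rfl (h1 i)).2⟩

/-! ### The totally geodesic case -/

section Classification

variable {M : Type*} [TopologicalSpace M] [ChartedSpace ℂ M] [IsManifold 𝓘(ℂ) ω M]
  {φ : M → E7} (hφ : IsSmoothIntoS6 φ) (hharm : IsHarmonicMap φ)
    (hconf : IsConformalImmersion φ)
include hφ hharm hconf

/-- When `f₂ = 0`, `f_zz` is a multiple of `f_z`. Its real and imaginary parts put `f_yy + |f_x|² f`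
and `f_xy` in the tangent plane, and harmonicity then handles `f_xx`. -/
theorem isTotallyGeodesic_of_second_eq_zero
    (h0 : ∀ p, second (chartMap φ p) (chartAt ℂ p p) = 0) : IsTotallyGeodesic φ := by
  intro p u v
  have hP := D2_add_D2 hφ hharm hconf p
  obtain ⟨c, h1⟩ : ∃ c : ℂ, del (del (chartMap φ p)) (chartAt ℂ p p) =
      c • del (chartMap φ p) (chartAt ℂ p p) :=
    ⟨_, by have := IsHarmonicChart.del_del_eq (f := chartMap φ p) (chartAt ℂ p p)
           rwa [h0, zero_add] at this⟩
  rw [del_del_chartMap_self hφ.smooth, del_chartMap_self hφ.smooth] at h1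
  obtain ⟨r, t, rfl⟩ : ∃ r t : ℝ, c = r + t * Complex.I :=
    ⟨c.re, c.im, (Complex.re_add_im c).symm⟩
  obtain ⟨hx, hy⟩ := toC_add_I_smul_eq_zero
    (x := -((1 / 2 : ℝ) • (⟪D φ p 1, D φ p 1⟫_ℝ • φ p + D2 φ p Complex.I Complex.I +
      (r • D φ p 1 + t • D φ p Complex.I))))
    (y := -((1 / 2 : ℝ) • (D2 φ p 1 Complex.I + (t • D φ p 1 - r • D φ p Complex.I)))) (by
      rw [hP] at h1
      rw [← sub_eq_zero.2 h1]
      simp only [map_neg, map_add, map_sub, map_smul, ← Complex.coe_smul]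
      push_cast
      match_scalars <;> first
        | ring1
        | linear_combination -(t / 2 : ℂ) * Complex.I_mul_I)
  have hφm : φ p ∈ Submodule.span ℝ {φ p} ⊔ LinearMap.range (D φ p).toLinearMap :=
    Submodule.mem_sup_left (Submodule.mem_span_singleton_self _)
  have hDm : ∀ w, D φ p w ∈ Submodule.span ℝ {φ p} ⊔ LinearMap.range (D φ p).toLinearMap :=
    fun w => Submodule.mem_sup_right ⟨w, rfl⟩
  have hR : D2 φ p Complex.I Complex.I = -(⟪D φ p 1, D φ p 1⟫_ℝ • φ p +
      (r • D φ p 1 + t • D φ p Complex.I)) := by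
    rw [neg_eq_zero, smul_eq_zero_iff_right (by norm_num)] at hx
    rw [← sub_eq_zero, ← hx]
    module
  have hQ : D2 φ p 1 Complex.I = -(t • D φ p 1 - r • D φ p Complex.I) := by
    rw [neg_eq_zero, smul_eq_zero_iff_right (by norm_num)] at hy
    exact eq_neg_of_add_eq_zero_left hy
  rw [D2_apply_eq hφ, hP, hQ, hR]
  have h1 := hDm 1
  have h2 := hDm Complex.I
  generalize Submodule.span ℝ {φ p} ⊔ LinearMap.range (D φ p).toLinearMap = S at *
  have hR' := S.neg_mem (S.add_mem (S.smul_mem ⟪D φ p 1, D φ p 1⟫_ℝ hφm)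
    (S.add_mem (S.smul_mem r h1) (S.smul_mem t h2)))
  exact S.add_mem (S.add_mem (S.smul_mem _ (S.sub_mem (S.smul_mem _ hφm) hR'))
    (S.smul_mem _ (S.neg_mem (S.sub_mem (S.smul_mem _ h1) (S.smul_mem _ h2)))))
    (S.smul_mem _ hR')

end Classification

/-! ### Rotation to an almost complex curve in `S⁵` -/

section RotatedCase

variable {M : Type*} [TopologicalSpace M] [ChartedSpace ℂ M]

theorem D_clm_comp {s : M → E7} (hs : ContMDiff 𝓘(ℝ, ℂ) 𝓘(ℝ, E7) ∞ s) (L : E7 →L[ℝ] E7) (p : M)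
    (u : ℂ) : D (fun q => L (s q)) p u = L (D s p u) := by
  have h1 : MDifferentiableAt 𝓘(ℝ, ℂ) 𝓘(ℝ, E7) s p := hs.mdifferentiableAt (by simp)
  have h2 : MDifferentiableAt 𝓘(ℝ, E7) 𝓘(ℝ, E7) L (s p) :=
    L.differentiableAt.mdifferentiableAt
  have h3 := mfderiv_comp p h2 h1
  rw [mfderiv_eq_fderiv, L.fderiv] at h3
  exact congrArg (fun T : ℂ →L[ℝ] E7 => T u) h3

variable [IsManifold 𝓘(ℂ) ω M] {φ : M → E7} (hφ : IsSmoothIntoS6 φ) (hharm : IsHarmonicMap φ)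
    (hconf : IsConformalImmersion φ)
include hφ hharm hconf

/-- The component of the image of `φ` in the direction `v = - φ × n / |φ × n|`, and the action of
the complex structure. -/
theorem orthogonality_of_bicross_unitNormal {v : E7} {k r : ℝ} (hr : r ≠ 0) {p : M}
    (hk : dot (φ p) (unitNormal φ p) = k)
    (hS : bicross (φ p) (unitNormal φ p) = -r • v) :
    dot v (φ p) = 0 ∧ (∀ u, dot v (D φ p u) = 0) ∧ (∀ u, dot v (bicross (φ p) (D φ p u)) = 0) ∧
      ∀ u, D φ p (Complex.I * u) =
        k • bicross (φ p) (D φ p u) + r • bicross v (bicross (φ p) (D φ p u)) := by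
  have hff := (isHarmonicJet hφ hharm hconf p).ff
  have hv : ∀ x : E7, dot x (bicross (φ p) (unitNormal φ p)) = 0 → dot v x = 0 := by
    intro x hx
    rw [hS, dot_smul_right, dot_comm] at hx
    simpa [hr] using hx
  have h1 : dot v (φ p) = 0 := hv _ (dot_bicross_left _ _)
  have h2 : ∀ u, dot v (D φ p u) = 0 := fun u => hv _ (by
    rw [dot_bicross_cyclic, unitNormal_bicross hconf, dot_D hφ hharm hconf])
  refine ⟨h1, h2, fun u => hv _ ?_, fun u => ?_⟩
  · rw [dot_bicross_bicross, dot_D hφ hharm hconf, dot_comm, dot_comm (D φ p u),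
      dot_unitNormal_D]
    ring
  · have h3 := bicross_bicross_self (φ p) (unitNormal φ p)
    rw [hS, hk, hff, one_smul, bicross_smul_right] at h3
    have h4 : unitNormal φ p = k • φ p + r • bicross (φ p) v := by
      rw [eq_comm, ← sub_eq_zero, ← sub_eq_zero.2 h3.symm]
      module
    rw [← unitNormal_bicross hconf, h4, bicross_add_left, bicross_smul_left, bicross_smul_left,
      bicross_anticomm (φ p) v, bicross_neg_left,
      bicross_bicross_of_orthogonal h1 (h2 u) (dot_D hφ hharm hconf p u), neg_neg]

/-- The complement of the span is the line of `v`: a vector orthogonal to `v` and to the rotated map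
becomes, after the inverse rotation `c + s v × ·`, orthogonal to `v` and `φ`, and
`eq_zero_of_orthogonal` applies. -/
theorem finrank_span_range_eq {v : E7} (hv : dot v v = 1) {r : ℝ} (hr : r ≠ 0)
    (hA : ∀ p, CondA φ p) (hS : ∀ p, bicross (φ p) (unitNormal φ p) = -r • v)
    (hne : ∃ p, second (chartMap φ p) (chartAt ℂ p p) ≠ 0) {c s : ℝ} (hcs : s ^ 2 + c ^ 2 = 1) :
    Module.finrank ℝ (Submodule.span ℝ
      (Set.range fun p => c • φ p - s • bicross v (φ p))) = 6 := by
  obtain ⟨p, hp⟩ := hne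
  have h := isHarmonicChart hφ hharm hconf p
  have hvφ : ∀ q, dot v (φ q) = 0 := fun q =>
    (orthogonality_of_bicross_unitNormal hφ hharm hconf hr rfl (hS q)).1
  have hreal : ∀ {w : E7}, (∀ q, dot w (φ q) = 0) → ∀ y ∈ (chartAt ℂ p).target,
      dot (toC w) (chartMap φ p y) = 0 := fun {w} hw y _ => by
    rw [chartMap, dot_toC, inner_eq_dot_real]
    exact_mod_cast hw _
  have key : ∀ w : E7, dot v w = 0 → (∀ q, dot w (φ q) = 0) → w = 0 := by
    intro w hvw hw
    apply toC_injective
    rw [map_zero]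
    refine h.eq_zero_of_orthogonal (v := toC v) (mem_chart_target ℂ p)
      (fun y hy => (condA_iff hφ hharm hconf hy).1 (hA _)) hp (cj_toC v) (cj_toC w) ?_
      (hreal hvφ) ?_ ?_ (hreal hw)
    · rw [dot_toC, inner_eq_dot_real, hv]; simp
    · intro y hy
      have h1 : bicross (chartMap φ p y) (normalDir (chartMap φ p) y) = (-r : ℂ) • toC v := by
        rw [← normalDir_of_mem_target hφ hconf hy]
        change bicross (toC (φ ((chartAt ℂ p).symm y))) _ = _
        rw [← toC_cross, cross_eq_bicross, hS, map_smul, ← Complex.coe_smul]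
        simp
      -- Since `f_z` is orthogonal to `f` and `n`, the vectors `f × n` and `f × f_z` are orthogonal;
      -- the first is a nonzero multiple of `v`.
      have h2 := dot_bicross_bicross (chartMap φ p y) (normalDir (chartMap φ p) y)
        (del (chartMap φ p) y)
      rw [h1, dot_smul_left, h.dot_del hy, dot_comm _ (del (chartMap φ p) y),
        IsHarmonicChart.dot_normalDir] at h2
      have hr' : (r : ℂ) ≠ 0 := by exact_mod_cast hr
      simpa [hr'] using h2
    · rw [dot_toC, inner_eq_dot_real, hvw]; simp
  set S := Submodule.span ℝ (Set.range fun p => c • φ p - s • bicross v (φ p)) with hSdef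
  have hmem : ∀ w, w ∈ Sᗮ ↔ ∀ q, dot (c • φ q - s • bicross v (φ q)) w = 0 := by
    intro w
    rw [Submodule.mem_orthogonal]
    constructor
    · intro hw q
      rw [← inner_eq_dot_real]
      exact hw _ (Submodule.subset_span ⟨q, rfl⟩)
    · intro hw u hu
      induction hu using Submodule.span_induction with
      | mem x hx => obtain ⟨q, rfl⟩ := hx; rw [inner_eq_dot_real]; exact hw q
      | zero => simp
      | add x y _ _ hx hy => rw [inner_add_left, hx, hy, add_zero]
      | smul a x _ hx => rw [inner_smul_left, hx, mul_zero]
  have hv0 : v ≠ 0 := fun h0 => by simp [h0] at hv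
  have hperp : Sᗮ = Submodule.span ℝ {v} := by
    apply le_antisymm
    · intro w hw
      rw [hmem] at hw
      set w₀ := w - dot v w • v with hw₀
      have h1 : dot v w₀ = 0 := by rw [hw₀, dot_sub_right, dot_smul_right, hv]; ring
      have h2 : ∀ q, dot (c • w₀ + s • bicross v w₀) (φ q) = 0 := by
        intro q
        have h3 := hw q
        rw [dot_sub_left, dot_smul_left, dot_smul_left, dot_comm (bicross v (φ q)),
          dot_bicross_cyclic w, dot_bicross_cyclic v] at h3
        rw [hw₀]
        simp only [bicross_sub_right, bicross_smul_right, bicross_self, dot_add_left, dot_sub_left,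
          dot_smul_left, hvφ q, mul_zero, sub_zero, smul_zero]
        rw [dot_comm w, dot_comm (bicross v w), bicross_anticomm v w, dot_neg_right]
        linear_combination h3
      have h3 := key (c • w₀ + s • bicross v w₀)
        (by rw [dot_add_right, dot_smul_right, dot_smul_right, h1, dot_bicross_left]; ring) h2
      have h4 := congrArg (bicross v) h3
      rw [bicross_add_right, bicross_smul_right, bicross_smul_right, bicross_bicross_self, h1, hv,
        bicross_zero_right] at h4
      have h5 : w₀ = 0 := by
        have h6 : (s ^ 2 + c ^ 2) • w₀ = c • (c • w₀ + s • bicross v w₀) -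
            s • (c • bicross v w₀ + s • ((0 : ℝ) • v - (1 : ℝ) • w₀)) := by module
        rwa [h3, h4, hcs, one_smul, smul_zero, smul_zero, sub_zero] at h6
      exact Submodule.mem_span_singleton.2 ⟨_, (sub_eq_zero.1 h5).symm⟩
    · rw [Submodule.span_singleton_le_iff_mem, hmem]
      intro q
      rw [dot_comm, dot_sub_right, dot_smul_right, dot_smul_right, hvφ, dot_bicross_left]
      ring
  have h1 := Submodule.finrank_add_finrank_orthogonal S
  rw [hperp, finrank_span_singleton hv0, finrank_euclideanSpace_fin] at h1
  omega

/-- If `φ` is not parallel to its normal direction and not totally geodesic, then it is obtained by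
a rotation from an almost complex curve in a totally geodesic `S⁵`. -/
theorem exists_rotation_of_bicross_ne_zero [PreconnectedSpace M] (hA : ∀ p, CondA φ p)
    (hB : ∀ p, CondB φ p) {p₀ : M} (h0 : bicross (φ p₀) (unitNormal φ p₀) ≠ 0)
    (hne : ∃ p, second (chartMap φ p) (chartAt ℂ p p) ≠ 0) :
    ∃ (v : E7) (β : ℝ) (ψ : M → E7), ‖v‖ = 1 ∧ IsAlmostComplexCurveIII 1 ψ ∧
      (∀ p, ⟪v, ψ p⟫_ℝ = 0) ∧ ∀ p, φ p = rotation v β (ψ p) := by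
  have : Nonempty M := ⟨p₀⟩
  set N := bicross (φ p₀) (unitNormal φ p₀) with hN
  set k := dot (φ p₀) (unitNormal φ p₀) with hk
  have hr : ‖N‖ ≠ 0 := norm_ne_zero_iff.2 h0
  have hNN : dot N N = ‖N‖ ^ 2 := by rw [← inner_eq_dot_real, real_inner_self_eq_norm_sq]
  have hkr : k ^ 2 + ‖N‖ ^ 2 = 1 := by
    rw [← hNN, hN, dot_bicross_bicross, (isHarmonicJet hφ hharm hconf p₀).ff,
      dot_unitNormal_self hconf, ← hk]
    ring
  -- This sign makes the coefficient of `v × (φ × dφ)` equal to `+‖N‖`, the nonnegative sine of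
  -- `arccos k`.
  set v := -(‖N‖⁻¹ • N) with hv
  have hNv : N = -‖N‖ • v := by rw [hv, neg_smul_neg, smul_smul, mul_inv_cancel₀ hr, one_smul]
  have hvv : dot v v = 1 := by
    rw [hv, dot_neg_left, dot_neg_right, dot_smul_left, dot_smul_right, hNN]
    field_simp
  have hS : ∀ p, bicross (φ p) (unitNormal φ p) = -‖N‖ • v := fun p => by
    rw [← hNv, hN, bicross_unitNormal_eq hφ hharm hconf hA hB p p₀]
  have hor := fun p => orthogonality_of_bicross_unitNormal hφ hharm hconf hr
    (dot_unitNormal_eq hφ hharm hconf hA hB p p₀) (hS p)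
  rw [← hk] at hor
  -- With `J = v × ·`, the complex structure reads `dφ(iu) = (cos 3β + sin 3β J)(φ × dφ(u))`.
  -- Applying `cos β - sin β J` leaves the angle `2β`, which by `bicross_rotated` is the angle
  -- acquired by the product of two vectors rotated by `-β`.
  set β := Real.arccos k / 3 with hβ
  have h3 : 3 * β = Real.arccos k := by rw [hβ]; ring
  have hcos : 4 * Real.cos β ^ 3 - 3 * Real.cos β = k := by
    rw [← Real.cos_three_mul, h3, Real.cos_arccos] <;> nlinarith [sq_nonneg ‖N‖]
  have hsin : 3 * Real.sin β - 4 * Real.sin β ^ 3 = ‖N‖ := by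
    rw [← Real.sin_three_mul, h3, Real.sin_arccos, ← hkr, add_sub_cancel_left,
      Real.sqrt_sq (norm_nonneg _)]
  have hcs := Real.sin_sq_add_cos_sq β
  set c := Real.cos β with hc
  set s := Real.sin β with hs
  set L : E7 →L[ℝ] E7 := c • ContinuousLinearMap.id ℝ E7 - s • bicrossL v with hL
  have hLa : ∀ x, L x = c • x - s • bicross v x := fun x => rfl
  have hrot : ∀ p, φ p = rotation v β (L (φ p)) := fun p => by
    rw [hLa, hc, hs, rotation_rotated hvv (hor p).1]
  refine ⟨v, β, fun p => L (φ p), ?_, ⟨⟨⟨?_, fun p => ?_⟩, ?_, fun p u => ?_⟩, ?_⟩, fun p => ?_, hrot⟩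
  · rw [← sq_eq_sq₀ (norm_nonneg _) zero_le_one, ← real_inner_self_eq_norm_sq, inner_eq_dot_real,
      hvv, one_pow]
  · exact L.contDiff.contMDiff.comp hφ.smooth
  · have hff := (isHarmonicJet hφ hharm hconf p).ff
    rw [mem_sphere_zero_iff_norm, ← sq_eq_sq₀ (norm_nonneg _) zero_le_one,
      ← real_inner_self_eq_norm_sq, inner_eq_dot_real, hLa]
    simp only [dot_sub_left, dot_sub_right, dot_smul_left, dot_smul_right, dot_bicross_right,
      dot_bicross_bicross, hvv, hff, (hor p).1, dot_comm (bicross v (φ p)) (φ p)]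
    linear_combination hcs
  · obtain ⟨p, q, hpq⟩ := exists_ne (φ := φ) hconf
    exact ⟨p, q, fun h => hpq (by rw [hrot p, hrot q, h])⟩
  · obtain ⟨o1, o2, o3, o4⟩ := hor p
    rw [D_clm_comp hφ.smooth, D_clm_comp hφ.smooth, cross_eq_bicross, hLa, hLa, hLa,
      bicross_rotated hvv o1 (o2 u) (dot_D hφ hharm hconf p u) (o3 u)]
    simp only [Units.val_one, Int.cast_one, one_mul, o4 u, bicross_add_right, bicross_smul_right,
      bicross_bicross_self, o3 u, hvv]
    rw [← hcos, ← hsin]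
    match_scalars
    · linear_combination (4 * (c ^ 2 - s ^ 2)) * hcs
    · linear_combination (-4 * s * c) * hcs
    · ring
  · exact finrank_span_range_eq hφ hharm hconf hvv hr hA hS hne hcs
  · change ⟪v, L (φ p)⟫_ℝ = 0
    rw [hLa, inner_eq_dot_real, dot_sub_right, dot_smul_right, dot_smul_right, (hor p).1,
      dot_bicross_left]
    ring

end RotatedCase

end CrossSurface

end

/-! ### The equivalence and the classification -/

open CrossSurface
theorem mainTheorem4 {M : Type*} [TopologicalSpace M] [T2Space M] [ConnectedSpace M]
    [ChartedSpace ℂ M] [IsManifold 𝓘(ℂ) ω M]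
    (φ F : M → E7) (hφ : IsSmoothIntoS6 φ) (hharm : IsHarmonicMap φ)
    (hconf : IsConformalImmersion φ) (hF : IsAssociatedSurface φ F) :
    (IsIsotropicImmersion F ↔
      IsPseudoUmbilical F ∧
        (IsZeroBundle (harmonicSeq φ 2) ∨ IsIsotropicLineBundle (harmonicSeq φ 2))) ∧
    (IsIsotropicImmersion F →
      ∃ ε : ℤˣ,
        IsAlmostComplexCurve ε φ ∨
        (∃ (v : E7) (β : ℝ) (ψ : M → E7), ‖v‖ = 1 ∧ IsAlmostComplexCurveIII ε ψ ∧
          (∀ p, ⟪v, ψ p⟫_ℝ = 0) ∧ ∀ p, φ p = rotation v β (ψ p)) ∨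
        IsTotallyGeodesic φ ∨
        (IsSuperminimal φ ∧
          ∃ W : Submodule ℝ E7, Module.finrank ℝ W = 5 ∧ ∀ p, φ p ∈ W)) := by
  rw [isIsotropicImmersion_iff hφ hharm hconf hF, isPseudoUmbilical_iff hφ hharm hconf hF,
    harmonicSeq_two_isotropic_iff hφ hharm hconf, forall_and]
  refine ⟨and_comm, fun ⟨hA, hB⟩ => ?_⟩
  by_cases h0 : ∀ p, bicross (φ p) (unitNormal φ p) = 0
  · obtain ⟨ε, hε⟩ := isAlmostComplexCurve_of_bicross_eq_zero hφ hharm hconf hA hB h0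
    exact ⟨ε, Or.inl hε⟩
  push Not at h0
  obtain ⟨p₀, h0⟩ := h0
  -- Fullness of the rotated curve needs a point where `f₂ ≠ 0`, so the totally geodesic case is
  -- split off beforehand.
  by_cases h2 : ∀ p, second (chartMap φ p) (chartAt ℂ p p) = 0
  · exact ⟨1, Or.inr (Or.inr (Or.inl (isTotallyGeodesic_of_second_eq_zero hφ hharm hconf h2)))⟩
  push Not at h2
  exact ⟨1, Or.inr (Or.inl (exists_rotation_of_bicross_ne_zero hφ hharm hconf hA hB h0 h2))⟩
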